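/- Let $p$ be $0$ or an odd prime. \emph{Spaces.} Let $X_{CT}$ be the standard Borel space of combinatorial trees (connected acyclic graphs) with vertex set $\mathbb N$; $S\sqsubseteq_{CT}T$ means that $S$ is isomorphic to an induced subgraph of $T$. Let $X_{Fld,p}$ be the standard Borel space of fields of characteristic $p$ with underlying set $\mathbb N$ (a Borel set of structures for the language $\{+,\cdot,0,1\}$); $K\sqsubseteq_{Fld,p}L$ means that there is a field homomorphism $K\to L$. \emph{Construction of $K_T$.} Let $F$ be a countable field of characteristic $p$, and let $p_0<p_1<\cdots$ be odd primes different from $p$. Assume that for every $n$, every $p_n$-high element of $F$ is algebraic over the prime field of $F$, where $k\in F\setminus\{0\}$ is called $q$-high if $x^{q^m}=k$ has a solution in $F$ for every $m\in\mathbb N$. (This holds for instance if $F$ is algebraic over its prime field.) For a field $K$, a set $S$ algebraically independent over $K$ and a prime $q$, let $K(S)(S,q)$ be the extension of $K(S)$ generated by elements $s(l)$ ($s\in S$, $l\in\mathbb N$) with $s(0)=s$ and $s(l+1)^q=s(l)$. Let $V=\{v_0,v_1,\dots\}$ be algebraically independent over $F$, with $v_i$ identified with the vertex $i$. For $T\in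 X_{CT}$ put $K_0(T)=F(V)(V,p_0)$ and $H_0(T)=\{u+v : (u,v)\text{ an edge of }T\}$. Given $K_n(T)$ and $H_n(T)$, let $t_n$ be transcendental over $K_n(T)$, let $L_n=K_n(T)(t_n)(\{t_n\},p_{n+1})$, let $K_{n+1}(T)$ be the splitting field over $L_n$ of the polynomials $x^2-(t_n-a)$, $a\in H_n(T)$, and let $H_{n+1}(T)$ consist of exactly one root of each of these polynomials. Let $K_T=\bigcup_n K_n(T)$. \emph{Theorem.} (1) For all $F$ and $(p_n)_n$ as above, $T\mapsto K_T$ can be realized as a Borel reduction from $\sqsubseteq_{CT}$ to $\sqsubseteq_{Fld,p}$: there is a Borel map $f\colon X_{CT}\to X_{Fld,p}$ such that $f(T)$ is isomorphic to $K_T$ for every $T$, and $S\sqsubseteq_{CT}T\iff f(S)\sqsubseteq_{Fld,p}f(T)$ for all $S,T$. (2) $\sqsubseteq_{Fld,p}$ is a complete analytic quasi-order: it is reflexive, transitive and an analytic subset of $X_{Fld,p}^2$, and for every analytic quasi-order $R$ on a standard Borel space $Y$ there is a Borel map $g\colon Y\to X_{Fld,p}$ with $x\mathrel R y\iff g(x)\sqsubseteq_{Fld,p}g(y)$.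 -/

import Mathlib

universe u w

/-! ### Analytic quasi-orders and Borel reducibility -/

/-- A subset of a standard Borel space `X` is analytic if it is the projection to `X` of a Borel
subset of `X × Y` for some Polish space `Y`. -/
def IsAnalyticSubset {X : Type u} [MeasurableSpace X] [StandardBorelSpace X]
    (A : Set X) : Prop :=
  ∃ (Y : Type) (_ : TopologicalSpace Y) (_ : PolishSpace Y) (_ : MeasurableSpace Y)
    (_ : BorelSpace Y) (B : Set (X × Y)),
    MeasurableSet B ∧ A = {x | ∃ y, (x, y) ∈ B}

/-- An analytic quasi-order on a standard Borel space. -/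
structure IsAnalyticQuasiOrder {X : Type u} [MeasurableSpace X] [StandardBorelSpace X]
    (Q : X → X → Prop) : Prop where
  refl : ∀ x, Q x x
  trans : ∀ x y z, Q x y → Q y z → Q x z
  analytic : IsAnalyticSubset {z : X × X | Q z.1 z.2}

/-- `f` is a Borel reduction from `P` to `Q`. -/
structure IsBorelReduction {X : Type u} {Y : Type w}
    [MeasurableSpace X] [StandardBorelSpace X] [MeasurableSpace Y] [StandardBorelSpace Y]
    (P : X → X → Prop) (Q : Y → Y → Prop) (f : X → Y) : Prop where
  measurable : Measurable f
  iff : ∀ x y, P x y ↔ Q (f x) (f y)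

/-- A complete analytic quasi-order: an analytic quasi-order to which every analytic quasi-order
on a standard Borel space is Borel reducible. -/
structure IsCompleteAnalyticQuasiOrder {X : Type u}
    [MeasurableSpace X] [StandardBorelSpace X] (Q : X → X → Prop) : Prop where
  isAnalyticQuasiOrder : IsAnalyticQuasiOrder Q
  complete : ∀ (Y : Type w) [MeasurableSpace Y] [StandardBorelSpace Y] (R : Y → Y → Prop),
    IsAnalyticQuasiOrder R → ∃ f : Y → X, IsBorelReduction R Q f

/-! ### The space of combinatorial trees with vertex set `ℕ` -/

/-- The space of combinatorial trees (connected acyclic graphs) with vertex set `ℕ`, with the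
Borel structure inherited from `2^(ℕ × ℕ)` through the edge relation. -/
abbrev CombTree : Type := {G : SimpleGraph ℕ // G.IsTree}

/-- Embeddability of combinatorial trees: there is an injection of the vertices that is an
isomorphism onto the induced subgraph on its image. -/
def CombTree.Embeds (S T : CombTree) : Prop := Nonempty (S.1 ↪g T.1)

theorem measurableSet_adj (u v : ℕ) : MeasurableSet {G : SimpleGraph ℕ | G.Adj u v} := by
  have h : Measurable (fun G : SimpleGraph ℕ => G.Adj u v) :=
    (measurable_pi_apply v).comp ((measurable_pi_apply u).comp (comap_measurable _))
  exact measurableSet_setOfPred.2 h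

theorem measurableSet_reachable (u v : ℕ) :
    MeasurableSet {G : SimpleGraph ℕ | G.Reachable u v} := by
  let R : ℕ → ℕ → Set (SimpleGraph ℕ) := fun n =>
    Nat.rec (fun v => {_G | u = v}) (fun _ Rn v => ⋃ w, Rn w ∩ {G | G.Adj w v}) n
  have hR : ∀ n v, MeasurableSet (R n v) := by
    intro n
    induction n with
    | zero => intro v; exact MeasurableSet.const _
    | succ n ih => intro v; exact MeasurableSet.iUnion fun w => (ih w).inter (measurableSet_adj w v)
  have : {G : SimpleGraph ℕ | G.Reachable u v} = ⋃ n, R n v := by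
    ext G
    simp only [Set.mem_ofPred_eq, SimpleGraph.reachable_iff_reflTransGen, Set.mem_iUnion]
    constructor
    · intro h
      induction h with
      | refl => exact ⟨0, rfl⟩
      | tail _ hbc ih =>
        obtain ⟨n, hn⟩ := ih
        exact ⟨n + 1, Set.mem_iUnion.2 ⟨_, hn, hbc⟩⟩
    · rintro ⟨n, hn⟩
      induction n generalizing v with
      | zero => obtain rfl : u = v := hn; exact .refl
      | succ n ih =>
        obtain ⟨w, hw, hwv⟩ := Set.mem_iUnion.1 hn
        exact (ih w hw).tail hwv
  rw [this]
  exact MeasurableSet.iUnion fun n => hR n v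

theorem measurableSet_isTree : MeasurableSet {G : SimpleGraph ℕ | G.IsTree} := by
  have : {G : SimpleGraph ℕ | G.IsTree} = {G | ∀ u v, G.Reachable u v} ∩
      {G | ∀ n, 3 ≤ n → ∀ g : Fin n → ℕ, Function.Injective g →
        ¬ ∀ a b, (SimpleGraph.cycleGraph n).Adj a b → G.Adj (g a) (g b)} := by
    ext G
    simp only [Set.mem_ofPred_eq, Set.mem_inter_iff, SimpleGraph.isTree_iff,
      SimpleGraph.connected_iff, SimpleGraph.isAcyclic_iff_free_cycleGraph]
    refine and_congr ⟨fun h => h.1, fun h => ⟨h, inferInstance⟩⟩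
      (forall₂_congr fun n _ => ⟨fun h g hg hadj => h ⟨⟨⟨g, fun {a b} => hadj a b⟩, hg⟩⟩,
        fun h ⟨c⟩ => h c c.injective fun a b => c.toHom.map_rel⟩)
  rw [this]
  refine MeasurableSet.inter ?_ ?_
  · simp only [Set.ofPred_forall]
    exact .iInter fun u => .iInter fun v => measurableSet_reachable u v
  · simp only [Set.ofPred_forall]
    refine .iInter fun n => .iInter fun _ => .iInter fun g => .iInter fun _ => ?_
    have h : MeasurableSet {G : SimpleGraph ℕ |
        ∀ a b, (SimpleGraph.cycleGraph n).Adj a b → G.Adj (g a) (g b)} := by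
      simp only [Set.ofPred_forall]
      exact .iInter fun a => .iInter fun b => .iInter fun _ => measurableSet_adj _ _
    exact h.compl

theorem standardBorelSpace_simpleGraph : StandardBorelSpace (SimpleGraph ℕ) := by
  let A : Set (ℕ → ℕ → Prop) := {r | (∀ u v, r u v → r v u) ∧ ∀ u, ¬ r u u}
  have hr : ∀ u v, MeasurableSet {r : ℕ → ℕ → Prop | r u v} := fun u v =>
    measurableSet_setOfPred.2 ((measurable_pi_apply v).comp (measurable_pi_apply u))
  have hA : MeasurableSet A := by
    have : A = (⋂ u, ⋂ v, ({r | r u v}ᶜ ∪ {r | r v u})) ∩ ⋂ u, {r | r u u}ᶜ := by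
      ext r
      simp [A, imp_iff_not_or]
    rw [this]
    exact (MeasurableSet.iInter fun u => .iInter fun v => (hr u v).compl.union (hr v u)).inter
      (.iInter fun u => (hr u u).compl)
  have := hA.standardBorel
  let e : SimpleGraph ℕ ≃ᵐ A :=
    { toFun := fun G => ⟨G.Adj, fun _ _ h => h.symm, fun u => G.loopless.irrefl u⟩
      invFun := fun r => ⟨r.1, ⟨r.2.1⟩, ⟨r.2.2⟩⟩
      left_inv := fun _ => rfl
      right_inv := fun _ => rfl
      measurable_toFun := (comap_measurable _).subtype_mk
      measurable_invFun := measurable_comap_iff.2 measurable_subtype_coe }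
  obtain ⟨τ, hb, hp⟩ := this.polish
  refine ⟨⟨.induced e τ, @BorelSpace.mk _ (.induced e τ) _ ?_, e.toEquiv.polishSpace_induced⟩⟩
  rw [borel_comap, ← hb.measurable_eq]
  exact e.measurableEmbedding.comap_eq.symm

instance : StandardBorelSpace CombTree :=
  haveI := standardBorelSpace_simpleGraph
  measurableSet_isTree.standardBorel

/-! ### The space of fields of characteristic `p` with domain `ℕ` -/

/-- Structures with domain `ℕ` for the language of fields: an addition, a multiplication, a zero
and a one. It carries the product Borel structure. -/
abbrev FieldStr : Type := (ℕ → ℕ → ℕ) × (ℕ → ℕ → ℕ) × ℕ × ℕ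

/-- The addition of a structure. -/
abbrev FieldStr.add (c : FieldStr) : ℕ → ℕ → ℕ := c.1
/-- The multiplication of a structure. -/
abbrev FieldStr.mul (c : FieldStr) : ℕ → ℕ → ℕ := c.2.1
/-- The zero of a structure. -/
abbrev FieldStr.zero (c : FieldStr) : ℕ := c.2.2.1
/-- The one of a structure. -/
abbrev FieldStr.one (c : FieldStr) : ℕ := c.2.2.2

/-- The structure `c` satisfies the axioms of fields of characteristic `p`. In the last clause
`(c.add c.one)^[n] c.zero` is the sum of `n` ones. -/
structure IsFieldStr (p : ℕ) (c : FieldStr) : Prop where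
  add_assoc : ∀ x y z, c.add (c.add x y) z = c.add x (c.add y z)
  add_comm : ∀ x y, c.add x y = c.add y x
  zero_add : ∀ x, c.add c.zero x = x
  exists_neg : ∀ x, ∃ y, c.add y x = c.zero
  mul_assoc : ∀ x y z, c.mul (c.mul x y) z = c.mul x (c.mul y z)
  mul_comm : ∀ x y, c.mul x y = c.mul y x
  one_mul : ∀ x, c.mul c.one x = x
  mul_add : ∀ x y z, c.mul x (c.add y z) = c.add (c.mul x y) (c.mul x z)
  zero_ne_one : c.zero ≠ c.one
  exists_inv : ∀ x, x ≠ c.zero → ∃ y, c.mul x y = c.one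
  char : ∀ n, (c.add c.one)^[n] c.zero = c.zero ↔ p ∣ n

/-- The space of fields of characteristic `p` with domain `ℕ`. -/
abbrev Fld (p : ℕ) : Type := {c : FieldStr // IsFieldStr p c}

theorem measurableSet_isFieldStr (p : ℕ) : MeasurableSet {c : FieldStr | IsFieldStr p c} := by
  have ev : ∀ {f : FieldStr → ℕ → ℕ → ℕ} {g h : FieldStr → ℕ},
      (∀ a b, Measurable fun c => f c a b) → Measurable g → Measurable h →
      Measurable fun c => f c (g c) (h c) := by
    intro f g h hf hg hh
    have hk : Measurable fun q : FieldStr × (ℕ × ℕ) => f q.1 q.2.1 q.2.2 :=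
      measurable_from_prod_countable_left fun k => hf k.1 k.2
    exact hk.comp (measurable_id.prodMk (hg.prodMk hh))
  have ha : ∀ {g h : FieldStr → ℕ}, Measurable g → Measurable h →
      Measurable fun c : FieldStr => c.add (g c) (h c) := ev (f := FieldStr.add) fun a b =>
    (measurable_pi_apply b).comp ((measurable_pi_apply a).comp measurable_fst)
  have hm : ∀ {g h : FieldStr → ℕ}, Measurable g → Measurable h →
      Measurable fun c : FieldStr => c.mul (g c) (h c) := ev (f := FieldStr.mul) fun a b =>
    (measurable_pi_apply b).comp ((measurable_pi_apply a).comp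
      (measurable_fst.comp measurable_snd))
  have h0 : Measurable fun c : FieldStr => c.zero :=
    measurable_fst.comp (measurable_snd.comp measurable_snd)
  have h1 : Measurable fun c : FieldStr => c.one :=
    measurable_snd.comp (measurable_snd.comp measurable_snd)
  have hk : ∀ x : ℕ, Measurable fun _ : FieldStr => x := fun x => measurable_const
  have hn : ∀ n : ℕ, Measurable fun c : FieldStr => (c.add c.one)^[n] c.zero := by
    intro n
    induction n with
    | zero => exact h0
    | succ n ih => simp only [Function.iterate_succ_apply']; exact ha h1 ih
  have eq : ∀ {g h : FieldStr → ℕ}, Measurable g → Measurable h →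
      MeasurableSet {c | g c = h c} := fun hg hh => measurableSet_eq_fun hg hh
  have key : {c : FieldStr | IsFieldStr p c} =
      {c | ∀ x y z, c.add (c.add x y) z = c.add x (c.add y z)} ∩
      {c | ∀ x y, c.add x y = c.add y x} ∩ {c | ∀ x, c.add c.zero x = x} ∩
      {c | ∀ x, ∃ y, c.add y x = c.zero} ∩
      {c | ∀ x y z, c.mul (c.mul x y) z = c.mul x (c.mul y z)} ∩
      {c | ∀ x y, c.mul x y = c.mul y x} ∩ {c | ∀ x, c.mul c.one x = x} ∩
      {c | ∀ x y z, c.mul x (c.add y z) = c.add (c.mul x y) (c.mul x z)} ∩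
      {c | c.zero = c.one}ᶜ ∩
      {c | ∀ x, x = c.zero ∨ ∃ y, c.mul x y = c.one} ∩
      {c | ∀ n, ((c.add c.one)^[n] c.zero = c.zero ↔ p ∣ n)} := by
    ext c
    constructor
    · rintro ⟨h1, h2, h3, h4, h5, h6, h7, h8, h9, h10, h11⟩
      exact ⟨⟨⟨⟨⟨⟨⟨⟨⟨⟨h1, h2⟩, h3⟩, h4⟩, h5⟩, h6⟩, h7⟩, h8⟩, h9⟩,
        fun x => or_iff_not_imp_left.2 (h10 x)⟩, h11⟩
    · rintro ⟨⟨⟨⟨⟨⟨⟨⟨⟨⟨h1, h2⟩, h3⟩, h4⟩, h5⟩, h6⟩, h7⟩, h8⟩, h9⟩, h10⟩, h11⟩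
      exact ⟨h1, h2, h3, h4, h5, h6, h7, h8, h9, fun x => or_iff_not_imp_left.1 (h10 x), h11⟩
  rw [key]
  simp only [Set.ofPred_forall, Set.ofPred_exists, Set.ofPred_or]
  refine .inter (.inter (.inter (.inter (.inter (.inter (.inter (.inter (.inter (.inter
    ?_ ?_) ?_) ?_) ?_) ?_) ?_) ?_) ?_) ?_) ?_
  · exact .iInter fun x => .iInter fun y => .iInter fun z =>
      eq (ha (ha (hk x) (hk y)) (hk z)) (ha (hk x) (ha (hk y) (hk z)))
  · exact .iInter fun x => .iInter fun y => eq (ha (hk x) (hk y)) (ha (hk y) (hk x))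
  · exact .iInter fun x => eq (ha h0 (hk x)) (hk x)
  · exact .iInter fun x => .iUnion fun y => eq (ha (hk y) (hk x)) h0
  · exact .iInter fun x => .iInter fun y => .iInter fun z =>
      eq (hm (hm (hk x) (hk y)) (hk z)) (hm (hk x) (hm (hk y) (hk z)))
  · exact .iInter fun x => .iInter fun y => eq (hm (hk x) (hk y)) (hm (hk y) (hk x))
  · exact .iInter fun x => eq (hm h1 (hk x)) (hk x)
  · exact .iInter fun x => .iInter fun y => .iInter fun z =>
      eq (hm (hk x) (ha (hk y) (hk z))) (ha (hm (hk x) (hk y)) (hm (hk x) (hk z)))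
  · exact (eq h0 h1).compl
  · exact .iInter fun x => (eq (hk x) h0).union (.iUnion fun y => eq (hm (hk x) (hk y)) h1)
  · refine .iInter fun n => ?_
    by_cases h : p ∣ n
    · simpa only [h, iff_true] using eq (hn n) h0
    · simp only [h, iff_false]
      exact (eq (hn n) h0).compl

instance (p : ℕ) : StandardBorelSpace (Fld p) := (measurableSet_isFieldStr p).standardBorel

/-- The domain `ℕ` of a point of `Fld p`, as a type that carries the field operations. -/
def Fld.Carrier {p : ℕ} (_ : Fld p) : Type := ℕ

theorem IsFieldStr.exists_inv_or {p : ℕ} {c : FieldStr} (h : IsFieldStr p c) (x : ℕ) :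
    ∃ y, (x = c.zero → y = c.zero) ∧ (x ≠ c.zero → c.mul x y = c.one) := by
  by_cases hx : x = c.zero
  · exact ⟨c.zero, fun _ => rfl, fun h => absurd hx h⟩
  · obtain ⟨y, hy⟩ := h.exists_inv x hx
    exact ⟨y, fun h => absurd h hx, fun _ => hy⟩

/-- The field coded by a point of `Fld p`: its addition, multiplication, zero and one are those
of the code. -/
noncomputable instance Fld.instField {p : ℕ} (K : Fld p) : Field (Fld.Carrier K) :=
  letI : Add (Fld.Carrier K) := ⟨K.1.add⟩
  letI : Mul (Fld.Carrier K) := ⟨K.1.mul⟩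
  letI : Zero (Fld.Carrier K) := ⟨K.1.zero⟩
  letI : One (Fld.Carrier K) := ⟨K.1.one⟩
  letI : Neg (Fld.Carrier K) := ⟨fun x => (K.2.exists_neg x).choose⟩
  letI : Inv (Fld.Carrier K) := ⟨fun x => (K.2.exists_inv_or x).choose⟩
  Field.ofMinimalAxioms (Fld.Carrier K) K.2.add_assoc K.2.zero_add
    (fun x => (K.2.exists_neg x).choose_spec) K.2.mul_assoc K.2.mul_comm K.2.one_mul
    (fun x => (K.2.exists_inv_or x).choose_spec.2)
    ((K.2.exists_inv_or K.1.zero).choose_spec.1 rfl) K.2.mul_add ⟨0, 1, K.2.zero_ne_one⟩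

theorem Fld.add_def {p : ℕ} (K : Fld p) (x y : Fld.Carrier K) : x + y = K.1.add x y := rfl
theorem Fld.mul_def {p : ℕ} (K : Fld p) (x y : Fld.Carrier K) : x * y = K.1.mul x y := rfl
theorem Fld.zero_def {p : ℕ} (K : Fld p) : (0 : Fld.Carrier K) = K.1.zero := rfl
theorem Fld.one_def {p : ℕ} (K : Fld p) : (1 : Fld.Carrier K) = K.1.one := rfl

instance Fld.instCharP {p : ℕ} (K : Fld p) : CharP K.Carrier p where
  cast_eq_zero_iff n := by
    rw [← K.2.char n]
    suffices h : (Nat.cast n : K.Carrier) = (K.1.add K.1.one)^[n] K.1.zero by rw [h]; rfl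
    induction n with
    | zero => exact Nat.cast_zero
    | succ n ih =>
      rw [Function.iterate_succ_apply', Nat.cast_succ, _root_.add_comm]
      exact congrArg (K.1.add K.1.one) ih

/-- Embeddability of fields: there is a (necessarily injective) field homomorphism. -/
def Fld.Embeds {p : ℕ} (K L : Fld p) : Prop := Nonempty (K.Carrier →+* L.Carrier)

/-! ### The construction `T ↦ K_T` of Fried and Kollár -/

/-- A nonzero element `k` of a field is `q`-high if it has a `q ^ n`-th root for every `n`. -/
def IsHigh {K : Type*} [Field K] (q : ℕ) (k : K) : Prop :=
  k ≠ 0 ∧ ∀ n : ℕ, ∃ x : K, x ^ q ^ n = k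

namespace FriedKollar

/-- An algebraic closure of `F(v_0, v_1, …, t_0, t_1, …)`, where the `v_i` and `t_n` are
algebraically independent over `F`. All the fields of the construction are built inside it. -/
abbrev Ambient (F : Type*) [Field F] : Type _ :=
  AlgebraicClosure (FractionRing (MvPolynomial (ℕ ⊕ ℕ) F))

variable (F : Type*) [Field F]

/-- The transcendental element `v_i`, identified with the vertex `i`. -/
noncomputable def v (i : ℕ) : Ambient F :=
  algebraMap (FractionRing (MvPolynomial (ℕ ⊕ ℕ) F)) (Ambient F)
    (algebraMap (MvPolynomial (ℕ ⊕ ℕ) F) _ (MvPolynomial.X (Sum.inl i)))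

/-- The transcendental element `t_n`. -/
noncomputable def t (n : ℕ) : Ambient F :=
  algebraMap (FractionRing (MvPolynomial (ℕ ⊕ ℕ) F)) (Ambient F)
    (algebraMap (MvPolynomial (ℕ ⊕ ℕ) F) _ (MvPolynomial.X (Sum.inr n)))

variable {F}

/-- A chosen `q`-th root of `x`. -/
noncomputable def root (q : ℕ) (x : Ambient F) : Ambient F :=
  Classical.epsilon fun y => y ^ q = x

theorem root_pow {q : ℕ} (hq : 0 < q) (x : Ambient F) : root q x ^ q = x :=
  Classical.epsilon_spec (IsAlgClosed.exists_pow_nat_eq x hq)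

/-- The sequence `s(0) = s`, `s(l + 1) ^ q = s(l)` of iterated `q`-th roots of `s`. -/
noncomputable def rootSeq (q : ℕ) (s : Ambient F) : ℕ → Ambient F
  | 0 => s
  | l + 1 => root q (rootSeq q s l)

variable (F)

/-- The sets `H_n(T)`: `H_0(T)` is the set of sums `u + v` for the edges `(u, v)` of `T`, and
`H_{n+1}(T)` consists of one square root `r_a` of `t_n - a` for each `a ∈ H_n(T)`. -/
noncomputable def H (T : CombTree) : ℕ → Set (Ambient F)
  | 0 => {x | ∃ i j, T.1.Adj i j ∧ x = v F i + v F j}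
  | n + 1 => (fun a => root 2 (t F n - a)) '' H T n

/-- The fields `K_n(T)`, for the sequence of primes `q`. First, `K_0(T)` is obtained from `F` by
adjoining the iterated `q_0`-th roots of all `v_i`. Then `K_{n+1}(T)` is obtained from `K_n(T)`
by adjoining the iterated `q_{n+1}`-th roots of `t_n` (which gives `L_n`) and all roots of the
polynomials `x ^ 2 - (t_n - a)` for `a ∈ H_n(T)`. -/
noncomputable def KStage (q : ℕ → ℕ) (T : CombTree) : ℕ → IntermediateField F (Ambient F)
  | 0 => IntermediateField.adjoin F {x | ∃ i l, x = rootSeq (q 0) (v F i) l}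
  | n + 1 => IntermediateField.adjoin F
      ((KStage q T n : Set (Ambient F)) ∪ {x | ∃ l, x = rootSeq (q (n + 1)) (t F n) l} ∪
        {x | ∃ a ∈ H F T n, x ^ 2 = t F n - a})

/-- The field `K_T`, the union of the chain of the fields `K_n(T)`. -/
noncomputable def KTree (q : ℕ → ℕ) (T : CombTree) : IntermediateField F (Ambient F) :=
  ⨆ n, KStage F q T n

theorem KStage_le_succ (q : ℕ → ℕ) (T : CombTree) (n : ℕ) :
    KStage F q T n ≤ KStage F q T (n + 1) := fun _ hx =>
  IntermediateField.subset_adjoin _ _ (Or.inl (Or.inl hx))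

theorem coe_KTree (q : ℕ → ℕ) (T : CombTree) :
    (KTree F q T : Set (Ambient F)) = ⋃ n, (KStage F q T n : Set (Ambient F)) :=
  IntermediateField.coe_iSup_of_directed
    (monotone_nat_of_le_succ (KStage_le_succ F q T)).directed_le

end FriedKollar

/-!
A homomorphism between two of the fields `K_S` and `K_T` is controlled by the elements that have
roots of all orders `q ^ n` for one of the primes `q`, and by the square roots.

*Radical steps.* Every field of the construction is the union of a tower of extensions of one kind
(`IsRadicalStep`): to a field `k` one adjoins all iterated `q`-th roots of an element `s` that is
transcendental over `k`, and square roots of `ε * (s - a)` for some distinct nonzero elements `a` of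
`k`. By Kummer theory, and as the polynomials `X ^ M - a` are separable and coprime, these square
roots are independent over the field generated by any of the iterated roots. It follows that `k` is
algebraically closed in the extension (`IsRadicalStep.mem_bot_of_isAlgebraic`); that for a prime
`q'` other than `2` and `q` all `q'`-high elements of the extension lie in `k`, since the degrees
that occur are products of powers of `2` and `q` up to a bounded factor
(`IsRadicalStep.mem_bot_of_isHighIn`); that in the absence of square roots a `q`-high element is a
high element of `k` times a power of a root of `s` (`IsRadicalStep.exists_eq_mul_zpow_of_isHighIn`);
and that, with square roots for arbitrary `a`, an element `c * s_l ^ m - A` is a square only if `A`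
is `c` times a power of some `a` (`IsRadicalStep.exists_of_mul_zpow_sub_eq_sq`). Moreover,
homomorphisms extend along a radical step as soon as the images of the generators satisfy the same
equations (`IsRadicalStep.exists_ringHom`), which yields a homomorphism `K_S → K_T` for each
embedding of `S` in `T` (`FriedKollar.exists_ringHom_of_embeds`).

*From homomorphisms to embeddings.* Let `φ : K_S → K_T`. As the elements `v_i` and `t_0` are high,
so are their images. Hence the `φ(v_i)` are Laurent monomials in roots of the `v_j`
(`FriedKollar.IsHighIn.exists_isMonomial`). The field `K_1(T)` can also be built by adjoining `t_0`
before the `v_j`, which shows that `φ(t_0)` is `c * s ^ m` for a constant `c` and a root `s` of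
`t_0` (`FriedKollar.IsHighIn.exists_eq_mul_zpow`). Here `m ≠ 0`, as otherwise `φ(t_0)` would be
algebraic over the prime field by the assumption on the high elements of `F`. For an edge `(v_i,
v_j)` of `S`, the element `φ(t_0) - (φ(v_i) + φ(v_j))` is a square, so that `φ(v_i) + φ(v_j) = c *
(v_u + v_u') ^ N` for an edge `(v_u, v_u')` of `T`, where `N` depends on `φ(t_0)` only. A sum of two
monomials has this form only if they are `c * v_u ^ N` and `c * v_u' ^ N` (`IsMonomial.add_eq`).
Thus `φ` induces an injective homomorphism of graphs from `S` to `T`, and for trees this is an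
embedding (`SimpleGraph.Hom.adj_of_adj`, `FriedKollar.embeds_of_ringHom`).

*Borel coding.* All the fields `K_T` lie in one countable field, and membership of a fixed element
in `K_T` is a Borel condition on `T` (`FriedKollar.measurableSet_mem_KTree`). Such a family of
subfields can be coded in a Borel way by fields with domain `ℕ` (`exists_measurable_fld`).

*Completeness.* By the first part it suffices to reduce an analytic quasi-order `R` to the
embeddability of trees, in the manner of Louveau and Rosendal. One may take `R`, up to equality, to
be the range of a continuous map `f` on the Baire space. Let `Chain f n x y a` say that `x` and `y`
are joined, up to the first `n` terms, by a finite sequence of pairs `f γ` for which the sum of the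
`γ + 1` is bounded by `a`. By compactness and transitivity, `R x y` holds if and only if for some
`a` these approximations hold for all `n` (`exists_forall_chain_iff`). The tree of `x` consists of
the finite sequences `s` of natural numbers, together with gadgets attached to `s` that name the
initial segments `u` of length `|s|` with `Chain f |s| u x s`. Chains compose and their bounds add
up, so a bound `a` for `x` and `y` induces an embedding, the translation by `a`
(`isEmbedding_shiftNode_of_chain`). Conversely an embedding preserves gadgets and thereby the
lengths of sequences, and the images of the sequences of zeros form a branch, which is such a bound
(`exists_forall_chain_of_isEmbedding`).
-/

section
open Polynomial IntermediateField

/-! ### Square roots and degrees of simple extensions -/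

section Sqrt
variable {k Ω : Type*} [Field k] [Field Ω] [Algebra k Ω]

/-- The elements of `K(r)`, for `r` a square root of an element of `K`, in coordinates. -/
theorem mem_sup_adjoin_sqrt {K : IntermediateField k Ω} {r : Ω} (hr : r ^ 2 ∈ K) {z : Ω}
    (hz : z ∈ K ⊔ k⟮r⟯) : ∃ a ∈ K, ∃ b ∈ K, z = a + b * r := by
  have hle : K ⊔ k⟮r⟯ = adjoin k ((K : Set Ω) ∪ {r}) := by rw [adjoin_union, adjoin_self]
  rw [hle] at hz
  induction hz using adjoin_induction with
  | mem x hx =>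
    rcases hx with hx | hx
    · exact ⟨x, hx, 0, K.zero_mem, by simp⟩
    · exact ⟨0, K.zero_mem, 1, K.one_mem, by rw [Set.mem_singleton_iff.1 hx]; simp⟩
  | algebraMap x => exact ⟨_, K.algebraMap_mem x, 0, K.zero_mem, by simp⟩
  | add x y _ _ hx hy =>
    obtain ⟨a, ha, b, hb, rfl⟩ := hx
    obtain ⟨c, hc, d, hd, rfl⟩ := hy
    exact ⟨a + c, K.add_mem ha hc, b + d, K.add_mem hb hd, by ring⟩
  | mul x y _ _ hx hy =>
    obtain ⟨a, ha, b, hb, rfl⟩ := hx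
    obtain ⟨c, hc, d, hd, rfl⟩ := hy
    exact ⟨a * c + b * d * r ^ 2, K.add_mem (K.mul_mem ha hc) (K.mul_mem (K.mul_mem hb hd) hr),
      a * d + b * c, K.add_mem (K.mul_mem ha hd) (K.mul_mem hb hc), by ring⟩
  | inv x _ hx =>
    obtain ⟨a, ha, b, hb, rfl⟩ := hx
    -- the inverse is the conjugate divided by the norm, unless the norm vanishes
    by_cases hN : a ^ 2 - b ^ 2 * r ^ 2 = 0
    · rcases mul_eq_zero.1 (show (a + b * r) * (a - b * r) = 0 by rw [← hN]; ring) with h | h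
      · exact ⟨0, K.zero_mem, 0, K.zero_mem, by rw [h]; simp⟩
      · have : b * r = a := (sub_eq_zero.1 h).symm
        exact ⟨_, K.inv_mem (K.add_mem ha ha), 0, K.zero_mem, by rw [this]; simp⟩
    · set N := a ^ 2 - b ^ 2 * r ^ 2 with hNd
      have hNK : N ∈ K := K.sub_mem (pow_mem ha 2) (K.mul_mem (pow_mem hb 2) hr)
      have hne : a + b * r ≠ 0 := fun h => hN (by
        rw [hNd, show a ^ 2 - b ^ 2 * r ^ 2 = (a + b * r) * (a - b * r) by ring, h, zero_mul])
      refine ⟨a / N, K.div_mem ha hNK, -b / N, K.div_mem (K.neg_mem hb) hNK, ?_⟩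
      refine (eq_inv_of_mul_eq_one_left ?_).symm
      rw [show (a / N + -b / N * r) * (a + b * r) = (a ^ 2 - b ^ 2 * r ^ 2) / N by ring, ← hNd,
        div_self hN]

/-- The basic step of Kummer theory for square roots: an element of `K(r)` whose square lies in `K`
is in `K` or in `K * r`. -/
theorem mem_or_eq_mul_of_sq_mem (h2 : (2 : Ω) ≠ 0) {K : IntermediateField k Ω} {r : Ω}
    (hr : r ^ 2 ∈ K) {z : Ω} (hz : z ∈ K ⊔ k⟮r⟯) (hz2 : z ^ 2 ∈ K) :
    z ∈ K ∨ ∃ b ∈ K, z = b * r := by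
  obtain ⟨a, ha, b, hb, rfl⟩ := mem_sup_adjoin_sqrt hr hz
  by_cases hrK : r ∈ K
  · exact Or.inl (K.add_mem ha (K.mul_mem hb hrK))
  by_cases hab : a * b = 0
  · rcases mul_eq_zero.1 hab with rfl | rfl
    · exact Or.inr ⟨b, hb, by simp⟩
    · exact Or.inl (by simp [ha])
  -- if `a * b ≠ 0`, then `r` can be recovered from the mixed term of `(a + b * r) ^ 2`
  · refine absurd ?_ hrK
    have h2K : (2 : Ω) ∈ K := by simp
    have hm : 2 * (a * b) * r ∈ K := by
      have : 2 * (a * b) * r = (a + b * r) ^ 2 - a ^ 2 - b ^ 2 * r ^ 2 := by ring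
      rw [this]
      exact K.sub_mem (K.sub_mem hz2 (pow_mem ha 2)) (K.mul_mem (pow_mem hb 2) hr)
    have hd : 2 * (a * b) ∈ K := K.mul_mem h2K (K.mul_mem ha hb)
    have := K.div_mem hm hd
    rwa [mul_div_cancel_left₀ _ (mul_ne_zero h2 hab)] at this

theorem sup_adjoin_image_insert {ι : Type*} [DecidableEq ι] (L : IntermediateField k Ω) (r : ι → Ω)
    (J : Finset ι) (i : ι) :
    L ⊔ adjoin k (r '' (insert i J : Finset ι)) = (L ⊔ adjoin k (r '' J)) ⊔ k⟮r i⟯ := by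
  rw [Finset.coe_insert, Set.image_insert_eq, Set.insert_eq, adjoin_union, sup_comm k⟮r i⟯,
    sup_assoc]

/-- Kummer theory for finitely many square roots. -/
theorem exists_eq_mul_prod_of_sq_mem (h2 : (2 : Ω) ≠ 0) {ι : Type*} {L : IntermediateField k Ω}
    {r : ι → Ω} (hr : ∀ i, r i ^ 2 ∈ L) (hr0 : ∀ i, r i ≠ 0) (J : Finset ι) {z : Ω}
    (hz : z ∈ L ⊔ adjoin k (r '' J)) (hz2 : z ^ 2 ∈ L) :
    ∃ J' ⊆ J, ∃ b ∈ L, z = b * ∏ i ∈ J', r i := by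
  classical
  induction J using Finset.induction_on generalizing z with
  | empty => exact ⟨∅, by simp, z, by simpa using hz, by simp⟩
  | insert i J hi ih =>
    rw [sup_adjoin_image_insert] at hz
    have hle : L ≤ L ⊔ adjoin k (r '' J) := le_sup_left
    rcases mem_or_eq_mul_of_sq_mem h2 (hle (hr i)) hz (hle hz2) with h | ⟨b, hb, rfl⟩
    · obtain ⟨J', hJ', b, hb, e⟩ := ih h hz2
      exact ⟨J', hJ'.trans (Finset.subset_insert _ _), b, hb, e⟩
    · have hb2 : b ^ 2 ∈ L := by
        have := L.div_mem hz2 (hr i)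
        rwa [mul_pow, mul_div_cancel_right₀ _ (pow_ne_zero 2 (hr0 i))] at this
      obtain ⟨J', hJ', b', hb', rfl⟩ := ih hb hb2
      refine ⟨insert i J', Finset.insert_subset_insert _ hJ', b', hb', ?_⟩
      rw [Finset.prod_insert (fun h => hi (hJ' h))]; ring

theorem relfinrank_sup_adjoin_simple {K : IntermediateField k Ω} {y : Ω} (hy : IsIntegral K y) :
    relfinrank K (K ⊔ k⟮y⟯) = (minpoly K y).natDegree := by
  rw [relfinrank_eq_finrank_of_le le_sup_left, ← adjoin.finrank hy]
  have : extendScalars (le_sup_left : K ≤ K ⊔ k⟮y⟯) = K⟮y⟯ := by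
    apply restrictScalars_injective k
    rw [extendScalars_restrictScalars, restrictScalars_adjoin, adjoin_union, adjoin_self]
  rw [this]

theorem relfinrank_sup_adjoin_sqrt {K : IntermediateField k Ω} {r : Ω} (hr : r ^ 2 ∈ K) :
    relfinrank K (K ⊔ k⟮r⟯) = 1 ∨ relfinrank K (K ⊔ k⟮r⟯) = 2 := by
  set P : K[X] := X ^ 2 - C ⟨r ^ 2, hr⟩ with hP
  have hm : P.Monic := monic_X_pow_sub_C _ two_ne_zero
  have h0 : aeval r P = 0 := by simp [hP, Algebra.algebraMap_eq_smul_one]; simp [Algebra.smul_def]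
  have hi : IsIntegral K r := ⟨P, hm, h0⟩
  rw [relfinrank_sup_adjoin_simple hi]
  have h1 := minpoly.natDegree_pos hi
  have h2 := natDegree_le_of_dvd (minpoly.dvd K r h0) hm.ne_zero
  have h3 : P.natDegree = 2 := natDegree_X_pow_sub_C
  omega

theorem exists_relfinrank_sup_adjoin_sqrt {ι : Type*} {L : IntermediateField k Ω}
    {r : ι → Ω} (hr : ∀ i, r i ^ 2 ∈ L) (J : Finset ι) :
    ∃ n, relfinrank L (L ⊔ adjoin k (r '' J)) = 2 ^ n := by
  classical
  induction J using Finset.induction_on with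
  | empty => exact ⟨0, by simp⟩
  | insert i J hi ih =>
    obtain ⟨n, hn⟩ := ih
    rw [sup_adjoin_image_insert, ← relfinrank_mul_relfinrank le_sup_left le_sup_left, hn]
    rcases relfinrank_sup_adjoin_sqrt (K := L ⊔ adjoin k (r '' J)) (r := r i)
      ((le_sup_left : L ≤ _) (hr i)) with h | h <;> rw [h]
    · exact ⟨n, by simp⟩
    · exact ⟨n + 1, by rw [pow_succ]⟩

/-- If `r` is a square root of an element of `K` outside `K`, then `r` and `-r` are conjugate over
`K`. -/
theorem aeval_neg_eq_zero_of_sqrt {K : IntermediateField k Ω} {r : Ω} (hr : r ^ 2 ∈ K)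
    (hrK : r ∉ K) {P : K[X]} (hP : aeval r P = 0) : aeval (-r) P = 0 := by
  set Q : K[X] := X ^ 2 - C ⟨r ^ 2, hr⟩ with hQ
  have hm : Q.Monic := monic_X_pow_sub_C _ two_ne_zero
  have h0 : ∀ x : Ω, x ^ 2 = r ^ 2 → aeval x Q = 0 := fun x hx => by
    rw [hQ, map_sub, map_pow, aeval_X, aeval_C, hx]; exact sub_self _
  have hd := minpoly.dvd K r (h0 r rfl)
  have hi : IsIntegral K r := ⟨Q, hm, h0 r rfl⟩
  have h2 : 2 ≤ (minpoly K r).natDegree := by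
    rw [minpoly.two_le_natDegree_iff hi]
    rintro ⟨x, hx⟩
    exact hrK (hx ▸ x.2)
  have : minpoly K r = Q := (Polynomial.eq_of_monic_of_dvd_of_natDegree_le (minpoly.monic hi) hm hd
    (by rw [hQ, natDegree_X_pow_sub_C]; exact h2)).symm
  obtain ⟨R, rfl⟩ := this ▸ minpoly.dvd K r hP
  rw [map_mul, h0 (-r) (by ring), zero_mul]

/-- The conjugate over `K` of an element of `K(r)` that is algebraic over `k` is also algebraic over
`k`. -/
theorem isAlgebraic_conj_sqrt {K : IntermediateField k Ω} {r a b : Ω} (hr : r ^ 2 ∈ K)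
    (hrK : r ∉ K) (ha : a ∈ K) (hb : b ∈ K) (h : IsAlgebraic k (a + b * r)) :
    IsAlgebraic k (a - b * r) := by
  obtain ⟨f, hf, h0⟩ := h
  refine ⟨f, hf, ?_⟩
  set P : K[X] := (f.map (algebraMap k K)).comp (C ⟨a, ha⟩ + C ⟨b, hb⟩ * X) with hP
  have e : ∀ x : Ω, aeval x P = aeval (a + b * x) f := fun x => by
    rw [hP, aeval_comp, aeval_map_algebraMap]
    congr 1
    simp only [map_add, map_mul, aeval_C, aeval_X]
    rfl
  have := aeval_neg_eq_zero_of_sqrt hr hrK (P := P) (by rw [e, h0])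
  rwa [e, mul_neg, ← sub_eq_add_neg] at this

end Sqrt

/-! ### Simple transcendental extensions -/

section Transcendental
variable {k Ω : Type*} [Field k] [Field Ω] [Algebra k Ω]

/-- The degree `[k(y) : k(y ^ N)]`, for `y` transcendental over `k`. -/
theorem relfinrank_adjoin_pow {y : Ω} (hy : Transcendental k y) (N : ℕ) :
    relfinrank k⟮y ^ N⟯ k⟮y⟯ = N := by
  let f : RatFunc k →ₐ[k] Ω := (k⟮y⟯).val.comp (RatFunc.algEquivOfTranscendental y hy).toAlgHom
  have hf : f RatFunc.X = y := by
    simp [f]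
  have e1 : k⟮y⟯ = (k⟮(RatFunc.X : RatFunc k)⟯).map f := by
    rw [adjoin_map, Set.image_singleton, hf]
  have e2 : k⟮y ^ N⟯ = (k⟮(RatFunc.X : RatFunc k) ^ N⟯).map f := by
    rw [adjoin_map, Set.image_singleton, map_pow, hf]
  rw [e1, e2, relfinrank_map_map, RatFunc.adjoin_X, relfinrank_top_right,
    RatFunc.finrank_eq_max_natDegree]
  have : (RatFunc.X : RatFunc k) ^ N = algebraMap k[X] (RatFunc k) (X ^ N) := by simp
  rw [this, RatFunc.num_algebraMap, RatFunc.denom_algebraMap]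
  simp

/-- A variant of `IntermediateField.mem_adjoin_simple_iff` in which the denominator is not the zero
polynomial. -/
theorem mem_adjoin_simple_iff_ne_zero {s x : Ω} :
    x ∈ k⟮s⟯ ↔ ∃ f g : k[X], g ≠ 0 ∧ x = aeval s f / aeval s g := by
  rw [mem_adjoin_simple_iff]
  constructor
  · rintro ⟨f, g, rfl⟩
    by_cases hg : g = 0
    · exact ⟨0, 1, one_ne_zero, by simp [hg]⟩
    · exact ⟨f, g, hg, rfl⟩
  · rintro ⟨f, g, -, h⟩
    exact ⟨f, g, h⟩

theorem aeval_ne_zero_of_transcendental {s : Ω} (hs : Transcendental k s) {f : k[X]} (hf : f ≠ 0) :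
    aeval s f ≠ 0 := fun h => hf ((transcendental_iff.1 hs) f h)

theorem eq_of_aeval_eq_of_transcendental {s : Ω} (hs : Transcendental k s) {f g : k[X]}
    (h : aeval s f = aeval s g) : f = g :=
  transcendental_iff_injective.1 hs h

/-- The base field is algebraically closed in a simple transcendental extension. -/
theorem mem_bot_of_mem_adjoin_of_isAlgebraic {s : Ω} (hs : Transcendental k s) {x : Ω}
    (hx : x ∈ k⟮s⟯) (ha : IsAlgebraic k x) : x ∈ (⊥ : IntermediateField k Ω) := by
  let f : RatFunc k →ₐ[k] Ω := (k⟮s⟯).val.comp (RatFunc.algEquivOfTranscendental s hs).toAlgHom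
  obtain ⟨u, hu⟩ : ∃ u, f u = x := by
    obtain ⟨u, hu⟩ := (RatFunc.algEquivOfTranscendental s hs).surjective ⟨x, hx⟩
    exact ⟨u, congrArg Subtype.val hu⟩
  have hua : IsAlgebraic k u := (isAlgebraic_algHom_iff f f.toRingHom.injective).1 (hu ▸ ha)
  by_contra hne
  refine RatFunc.transcendental_of_ne_C u ?_ hua
  rintro ⟨c, rfl⟩
  refine hne (mem_bot.2 ⟨c, ?_⟩)
  rw [← hu]
  exact (f.commutes c).symm

/-- The elements of `Ω` that are algebraic over an intermediate field `K`. -/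
noncomputable def algClosureOver (K : IntermediateField k Ω) : IntermediateField k Ω :=
  (algebraicClosure K Ω).restrictScalars k

theorem mem_algClosureOver {K : IntermediateField k Ω} {z : Ω} :
    z ∈ algClosureOver K ↔ IsAlgebraic K z := by
  rw [algClosureOver, mem_restrictScalars, mem_algebraicClosure_iff]

theorem le_algClosureOver (K : IntermediateField k Ω) : K ≤ algClosureOver K := fun z hz =>
  mem_algClosureOver.2 (isAlgebraic_algebraMap (⟨z, hz⟩ : K))

theorem mem_algClosureOver_of_pow_mem {K : IntermediateField k Ω} {z : Ω} {n : ℕ} (hn : 0 < n)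
    (h : z ^ n ∈ algClosureOver K) : z ∈ algClosureOver K :=
  mem_algClosureOver.2 ((mem_algClosureOver.1 h).of_pow hn)

theorem mem_algClosureOver_of_isAlgebraic {K L : IntermediateField k Ω}
    (hL : L ≤ algClosureOver K) {z : Ω} (h : IsAlgebraic L z) : z ∈ algClosureOver K := by
  have h1 : IsAlgebraic (algebraicClosure K Ω) z := by
    obtain ⟨f, hf, h0⟩ := h
    let j : L →+* algebraicClosure K Ω :=
      (algebraMap L Ω).codRestrict (algebraicClosure K Ω) fun x => hL x.2
    refine ⟨f.map j, (Polynomial.map_ne_zero_iff j.injective).2 hf, ?_⟩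
    rw [aeval_def, eval₂_map]
    exact h0
  exact mem_algClosureOver.2 (h1.restrictScalars K)

/-- The exchange property of algebraic dependence, for two elements. -/
theorem isAlgebraic_adjoin_simple_symm {s x : Ω} (hx : Transcendental k x)
    (h : IsAlgebraic k⟮s⟯ x) : IsAlgebraic k⟮x⟯ s := by
  by_contra hs
  have hne : s ∉ ({x} : Set Ω) := fun e => by
    rw [Set.mem_singleton_iff.1 e] at hs
    exact hs (isAlgebraic_algebraMap (⟨x, mem_adjoin_simple_self k x⟩ : k⟮x⟯))
  have hx' : AlgebraicIndepOn k id ({x} : Set Ω) :=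
    algebraicIndependent_unique_type_iff.2 hx
  have h1 : AlgebraicIndepOn k id (insert s ({x} : Set Ω)) := by
    rw [AlgebraicIndepOn.insert_iff hne]
    refine ⟨hx', ?_⟩
    rw [Set.image_id]
    exact transcendental_adjoin_iff.1 hs
  rw [Set.pair_comm, AlgebraicIndepOn.insert_iff (fun e => hne (Set.mem_singleton_iff.1 e).symm),
    Set.image_id] at h1
  exact transcendental_adjoin_iff.2 h1.2 h

theorem relfinrank_sup_adjoin_ne_zero {K : IntermediateField k Ω} {S : Set Ω} (hS : S.Finite)
    (h : ∀ z ∈ S, IsAlgebraic K z) : relfinrank K (K ⊔ adjoin k S) ≠ 0 := by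
  rw [relfinrank_eq_finrank_of_le le_sup_left]
  have e : extendScalars (le_sup_left : K ≤ K ⊔ adjoin k S) = adjoin K S := by
    apply restrictScalars_injective k
    rw [extendScalars_restrictScalars, restrictScalars_adjoin, adjoin_union, adjoin_self]
  rw [e]
  have := hS.to_subtype
  have : FiniteDimensional K (adjoin K S) := finiteDimensional_adjoin fun z hz => (h z hz).isIntegral
  exact Module.finrank_pos.ne'

end Transcendental

/-! ### Radical steps -/

section Step
variable {k Ω : Type*} [Field k] [Field Ω] [Algebra k Ω]

/-- Distinct binomials `X ^ M - a` generate the unit ideal in pairs, and each is separable. -/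
theorem separable_prod_X_pow_sub_C {ι : Type*} {a : ι → k} (ha : Function.Injective a)
    (ha0 : ∀ i, a i ≠ 0) {M : ℕ} (hM : (M : k) ≠ 0) (J : Finset ι) :
    (∏ i ∈ J, (X ^ M - C (a i)) : k[X]).Separable := by
  refine separable_prod' (fun i _ j _ hij => ?_) fun i _ => separable_X_pow_sub_C _ hM (ha0 i)
  have hne : a j - a i ≠ 0 := sub_ne_zero.2 fun h => hij (ha h).symm
  refine ⟨C (a j - a i)⁻¹, -C (a j - a i)⁻¹, ?_⟩
  have : C (a j - a i)⁻¹ * (X ^ M - C (a i)) + -C (a j - a i)⁻¹ * (X ^ M - C (a j)) =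
      C ((a j - a i)⁻¹ * (a j - a i)) := by
    simp only [map_mul, map_sub]; ring
  rw [this, inv_mul_cancel₀ hne, map_one]

/-- A nonempty product of distinct binomials `s ^ M - a`, `a ≠ 0`, is not a square in `k(s)` up to a
constant. -/
theorem eq_empty_of_mul_prod_eq_sq {s : Ω} (hs : Transcendental k s) {ι : Type*} {a : ι → k}
    (ha : Function.Injective a) (ha0 : ∀ i, a i ≠ 0) {M : ℕ} (hM : (M : k) ≠ 0) {J : Finset ι}
    {e : k} (he : e ≠ 0) {b : Ω} (hb : b ∈ k⟮s⟯)
    (h : algebraMap k Ω e * ∏ i ∈ J, (s ^ M - algebraMap k Ω (a i)) = b ^ 2) : J = ∅ := by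
  obtain ⟨f, g, hg, rfl⟩ := mem_adjoin_simple_iff_ne_zero.1 hb
  set P : k[X] := ∏ i ∈ J, (X ^ M - C (a i)) with hP
  have h1 : C e * P * g ^ 2 = f ^ 2 := by
    apply eq_of_aeval_eq_of_transcendental hs
    have hg' := aeval_ne_zero_of_transcendental hs hg
    simp only [map_mul, map_pow, aeval_C, hP, map_prod, map_sub, aeval_X]
    rw [h]
    field_simp
  have hgf : g ∣ f := (UniqueFactorizationMonoid.pow_dvd_pow_iff_dvd two_ne_zero).1
    ⟨C e * P, by rw [← h1]; ring⟩
  obtain ⟨u, rfl⟩ := hgf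
  have h2 : C e * P = u ^ 2 := by
    have : g ^ 2 * (C e * P) = g ^ 2 * u ^ 2 := by linear_combination h1
    exact mul_left_cancel₀ (pow_ne_zero 2 hg) this
  -- `P` is squarefree, so its square root `u` up to a constant is a unit, and `P` has degree `0`
  have hu : IsUnit u := by
    refine (separable_prod_X_pow_sub_C ha ha0 hM J).squarefree u ⟨C (e)⁻¹, ?_⟩
    rw [← pow_two, ← h2, hP, mul_comm (C e), mul_assoc, ← C_mul, mul_inv_cancel₀ he]; simp
  have h3 : P.natDegree = 0 := by
    rw [← natDegree_C_mul he, h2, natDegree_pow, natDegree_eq_zero_of_isUnit hu]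
  have hM0 : M ≠ 0 := by rintro rfl; simp at hM
  have h4 : P.natDegree = J.card * M := by
    rw [hP, natDegree_prod_of_monic _ _ fun i _ => monic_X_pow_sub_C _ hM0]
    simp
  rw [h4] at h3
  exact Finset.card_eq_zero.1 ((mul_eq_zero.1 h3).resolve_right hM0)

/-- One step of the construction, over a base field `k` inside `Ω`: a sequence `s` of iterated
`q`-th roots of an element `s 0` that is transcendental over `k`, and square roots `r i` of
`ε i * (s 0 - a i)` for distinct nonzero `a i ∈ k`. -/
structure IsRadicalStep (q : ℕ) (s : ℕ → Ω) {ι : Type*} (a ε : ι → k) (r : ι → Ω) : Prop where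
  prime : q.Prime
  two_ne : (2 : k) ≠ 0
  q_ne : (q : k) ≠ 0
  root : ∀ l, s (l + 1) ^ q = s l
  trans : Transcendental k (s 0)
  inj : Function.Injective a
  a_ne : ∀ i, a i ≠ 0
  ε_ne : ∀ i, ε i ≠ 0
  sq : ∀ i, r i ^ 2 = algebraMap k Ω (ε i) * (s 0 - algebraMap k Ω (a i))

variable (k) in
/-- The extension of `k` generated by all iterated roots `s l` and all square roots `r i`. -/
def stepField (s : ℕ → Ω) {ι : Type*} (r : ι → Ω) : IntermediateField k Ω :=
  adjoin k (Set.range s ∪ Set.range r)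

variable (k) in
/-- The extension of `k` generated by the single root `s l` and finitely many square roots `r i`. -/
def stepPart (s : ℕ → Ω) {ι : Type*} (r : ι → Ω) (l : ℕ) (J : Finset ι) : IntermediateField k Ω :=
  k⟮s l⟯ ⊔ adjoin k (r '' J)

theorem pow_pow_eq_of_root {q : ℕ} {s : ℕ → Ω} (h : ∀ l, s (l + 1) ^ q = s l) (l m : ℕ) :
    s (l + m) ^ q ^ m = s l := by
  induction m with
  | zero => simp
  | succ m ih => rw [pow_succ', pow_mul, ← add_assoc, h, ih]

namespace IsRadicalStep
variable {q : ℕ} {s : ℕ → Ω} {ι : Type*} {a ε : ι → k} {r : ι → Ω} (h : IsRadicalStep q s a ε r)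
include h

theorem pow_pow (l m : ℕ) : s (l + m) ^ q ^ m = s l := pow_pow_eq_of_root h.root l m

theorem pow_zero (l : ℕ) : s l ^ q ^ l = s 0 := by simpa using h.pow_pow 0 l

theorem two_ne' : (2 : Ω) ≠ 0 := by
  have := (map_ne_zero (algebraMap k Ω)).2 h.two_ne
  rwa [map_ofNat] at this

theorem transcendental (l : ℕ) : Transcendental k (s l) := fun ha => h.trans (h.pow_zero l ▸ ha.pow _)

theorem r_ne (i : ι) : r i ≠ 0 := fun h0 => by
  have := h.sq i
  rw [h0, zero_pow two_ne_zero, eq_comm, mul_eq_zero] at this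
  rcases this with h1 | h1
  · exact h.ε_ne i ((map_eq_zero _).1 h1)
  · exact h.trans (sub_eq_zero.1 h1 ▸ isAlgebraic_algebraMap _)

theorem zero_mem (l : ℕ) : s 0 ∈ k⟮s l⟯ := h.pow_zero l ▸ pow_mem (mem_adjoin_simple_self k _) _

theorem adjoin_le_adjoin {l m : ℕ} (hlm : l ≤ m) : k⟮s l⟯ ≤ k⟮s m⟯ := by
  obtain ⟨n, rfl⟩ := Nat.exists_eq_add_of_le hlm
  rw [adjoin_simple_le_iff, ← h.pow_pow l n]
  exact pow_mem (mem_adjoin_simple_self k _) _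

theorem sq_mem (l : ℕ) (i : ι) : r i ^ 2 ∈ k⟮s l⟯ := by
  rw [h.sq]
  exact mul_mem (_root_.algebraMap_mem _ _) (sub_mem (h.zero_mem l) (_root_.algebraMap_mem _ _))

theorem stepPart_mono {l m : ℕ} (hlm : l ≤ m) {J J' : Finset ι} (hJ : J ⊆ J') :
    stepPart k s r l J ≤ stepPart k s r m J' :=
  sup_le_sup (h.adjoin_le_adjoin hlm) (adjoin.mono _ _ _ (Set.image_mono (by exact_mod_cast hJ)))

/-- A step field is the directed union of its parts. -/
theorem exists_mem_stepPart {x : Ω} (hx : x ∈ stepField k s r) :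
    ∃ l J, x ∈ stepPart k s r l J := by
  classical
  rw [stepField] at hx
  induction hx using adjoin_induction with
  | mem x hx =>
    rcases hx with ⟨l, rfl⟩ | ⟨i, rfl⟩
    · exact ⟨l, ∅, (le_sup_left : k⟮s l⟯ ≤ _) (mem_adjoin_simple_self k _)⟩
    · exact ⟨0, {i}, (le_sup_right : _ ≤ k⟮s 0⟯ ⊔ _)
        (subset_adjoin _ _ ⟨i, by simp, rfl⟩)⟩
  | algebraMap x => exact ⟨0, ∅, _root_.algebraMap_mem _ _⟩
  | add x y _ _ hx hy =>
    obtain ⟨l, J, hx⟩ := hx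
    obtain ⟨m, J', hy⟩ := hy
    exact ⟨max l m, J ∪ J', add_mem
      (h.stepPart_mono (le_max_left _ _) Finset.subset_union_left hx)
      (h.stepPart_mono (le_max_right _ _) Finset.subset_union_right hy)⟩
  | mul x y _ _ hx hy =>
    obtain ⟨l, J, hx⟩ := hx
    obtain ⟨m, J', hy⟩ := hy
    exact ⟨max l m, J ∪ J', mul_mem
      (h.stepPart_mono (le_max_left _ _) Finset.subset_union_left hx)
      (h.stepPart_mono (le_max_right _ _) Finset.subset_union_right hy)⟩
  | inv x _ hx =>
    obtain ⟨l, J, hx⟩ := hx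
    exact ⟨l, J, inv_mem hx⟩

/-- No nonempty product of the square roots `r i` lies in `k(s l)`, even up to the square root of a
constant. -/
theorem eq_empty_of_prod_sq_eq {l : ℕ} {J : Finset ι} {e : k} (he : e ≠ 0) {b : Ω}
    (hb : b ∈ k⟮s l⟯) (hp : algebraMap k Ω e * ∏ i ∈ J, r i ^ 2 = b ^ 2) : J = ∅ := by
  refine eq_empty_of_mul_prod_eq_sq (h.transcendental l) h.inj h.a_ne (M := q ^ l)
    (by simpa using pow_ne_zero l h.q_ne) (e := e * ∏ i ∈ J, ε i)
    (mul_ne_zero he (Finset.prod_ne_zero_iff.2 fun i _ => h.ε_ne i)) hb ?_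
  rw [← hp, h.pow_zero, map_mul, map_prod, mul_assoc, ← Finset.prod_mul_distrib]
  simp only [h.sq]

/-- The square roots `r i` are independent over `k(s l)`. -/
theorem notMem_stepPart (l : ℕ) {J : Finset ι} {i : ι} (hi : i ∉ J) : r i ∉ stepPart k s r l J := by
  classical
  intro hr
  obtain ⟨J', hJ', b, hb, e⟩ := exists_eq_mul_prod_of_sq_mem h.two_ne' (h.sq_mem l) h.r_ne J hr
    (h.sq_mem l i)
  have hi' : i ∉ J' := fun hh => hi (hJ' hh)
  have hb0 : b ≠ 0 := by rintro rfl; exact h.r_ne i (by simpa using e)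
  have := h.eq_empty_of_prod_sq_eq (l := l) (J := insert i J') (e := 1) one_ne_zero
    (b := b * ∏ i ∈ J', r i ^ 2) (mul_mem hb (prod_mem fun i _ => h.sq_mem l i)) (by
      rw [Finset.prod_insert hi', e, mul_pow, ← Finset.prod_pow, map_one]; ring)
  simp at this

/-- The base field is algebraically closed in a radical step. -/
theorem mem_bot_of_isAlgebraic {z : Ω} (hz' : z ∈ stepField k s r) (ha : IsAlgebraic k z) :
    z ∈ (⊥ : IntermediateField k Ω) := by
  classical
  obtain ⟨l, J, hz⟩ := h.exists_mem_stepPart hz'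
  clear hz'
  induction J using Finset.induction_on generalizing z with
  | empty =>
    refine mem_bot_of_mem_adjoin_of_isAlgebraic (h.transcendental l) ?_ ha
    simpa [stepPart] using hz
  | insert i J hi ih =>
    rw [stepPart, sup_adjoin_image_insert] at hz
    have hiE := h.notMem_stepPart l hi
    have hle : k⟮s l⟯ ≤ k⟮s l⟯ ⊔ adjoin k (r '' J) := le_sup_left
    obtain ⟨x, hx, y, hy, rfl⟩ := mem_sup_adjoin_sqrt (hle (h.sq_mem l i)) hz
    -- with `z`, its conjugate is algebraic over `k`, hence so are its two components
    have hc := isAlgebraic_conj_sqrt (hle (h.sq_mem l i)) hiE hx hy ha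
    have h2 := h.two_ne'
    have hxa : IsAlgebraic k x := by
      have h3 : x = (algebraMap k Ω 2)⁻¹ * ((x + y * r i) + (x - y * r i)) := by
        rw [map_ofNat]; field_simp; ring
      rw [h3]
      exact (isAlgebraic_algebraMap _).inv.mul (ha.add hc)
    have hxk := ih hxa hx
    have hya : IsAlgebraic k (y * r i) := by
      have := ha.sub hxa
      rwa [add_sub_cancel_left] at this
    -- if `y ≠ 0`, then the square of the second component is a nonzero constant `e`, so that `y` is
    -- a product of square roots and a nonempty product of the `r ^ 2` is `e` times a square
    by_cases hy0 : y = 0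
    · simpa [hy0] using hxk
    have hyk : y ^ 2 * r i ^ 2 ∈ (⊥ : IntermediateField k Ω) :=
      ih (by rw [← mul_pow]; exact hya.pow 2) (mul_mem (pow_mem hy 2) (hle (h.sq_mem l i)))
    obtain ⟨e, he⟩ := mem_bot.1 hyk
    have hr0 := h.r_ne i
    have he0 : e ≠ 0 := by
      rintro rfl
      rw [map_zero, eq_comm, ← mul_pow] at he
      exact mul_ne_zero hy0 hr0 (pow_eq_zero_iff two_ne_zero |>.1 he)
    have hy2 : y ^ 2 ∈ k⟮s l⟯ := by
      have : y ^ 2 = algebraMap k Ω e / r i ^ 2 := by rw [he]; field_simp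
      rw [this]
      exact div_mem (_root_.algebraMap_mem _ _) (h.sq_mem l i)
    obtain ⟨J', hJ', b, hb, e1⟩ := exists_eq_mul_prod_of_sq_mem h.two_ne' (h.sq_mem l) h.r_ne J hy
      hy2
    have hi' : i ∉ J' := fun hh => hi (hJ' hh)
    have := h.eq_empty_of_prod_sq_eq (l := l) (J := insert i J') (e := e) he0
      (b := b * ∏ i ∈ insert i J', r i ^ 2) (mul_mem hb (prod_mem fun i _ => h.sq_mem l i)) (by
        rw [he, e1, Finset.prod_insert hi', mul_pow, ← Finset.prod_pow]; ring)
    simp at this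

/-- The elements of a step field whose square lies in `k(s l)` for some `l` are products of an
element of some `k(s m)` and finitely many square roots `r i`. -/
theorem exists_eq_mul_prod {z : Ω} (hz : z ∈ stepField k s r) {l : ℕ} (hz2 : z ^ 2 ∈ k⟮s l⟯) :
    ∃ m ≥ l, ∃ J : Finset ι, ∃ b ∈ k⟮s m⟯, z = b * ∏ i ∈ J, r i := by
  obtain ⟨m, J, hz⟩ := h.exists_mem_stepPart hz
  obtain ⟨J', -, b, hb, e⟩ := exists_eq_mul_prod_of_sq_mem h.two_ne' (h.sq_mem (max l m)) h.r_ne J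
    (h.stepPart_mono (le_max_right l m) subset_rfl hz) (h.adjoin_le_adjoin (le_max_left l m) hz2)
  exact ⟨max l m, le_max_left _ _, J', b, hb, e⟩

theorem isAlgebraic_of_mem_stepPart {l : ℕ} {J : Finset ι} {x : Ω} (hx : x ∈ stepPart k s r l J) :
    IsAlgebraic k⟮s l⟯ x := by
  have : stepPart k s r l J ≤ algClosureOver k⟮s l⟯ := by
    refine sup_le (le_algClosureOver _) (adjoin_le_iff.2 ?_)
    rintro _ ⟨i, -, rfl⟩
    exact mem_algClosureOver_of_pow_mem two_pos (le_algClosureOver _ (h.sq_mem l i))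
  exact mem_algClosureOver.1 (this hx)

/-- A part of a step field is a finite extension of `k(x)` for each of its elements `x` that is
transcendental over `k`. -/
theorem relfinrank_stepPart_ne_zero {l : ℕ} {J : Finset ι} {x : Ω} (hx : x ∈ stepPart k s r l J)
    (hxt : Transcendental k x) : relfinrank k⟮x⟯ (stepPart k s r l J) ≠ 0 := by
  have hs := mem_algClosureOver.2
    (isAlgebraic_adjoin_simple_symm hxt (h.isAlgebraic_of_mem_stepPart hx))
  have h1 := relfinrank_sup_adjoin_ne_zero (K := k⟮x⟯) (S := insert (s l) (r '' J))
    ((J.finite_toSet.image r).insert _) (by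
      rintro z (rfl | ⟨i, -, rfl⟩)
      · exact mem_algClosureOver.1 hs
      · refine mem_algClosureOver.1 (mem_algClosureOver_of_pow_mem two_pos ?_)
        exact adjoin_simple_le_iff.2 hs (h.sq_mem l i))
  have e : k⟮x⟯ ⊔ adjoin k (insert (s l) (r '' J)) = stepPart k s r l J := by
    have : adjoin k (insert (s l) (r '' J)) = stepPart k s r l J := by
      rw [Set.insert_eq, adjoin_union]; rfl
    rw [this]
    exact sup_eq_right.2 (adjoin_simple_le_iff.2 hx)
  rwa [e] at h1

/-- The only prime divisors of the degree of a part of a step field over a smaller part are `2` and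
`q`. -/
theorem relfinrank_stepPart_dvd {l m : ℕ} (hlm : l ≤ m) {J J' : Finset ι} (hJ : J ⊆ J') :
    ∃ n, relfinrank (stepPart k s r l J) (stepPart k s r m J') ∣ q ^ (m - l) * 2 ^ n := by
  obtain ⟨n, hn⟩ := exists_relfinrank_sup_adjoin_sqrt (h.sq_mem m) J'
  refine ⟨n, ?_⟩
  have h1 : relfinrank k⟮s l⟯ k⟮s m⟯ = q ^ (m - l) := by
    obtain ⟨d, rfl⟩ := Nat.exists_eq_add_of_le hlm
    rw [← h.pow_pow l d, relfinrank_adjoin_pow (h.transcendental _)]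
    simp
  have h2 : relfinrank k⟮s l⟯ (stepPart k s r m J') = q ^ (m - l) * 2 ^ n := by
    rw [stepPart, ← relfinrank_mul_relfinrank (h.adjoin_le_adjoin hlm) le_sup_left, h1, hn]
  rw [← h2, ← relfinrank_mul_relfinrank (B := stepPart k s r l J) le_sup_left
    (h.stepPart_mono hlm hJ)]
  exact dvd_mul_left _ _

end IsRadicalStep

/-- `x` is a nonzero element that has `q ^ n`-th roots in the field `K` for every `n`. -/
def IsHighIn (K : IntermediateField k Ω) (q : ℕ) (x : Ω) : Prop :=
  x ≠ 0 ∧ ∀ n : ℕ, ∃ y ∈ K, y ^ q ^ n = x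

theorem IsHighIn.mem {K : IntermediateField k Ω} {q : ℕ} {x : Ω} (h : IsHighIn K q x) : x ∈ K := by
  obtain ⟨y, hy, e⟩ := h.2 0
  simp only [pow_zero, pow_one] at e
  exact e ▸ hy

/-- For a prime `q'` other than `q` and `2`, a `q'`-high element of a radical step for the prime `q`
lies in the base field: if `x` were transcendental over `k`, then a `q' ^ n`-th root `y` of `x`
would satisfy `[k(y) : k(x)] = q' ^ n`, while up to powers of `2` and `q` the degree over `k(x)` of
any part of the step field containing `x` is bounded. -/
theorem IsRadicalStep.mem_bot_of_isHighIn {q : ℕ} {s : ℕ → Ω} {ι : Type*} {a ε : ι → k} {r : ι → Ω}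
    (h : IsRadicalStep q s a ε r) {q' : ℕ} (hq' : q'.Prime) (hne : q' ≠ q) (hne2 : q' ≠ 2) {x : Ω}
    (hx : IsHighIn (stepField k s r) q' x) : x ∈ (⊥ : IntermediateField k Ω) := by
  classical
  by_contra hbot
  have hxt : Transcendental k x := fun ha => hbot (h.mem_bot_of_isAlgebraic hx.mem ha)
  obtain ⟨l, J, hxE⟩ := h.exists_mem_stepPart hx.mem
  set D := relfinrank k⟮x⟯ (stepPart k s r l J) with hD
  have hD0 : D ≠ 0 := h.relfinrank_stepPart_ne_zero hxE hxt
  have key : ∀ n, q' ^ n ∣ D := by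
    intro n
    obtain ⟨y, hy, hyx⟩ := hx.2 n
    obtain ⟨m, J', hyE⟩ := h.exists_mem_stepPart hy
    have hyE' := h.stepPart_mono (le_max_right l m) (Finset.subset_union_right : J' ⊆ J ∪ J') hyE
    have hyt : Transcendental k y := fun ha => hxt (hyx ▸ ha.pow _)
    obtain ⟨c, hc⟩ := h.relfinrank_stepPart_dvd (le_max_left l m)
      (Finset.subset_union_left : J ⊆ J ∪ J')
    have hxy : k⟮x⟯ ≤ k⟮y⟯ := adjoin_simple_le_iff.2
      (hyx ▸ pow_mem (mem_adjoin_simple_self k y) _)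
    have h1 : relfinrank k⟮x⟯ k⟮y⟯ = q' ^ n := by rw [← hyx, relfinrank_adjoin_pow hyt]
    have h2 := relfinrank_mul_relfinrank hxy (adjoin_simple_le_iff.2 hyE')
    have h3 := relfinrank_mul_relfinrank (adjoin_simple_le_iff.2 hxE)
      (h.stepPart_mono (le_max_left l m) (Finset.subset_union_left : J ⊆ J ∪ J'))
    have h4 : q' ^ n ∣ D * (q ^ (max l m - l) * 2 ^ c) := by
      refine dvd_trans ?_ (mul_dvd_mul_left D hc)
      rw [hD, h3, ← h2, h1]
      exact dvd_mul_right _ _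
    refine Nat.Coprime.dvd_of_dvd_mul_right ?_ h4
    refine Nat.Coprime.pow_left _ (Nat.Coprime.mul_right ?_ ?_)
    · exact Nat.Coprime.pow_right _ ((Nat.coprime_primes hq' h.prime).2 hne)
    · exact Nat.Coprime.pow_right _ ((Nat.coprime_primes hq' Nat.prime_two).2 hne2)
  have := Nat.le_of_dvd (Nat.pos_of_ne_zero hD0) (key D)
  exact absurd (Nat.lt_pow_self hq'.one_lt) (not_lt.2 this)

end Step

/-! ### High elements and squares in a purely radical step -/

section RootMultiplicity
variable {K : Type*} [Field K]

theorem rootMultiplicity_pow_eq {f : K[X]} (β : K) (n : ℕ) :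
    rootMultiplicity β (f ^ n) = n * rootMultiplicity β f := by
  classical
  rw [← count_roots, ← count_roots, roots_pow, Multiset.count_nsmul]

theorem rootMultiplicity_X_pow_sub_C {β : K} (hβ : β ≠ 0) {Q : ℕ} (hQ : (Q : K) ≠ 0) :
    rootMultiplicity β (X ^ Q - C (β ^ Q)) = 1 := by
  have hsep : (X ^ Q - C (β ^ Q)).Separable := separable_X_pow_sub_C _ hQ (pow_ne_zero _ hβ)
  refine le_antisymm (rootMultiplicity_le_one_of_separable hsep β) ?_
  exact (rootMultiplicity_pos hsep.ne_zero).2 (by simp [IsRoot])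

/-- Away from `0`, substituting `X ^ Q` for `X` is unramified when `Q` is invertible. -/
theorem rootMultiplicity_expand_of_ne_zero {f : K[X]} (hf : f ≠ 0) {β : K} (hβ : β ≠ 0) {Q : ℕ}
    (hQ : (Q : K) ≠ 0) : rootMultiplicity β (expand K Q f) = rootMultiplicity (β ^ Q) f := by
  have hQ0 : 0 < Q := Nat.pos_of_ne_zero (by rintro rfl; simp at hQ)
  obtain ⟨g, hg, hgd⟩ := exists_eq_pow_rootMultiplicity_mul_and_not_dvd f hf (β ^ Q)
  set m := rootMultiplicity (β ^ Q) f with hm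
  have hge : eval (β ^ Q) g ≠ 0 := fun h => hgd (dvd_iff_isRoot.2 h)
  have he : expand K Q f = (X ^ Q - C (β ^ Q)) ^ m * expand K Q g := by
    conv_lhs => rw [hg]
    simp [map_mul]
  have hg0 : expand K Q g ≠ 0 := (expand_ne_zero hQ0).2 (by rintro rfl; simp at hge)
  have hx0 : (X ^ Q - C (β ^ Q) : K[X]) ≠ 0 := X_pow_sub_C_ne_zero hQ0 _
  rw [he, rootMultiplicity_mul (mul_ne_zero (pow_ne_zero _ hx0) hg0), rootMultiplicity_pow_eq,
    rootMultiplicity_X_pow_sub_C hβ hQ, mul_one, rootMultiplicity_eq_zero, add_zero]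
  rwa [IsRoot, expand_eval]

/-- A polynomial is determined, up to a constant, by the multiplicities of its roots in the
algebraic closure. -/
theorem exists_eq_C_mul_of_rootMultiplicity_eq {k : Type*} [Field k] {f g : k[X]} (hf : f ≠ 0)
    (hg : g ≠ 0) (h : ∀ α : AlgebraicClosure k, rootMultiplicity α (f.map (algebraMap k _)) =
      rootMultiplicity α (g.map (algebraMap k _))) : ∃ c ≠ 0, f = C c * g := by
  classical
  have hlf := leadingCoeff_ne_zero.2 hf
  have hlg := leadingCoeff_ne_zero.2 hg
  refine ⟨f.leadingCoeff / g.leadingCoeff, div_ne_zero hlf hlg, ?_⟩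
  apply map_injective (algebraMap k (AlgebraicClosure k)) (algebraMap k _).injective
  have hr : (f.map (algebraMap k (AlgebraicClosure k))).roots =
      (g.map (algebraMap k (AlgebraicClosure k))).roots := by
    ext α
    rw [count_roots, count_roots, h]
  rw [Polynomial.map_mul, map_C, (IsAlgClosed.splits (f.map _)).eq_prod_roots,
    (IsAlgClosed.splits (g.map _)).eq_prod_roots, hr, ← mul_assoc, ← C_mul, leadingCoeff_map,
    leadingCoeff_map, map_div₀, div_mul_cancel₀ _ ((_root_.map_ne_zero _).2 hlg)]

end RootMultiplicity

section Rational
variable {k Ω : Type*} [Field k] [Field Ω] [Algebra k Ω]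

/-- In a radical step for the prime `q` without square roots, the `q`-high elements are the obvious
ones: the numerator and the denominator of such an element have the same multiplicities modulo every
power of `q` at each nonzero element of the algebraic closure of `k`. -/
theorem IsRadicalStep.exists_eq_mul_zpow_of_isHighIn {q : ℕ} {s : ℕ → Ω} {ι : Type*} [IsEmpty ι]
    {a ε : ι → k} {r : ι → Ω} (h : IsRadicalStep q s a ε r) {x : Ω}
    (hx : IsHighIn (stepField k s r) q x) :
    ∃ (l : ℕ) (m : ℤ) (c : k), IsHighIn (⊥ : IntermediateField k Ω) q (algebraMap k Ω c) ∧
      x = algebraMap k Ω c * s l ^ m := by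
  classical
  have hpart : ∀ {y : Ω}, y ∈ stepField k s r → ∃ l, y ∈ k⟮s l⟯ := fun hy => by
    obtain ⟨l, J, hy⟩ := h.exists_mem_stepPart hy
    refine ⟨l, ?_⟩
    rw [J.eq_empty_of_isEmpty] at hy
    simpa [stepPart] using hy
  obtain ⟨l, hxl⟩ := hpart hx.mem
  obtain ⟨f, g, hg, hxfg⟩ := mem_adjoin_simple_iff_ne_zero.1 hxl
  have hf : f ≠ 0 := by rintro rfl; exact hx.1 (by rw [hxfg]; simp)
  set i := algebraMap k (AlgebraicClosure k) with hi
  have hQ : ∀ n : ℕ, ((q ^ n : ℕ) : k) ≠ 0 := fun n => by simpa using pow_ne_zero n h.q_ne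
  have hmap : ∀ {p : k[X]}, p ≠ 0 → p.map i ≠ 0 := fun hp =>
    (Polynomial.map_ne_zero_iff i.injective).2 hp
  -- compare the multiplicities, at a `q ^ d`-th root `β` of `α`, of both sides of `x = y ^ q ^ n`,
  -- where `x = f / g` at `s l = s (l + d) ^ q ^ d` and `y = f' / g'` at `s (l + d)`
  have hdvd : ∀ (n : ℕ) (α : AlgebraicClosure k), α ≠ 0 → ((q ^ n : ℕ) : ℤ) ∣
      (rootMultiplicity α (f.map i) : ℤ) - rootMultiplicity α (g.map i) := by
    intro n α hα
    obtain ⟨y, hy, hyx⟩ := hx.2 n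
    obtain ⟨m', hym'⟩ := hpart hy
    obtain ⟨d, hd⟩ := Nat.exists_eq_add_of_le (le_max_left l m')
    have hym := h.adjoin_le_adjoin (le_max_right l m') hym'
    rw [hd] at hym
    obtain ⟨f', g', hg', hyfg⟩ := mem_adjoin_simple_iff_ne_zero.1 hym
    have hf' : f' ≠ 0 := by
      rintro rfl
      apply hx.1
      rw [← hyx, hyfg, map_zero, zero_div, zero_pow (pow_ne_zero _ h.prime.ne_zero)]
    have ht := h.transcendental (l + d)
    have hpoly : expand k (q ^ d) f * g' ^ q ^ n = f' ^ q ^ n * expand k (q ^ d) g := by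
      apply eq_of_aeval_eq_of_transcendental ht
      rw [map_mul, map_mul, map_pow, map_pow, expand_aeval, expand_aeval, h.pow_pow l d]
      have h1 := aeval_ne_zero_of_transcendental ht hg'
      have h2 := aeval_ne_zero_of_transcendental (h.transcendental l) hg
      rw [hxfg, hyfg, div_pow, div_eq_div_iff (pow_ne_zero _ h1) h2] at hyx
      exact hyx.symm
    obtain ⟨β, hβ⟩ := IsAlgClosed.exists_pow_nat_eq α (pow_pos h.prime.pos d)
    have hβ0 : β ≠ 0 := by
      rintro rfl
      rw [zero_pow (pow_ne_zero _ h.prime.ne_zero)] at hβ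
      exact hα hβ.symm
    have hQK : ((q ^ d : ℕ) : AlgebraicClosure k) ≠ 0 := by
      have := (_root_.map_ne_zero i).2 (hQ d)
      rwa [map_natCast] at this
    have hq0 : 0 < q ^ d := pow_pos h.prime.pos d
    have := congrArg (fun p => rootMultiplicity β (p.map i)) hpoly
    simp only [Polynomial.map_mul, Polynomial.map_pow, map_expand] at this
    rw [rootMultiplicity_mul (mul_ne_zero ((expand_ne_zero hq0).2 (hmap hf))
        (pow_ne_zero _ (hmap hg'))),
      rootMultiplicity_mul (mul_ne_zero (pow_ne_zero _ (hmap hf'))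
        ((expand_ne_zero hq0).2 (hmap hg))), rootMultiplicity_pow_eq, rootMultiplicity_pow_eq,
      rootMultiplicity_expand_of_ne_zero (hmap hf) hβ0 hQK,
      rootMultiplicity_expand_of_ne_zero (hmap hg) hβ0 hQK, hβ] at this
    refine ⟨rootMultiplicity β (f'.map i) - rootMultiplicity β (g'.map i), ?_⟩
    have h' : (rootMultiplicity α (f.map i) : ℤ) + (q ^ n : ℕ) * rootMultiplicity β (g'.map i) =
        (q ^ n : ℕ) * rootMultiplicity β (f'.map i) + rootMultiplicity α (g.map i) := by
      exact_mod_cast this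
    linear_combination h'
  have heq : ∀ α : AlgebraicClosure k, α ≠ 0 →
      rootMultiplicity α (f.map i) = rootMultiplicity α (g.map i) := by
    intro α hα
    by_contra hne
    set D := ((rootMultiplicity α (f.map i) : ℤ) - rootMultiplicity α (g.map i)) with hD
    have hD0 : D ≠ 0 := sub_ne_zero.2 (by exact_mod_cast hne)
    have h1 := Nat.le_of_dvd (Int.natAbs_pos.2 hD0) (Int.natCast_dvd.1 (hdvd D.natAbs α hα))
    exact absurd (Nat.lt_pow_self h.prime.one_lt) (not_lt.2 h1)
  -- the roots of `f` and `g` agree away from `0`, so that `f / g` is a constant times a power of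
  -- `X`
  set u := rootMultiplicity 0 (f.map i)
  set v := rootMultiplicity 0 (g.map i)
  obtain ⟨c, hc, hfg⟩ := exists_eq_C_mul_of_rootMultiplicity_eq (f := f * X ^ v) (g := g * X ^ u)
    (mul_ne_zero hf (pow_ne_zero _ X_ne_zero)) (mul_ne_zero hg (pow_ne_zero _ X_ne_zero)) (by
      intro α
      have hX : ∀ n, (X ^ n : (AlgebraicClosure k)[X]) ≠ 0 := fun n => pow_ne_zero _ X_ne_zero
      simp only [Polynomial.map_mul, Polynomial.map_pow, map_X]
      rw [rootMultiplicity_mul (mul_ne_zero (hmap hf) (hX _)),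
        rootMultiplicity_mul (mul_ne_zero (hmap hg) (hX _)), rootMultiplicity_pow_eq,
        rootMultiplicity_pow_eq]
      by_cases hα : α = 0
      · subst hα
        have : rootMultiplicity (0 : AlgebraicClosure k) X = 1 := by
          have := rootMultiplicity_X_sub_C_self (x := (0 : AlgebraicClosure k))
          simpa using this
        rw [this]
        change u + v * 1 = v + u * 1
        ring
      · have : rootMultiplicity α (X : (AlgebraicClosure k)[X]) = 0 :=
          rootMultiplicity_eq_zero (by simpa [IsRoot] using hα)
        rw [this, heq α hα]
        simp)
  have hs0 : s l ≠ 0 := fun h0 => h.transcendental l (h0 ▸ isAlgebraic_zero)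
  have hxc : x = algebraMap k Ω c * s l ^ ((u : ℤ) - v) := by
    have h1 := congrArg (aeval (s l)) hfg
    simp only [map_mul, map_pow, aeval_X, aeval_C] at h1
    have h2 := aeval_ne_zero_of_transcendental (h.transcendental l) hg
    rw [hxfg, zpow_sub₀ hs0, zpow_natCast, zpow_natCast]
    field_simp
    linear_combination h1
  -- the constant is high: its roots are obtained from those of `x` and of `s l`, and they are
  -- algebraic
  refine ⟨l, u - v, c, ⟨(_root_.map_ne_zero _).2 hc, fun n => ?_⟩, hxc⟩
  obtain ⟨y, hy, hyx⟩ := hx.2 n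
  have e : (y * s (l + n) ^ (-((u : ℤ) - v))) ^ q ^ n = algebraMap k Ω c := by
    rw [mul_pow, hyx, ← zpow_natCast (s (l + n) ^ _), zpow_comm, zpow_natCast, h.pow_pow, hxc,
      mul_assoc, ← zpow_add₀ hs0, add_neg_cancel, zpow_zero, mul_one]
  refine ⟨_, h.mem_bot_of_isAlgebraic ?_ ?_, e⟩
  · exact mul_mem hy (zpow_mem (show s (l + n) ∈ stepField k s r from
      subset_adjoin _ _ (Or.inl ⟨_, rfl⟩)) _)
  · exact IsAlgebraic.of_pow (pow_pos h.prime.pos n) (e ▸ isAlgebraic_algebraMap c)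

theorem transcendental_inv {s : Ω} (hs : Transcendental k s) : Transcendental k s⁻¹ := fun h =>
  hs (by simpa using h.inv)

/-- A binomial `c * s ^ m - A` with `m ≠ 0` is not a square in `k(s)`. -/
theorem mul_zpow_sub_ne_sq (h2 : (2 : k) ≠ 0) {s : Ω} (hs : Transcendental k s) {c A : k}
    (hc : c ≠ 0) (hA : A ≠ 0) {m : ℤ} (hm : m ≠ 0) {b : Ω} (hb : b ∈ k⟮s⟯) :
    algebraMap k Ω c * s ^ m - algebraMap k Ω A ≠ b ^ 2 := by
  intro h
  -- replacing `s` by its inverse if necessary, the exponent is positive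
  obtain ⟨s, hs, hb, n, hn, h⟩ : ∃ s : Ω, Transcendental k s ∧ b ∈ k⟮s⟯ ∧ ∃ n : ℕ, n ≠ 0 ∧
      algebraMap k Ω c * s ^ n - algebraMap k Ω A = b ^ 2 := by
    rcases Int.eq_nat_or_neg m with ⟨n, rfl | rfl⟩
    · exact ⟨s, hs, hb, n, by simpa using hm, by simpa using h⟩
    · refine ⟨s⁻¹, transcendental_inv hs, ?_, n, by simpa using hm, by simpa using h⟩
      have : k⟮s⟯ ≤ k⟮s⁻¹⟯ := adjoin_simple_le_iff.2
        (by simpa using inv_mem (mem_adjoin_simple_self k s⁻¹))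
      exact this hb
  obtain ⟨f, g, hg, rfl⟩ := mem_adjoin_simple_iff_ne_zero.1 hb
  have h1 : (C c * X ^ n - C A) * g ^ 2 = f ^ 2 := by
    apply eq_of_aeval_eq_of_transcendental hs
    have hg' := aeval_ne_zero_of_transcendental hs hg
    simp only [map_mul, map_pow, aeval_C, map_sub, aeval_X]
    rw [h]
    field_simp
  obtain ⟨u, rfl⟩ : g ∣ f := (UniqueFactorizationMonoid.pow_dvd_pow_iff_dvd two_ne_zero).1
    ⟨C c * X ^ n - C A, by rw [← h1]; ring⟩
  have hu : C c * X ^ n - C A = u ^ 2 := by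
    have : g ^ 2 * (C c * X ^ n - C A) = g ^ 2 * u ^ 2 := by linear_combination h1
    exact mul_left_cancel₀ (pow_ne_zero 2 hg) this
  have hdeg : (C c * X ^ n - C A).natDegree = n := by
    rw [natDegree_sub_C, natDegree_C_mul_X_pow _ _ hc]
  have hlead : (C c * X ^ n - C A).leadingCoeff = c := by
    rw [leadingCoeff, hdeg]
    simp [coeff_C, hn]
  have hd : n = 2 * u.natDegree := by rw [← hdeg, hu, natDegree_pow]
  have hl : c = u.leadingCoeff ^ 2 := by rw [← hlead, hu, leadingCoeff_pow]
  set γ := u.leadingCoeff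
  -- subtracting the leading term, a nonzero constant is the product of `u ± γ * X ^ deg u`; then
  -- both factors are constant, and so is `2 * u`
  have hfac : (u - C γ * X ^ u.natDegree) * (u + C γ * X ^ u.natDegree) = C (-A) := by
    have : (u - C γ * X ^ u.natDegree) * (u + C γ * X ^ u.natDegree) =
      u ^ 2 - C (γ ^ 2) * X ^ (2 * u.natDegree) := by rw [C_pow]; ring
    rw [this, ← hu, ← hl, ← hd, C_neg]; ring
  have hunit : IsUnit ((u - C γ * X ^ u.natDegree) * (u + C γ * X ^ u.natDegree)) := by
    rw [hfac]; exact isUnit_C.2 (neg_ne_zero.2 hA).isUnit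
  have hd1 := natDegree_eq_zero_of_isUnit (isUnit_of_mul_isUnit_left hunit)
  have hd2 := natDegree_eq_zero_of_isUnit (isUnit_of_mul_isUnit_right hunit)
  have h3 : (C 2 * u).natDegree ≤ 0 := by
    have : C 2 * u = (u - C γ * X ^ u.natDegree) + (u + C γ * X ^ u.natDegree) := by
      rw [show (C 2 : k[X]) = 2 from rfl]; ring
    rw [this]
    exact (natDegree_add_le _ _).trans (by rw [hd1, hd2]; simp)
  rw [natDegree_C_mul h2] at h3
  omega

/-- If `c * s ^ m - A` is the product of a square of `k(s)` and some distinct binomials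
`s ^ M - a i`, then each `M`-th root `β` of each `a i` is a root of odd order of the
right-hand side, hence a root of the left-hand side. -/
theorem exists_eq_mul_of_mul_zpow_sub_eq {s : Ω} (hs : Transcendental k s) {c A : k}
    (hc : c ≠ 0) (hA : A ≠ 0) {m : ℤ} (hm : m ≠ 0) {b : Ω} (hb : b ∈ k⟮s⟯) {ι : Type*} {a : ι → k}
    (ha : Function.Injective a) (ha0 : ∀ i, a i ≠ 0) {M : ℕ} (hM : (M : k) ≠ 0) {J : Finset ι}
    {e : k} (he : e ≠ 0) (h : algebraMap k Ω c * s ^ m - algebraMap k Ω A =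
      algebraMap k Ω e * b ^ 2 * ∏ i ∈ J, (s ^ M - algebraMap k Ω (a i))) {i : ι} (hiJ : i ∈ J) :
    ∃ N : ℤ, m = M * N ∧ A = c * a i ^ N := by
  classical
  have hs0 : s ≠ 0 := fun h0 => hs (h0 ▸ isAlgebraic_zero)
  set j := algebraMap k (AlgebraicClosure k) with hj
  have hM0 : 0 < M := Nat.pos_of_ne_zero (by rintro rfl; simp at hM)
  have hmap : ∀ {p : k[X]}, p ≠ 0 → p.map j ≠ 0 := fun hp =>
    (Polynomial.map_ne_zero_iff j.injective).2 hp
  obtain ⟨f, g, hg, rfl⟩ := mem_adjoin_simple_iff_ne_zero.1 hb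
  set B : k[X] := ∏ i ∈ J, (X ^ M - C (a i)) with hB
  have hsep : B.Separable := separable_prod_X_pow_sub_C ha ha0 hM J
  -- clearing denominators gives an identity of polynomials
  obtain ⟨δ, P, hP, hPδ, hPe⟩ : ∃ (δ : ℕ) (P : k[X]), P ≠ 0 ∧
      aeval s P = s ^ δ * (algebraMap k Ω c * s ^ m - algebraMap k Ω A) ∧
      ∀ β : AlgebraicClosure k, β ≠ 0 → eval β (P.map j) = 0 → j c * β ^ m = j A := by
    rcases Int.eq_nat_or_neg m with ⟨n, rfl | rfl⟩
    · have hn : n ≠ 0 := by simpa using hm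
      refine ⟨0, C c * X ^ n - C A, fun h0 => ?_, by simp, fun β hβ h0 => ?_⟩
      · have := congrArg (coeff · 0) h0
        simp [hn.symm] at this
        exact hA this
      · simp only [Polynomial.map_sub, Polynomial.map_mul, map_C, Polynomial.map_pow, map_X,
          eval_sub, eval_mul, eval_C, eval_pow, eval_X] at h0
        rw [zpow_natCast]
        exact sub_eq_zero.1 h0
    · have hn : n ≠ 0 := by simpa using hm
      refine ⟨n, C c - C A * X ^ n, fun h0 => ?_, ?_, fun β hβ h0 => ?_⟩
      · have := congrArg (coeff · 0) h0
        simp [hn.symm] at this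
        exact hc this
      · simp only [map_sub, map_mul, map_pow, aeval_C, aeval_X, zpow_neg, zpow_natCast]
        field_simp
      · simp only [Polynomial.map_sub, Polynomial.map_mul, map_C, Polynomial.map_pow, map_X,
          eval_sub, eval_mul, eval_C, eval_pow, eval_X] at h0
        rw [zpow_neg, zpow_natCast, sub_eq_zero.1 h0]
        field_simp
  have hpoly : P * g ^ 2 = X ^ δ * C e * f ^ 2 * B := by
    apply eq_of_aeval_eq_of_transcendental hs
    have hg' := aeval_ne_zero_of_transcendental hs hg
    rw [map_mul, hPδ, h]
    simp only [map_mul, map_pow, aeval_C, hB, map_prod, map_sub, aeval_X]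
    field_simp
  have hf : f ≠ 0 := by
    rintro rfl
    have : P * g ^ 2 = 0 := by rw [hpoly]; simp
    exact mul_ne_zero hP (pow_ne_zero 2 hg) this
  -- `β` is a simple root of `B`, while the squares contribute even multiplicities, so `β` is a root
  -- of `P`
  have key : ∀ β : AlgebraicClosure k, β ^ M = j (a i) → j c * β ^ m = j A := by
    intro β hβ
    have hβ0 : β ≠ 0 := by
      rintro rfl
      rw [zero_pow hM0.ne'] at hβ
      exact ha0 i ((map_eq_zero j).1 hβ.symm)
    refine hPe β hβ0 ?_
    have h1 := congrArg (fun p => rootMultiplicity β (p.map j)) hpoly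
    simp only [Polynomial.map_mul, Polynomial.map_pow, map_X, map_C] at h1
    have hX : (X ^ δ : (AlgebraicClosure k)[X]) ≠ 0 := pow_ne_zero _ X_ne_zero
    have hCe : C (j e) ≠ 0 := C_ne_zero.2 ((_root_.map_ne_zero j).2 he)
    have hne1 : X ^ δ * C (j e) * f.map j ^ 2 ≠ 0 :=
      mul_ne_zero (mul_ne_zero hX hCe) (pow_ne_zero 2 (hmap hf))
    rw [rootMultiplicity_mul (mul_ne_zero (hmap hP) (pow_ne_zero 2 (hmap hg))),
      rootMultiplicity_mul (mul_ne_zero hne1 (hmap hsep.ne_zero)), rootMultiplicity_mul hne1,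
      rootMultiplicity_mul (mul_ne_zero hX hCe), rootMultiplicity_C, rootMultiplicity_pow_eq,
      rootMultiplicity_pow_eq, rootMultiplicity_pow_eq,
      rootMultiplicity_eq_zero (p := X) (by simpa [IsRoot] using hβ0)] at h1
    have h2 : rootMultiplicity β (B.map j) = 1 := by
      refine le_antisymm (rootMultiplicity_le_one_of_separable hsep.map β) ?_
      refine (rootMultiplicity_pos (hmap hsep.ne_zero)).2 ?_
      rw [IsRoot, hB, Polynomial.map_prod, eval_prod]
      exact Finset.prod_eq_zero hiJ (by simp [hβ, hj])
    have h3 : 0 < rootMultiplicity β (P.map j) := by omega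
    exact (rootMultiplicity_pos (hmap hP)).1 h3
  have hMK : (M : AlgebraicClosure k) ≠ 0 := by
    have := (_root_.map_ne_zero j).2 hM
    rwa [map_natCast] at this
  have : NeZero (M : AlgebraicClosure k) := ⟨hMK⟩
  obtain ⟨ζ, hζ⟩ := HasEnoughRootsOfUnity.exists_primitiveRoot (AlgebraicClosure k) M
  obtain ⟨β, hβ⟩ := IsAlgClosed.exists_pow_nat_eq (j (a i)) hM0
  have hβ0 : β ≠ 0 := by
    rintro rfl
    rw [zero_pow hM0.ne'] at hβ
    exact ha0 i ((map_eq_zero j).1 hβ.symm)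
  -- all `M`-th roots of `a i` have the same `m`-th power, hence `M` divides `m`
  have h1 := key β hβ
  have h2 := key (ζ * β) (by rw [mul_pow, hζ.pow_eq_one, one_mul, hβ])
  have h3 : ζ ^ m = 1 := by
    rw [mul_zpow, ← h1] at h2
    have hne : j c * β ^ m ≠ 0 := mul_ne_zero ((_root_.map_ne_zero j).2 hc) (zpow_ne_zero _ hβ0)
    have : ζ ^ m * (j c * β ^ m) = 1 * (j c * β ^ m) := by linear_combination h2
    exact mul_right_cancel₀ hne this
  obtain ⟨N, rfl⟩ := (hζ.zpow_eq_one_iff_dvd m).1 h3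
  refine ⟨N, rfl, j.injective ?_⟩
  rw [← h1, map_mul, map_zpow₀, ← hβ, zpow_mul, zpow_natCast]

/-- If `c * s_l ^ m - A` has a square root in a radical step, then it comes, up to the obvious
changes, from one of the elements `a i`. -/
theorem IsRadicalStep.exists_of_mul_zpow_sub_eq_sq {q : ℕ} {s : ℕ → Ω} {ι : Type*} {a ε : ι → k}
    {r : ι → Ω} (h : IsRadicalStep q s a ε r) {c A : k} (hc : c ≠ 0) (hA : A ≠ 0) {l : ℕ} {m : ℤ}
    (hm : m ≠ 0) {z : Ω} (hz : z ∈ stepField k s r)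
    (hz2 : z ^ 2 = algebraMap k Ω c * s l ^ m - algebraMap k Ω A) :
    ∃ (i : ι) (N : ℤ), m = (q ^ l : ℕ) * N ∧ A = c * a i ^ N := by
  obtain ⟨l', hl', J, b, hb, rfl⟩ := h.exists_eq_mul_prod hz (l := l) (by
    rw [hz2]
    exact sub_mem (mul_mem (_root_.algebraMap_mem _ _) (zpow_mem (mem_adjoin_simple_self k _) _))
      (_root_.algebraMap_mem _ _))
  obtain ⟨d, rfl⟩ := Nat.exists_eq_add_of_le hl'
  have hq0 : q ≠ 0 := h.prime.ne_zero
  have hm' : ((q ^ d : ℕ) : ℤ) * m ≠ 0 := mul_ne_zero (by simp [hq0]) hm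
  have hsm : s l ^ m = s (l + d) ^ (((q ^ d : ℕ) : ℤ) * m) := by
    rw [zpow_mul, zpow_natCast, h.pow_pow]
  rw [hsm, mul_pow, ← Finset.prod_pow] at hz2
  rcases J.eq_empty_or_nonempty with rfl | ⟨i, hi⟩
  · exact absurd (by simpa using hz2.symm)
      (mul_zpow_sub_ne_sq h.two_ne (h.transcendental _) hc hA hm' hb)
  · obtain ⟨N, hN, hAN⟩ := exists_eq_mul_of_mul_zpow_sub_eq (h.transcendental _) hc hA hm' hb h.inj
      h.a_ne (M := q ^ (l + d)) (by rw [Nat.cast_pow]; exact pow_ne_zero _ h.q_ne) (J := J)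
      (e := ∏ i ∈ J, ε i) (Finset.prod_ne_zero_iff.2 fun i _ => h.ε_ne i) (by
        rw [← hz2, h.pow_zero, map_prod, mul_right_comm, ← Finset.prod_mul_distrib, mul_comm]
        simp only [h.sq]) hi
    refine ⟨i, N, ?_, hAN⟩
    have hqd : ((q ^ d : ℕ) : ℤ) ≠ 0 := by simp [hq0]
    apply mul_left_cancel₀ hqd
    rw [hN]; push_cast; ring

end Rational

/-! ### Extending homomorphisms to a radical step -/

section Extension
variable {k Ω Ω' : Type*} [Field k] [Field Ω] [Algebra k Ω] [Field Ω']

theorem ringHom_adjoin_ext {S : Set Ω} {φ φ' : adjoin k S →+* Ω'}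
    (hk : ∀ c, φ (algebraMap k _ c) = φ' (algebraMap k _ c))
    (hS : ∀ x (hx : x ∈ S), φ ⟨x, subset_adjoin k S hx⟩ = φ' ⟨x, subset_adjoin k S hx⟩) : φ = φ' := by
  ext ⟨x, hx⟩
  induction hx using adjoin_induction with
  | mem x hx => exact hS x hx
  | algebraMap c => exact hk c
  | add x y hx hy h1 h2 =>
    have e : (⟨x + y, add_mem hx hy⟩ : adjoin k S) = ⟨x, hx⟩ + ⟨y, hy⟩ := rfl
    rw [e, map_add, map_add, h1, h2]
  | mul x y hx hy h1 h2 =>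
    have e : (⟨x * y, mul_mem hx hy⟩ : adjoin k S) = ⟨x, hx⟩ * ⟨y, hy⟩ := rfl
    rw [e, map_mul, map_mul, h1, h2]
  | inv x hx h1 =>
    have e : (⟨x⁻¹, inv_mem hx⟩ : adjoin k S) = (⟨x, hx⟩ : adjoin k S)⁻¹ := rfl
    rw [e, map_inv₀, map_inv₀, h1]

/-- A homomorphism on the field generated by a family `x` with prescribed values on the family
exists as soon as one exists for each finite part of the family. -/
theorem exists_ringHom_adjoin_range {κ : Type*} (ψ : k →+* Ω') (x : κ → Ω) (y : κ → Ω')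
    (h : ∀ T : Finset κ, ∃ φ : adjoin k (x '' T) →+* Ω', (∀ c, φ (algebraMap k _ c) = ψ c) ∧
      ∀ i (hi : i ∈ T), φ ⟨x i, subset_adjoin _ _ ⟨i, hi, rfl⟩⟩ = y i) :
    ∃ φ : adjoin k (Set.range x) →+* Ω', (∀ c, φ (algebraMap k _ c) = ψ c) ∧
      ∀ i, φ ⟨x i, subset_adjoin _ _ ⟨i, rfl⟩⟩ = y i := by
  classical
  choose Φ hΦk hΦx using h
  have hmono : ∀ {T T' : Finset κ}, T ⊆ T' → adjoin k (x '' T) ≤ adjoin k (x '' T') := fun hT =>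
    adjoin.mono _ _ _ (Set.image_mono (by exact_mod_cast hT))
  have hcomp : ∀ {T T' : Finset κ} (hT : T ⊆ T') (z : adjoin k (x '' T)),
      Φ T' (inclusion (hmono hT) z) = Φ T z := by
    intro T T' hT z
    have : (Φ T').comp (inclusion (hmono hT)).toRingHom = Φ T := by
      apply ringHom_adjoin_ext
      · intro c
        rw [hΦk]
        exact hΦk T' c
      · rintro _ ⟨i, hi, rfl⟩
        rw [hΦx T i hi]
        exact hΦx T' i (hT hi)
    exact congrArg (fun f => f z) this
  have hex : ∀ z ∈ adjoin k (Set.range x), ∃ T : Finset κ, z ∈ adjoin k (x '' T) := by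
    intro z hz
    obtain ⟨S, hS, hz⟩ := exists_finset_of_mem_adjoin hz
    rw [← Set.image_univ] at hS
    obtain ⟨T, -, rfl⟩ := Finset.subset_set_image_iff.1 hS
    exact ⟨T, by simpa using hz⟩
  -- the value at `z` is computed in some finite part that contains `z`, and does not depend on it
  choose τ hτ using hex
  have hwd : ∀ {T T' : Finset κ} {z : Ω} (hz : z ∈ adjoin k (x '' T)) (hz' : z ∈ adjoin k (x '' T')),
      Φ T ⟨z, hz⟩ = Φ T' ⟨z, hz'⟩ := fun {T T' z} hz hz' =>
    (hcomp (Finset.subset_union_left (s₁ := T) (s₂ := T')) ⟨z, hz⟩).symm.trans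
      (hcomp (Finset.subset_union_right (s₁ := T) (s₂ := T')) ⟨z, hz'⟩)
  let f : adjoin k (Set.range x) → Ω' := fun z => Φ (τ z z.2) ⟨z, hτ z z.2⟩
  have hf : ∀ (z : adjoin k (Set.range x)) {T : Finset κ} (hz : (z : Ω) ∈ adjoin k (x '' T)),
      f z = Φ T ⟨z, hz⟩ := fun z _ hz => hwd _ _
  have hpair : ∀ z w : adjoin k (Set.range x), ∃ T : Finset κ, (z : Ω) ∈ adjoin k (x '' T) ∧
      (w : Ω) ∈ adjoin k (x '' T) := fun z w =>
    ⟨τ z z.2 ∪ τ w w.2, hmono Finset.subset_union_left (hτ z z.2),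
      hmono Finset.subset_union_right (hτ w w.2)⟩
  have hcoe : ∀ c : k, f (algebraMap k _ c) = ψ c := fun c =>
    (hf _ (T := ∅) (_root_.algebraMap_mem _ c)).trans (hΦk ∅ c)
  refine ⟨{ toFun := f, map_one' := ?_, map_zero' := ?_, map_add' := ?_, map_mul' := ?_ }, hcoe, ?_⟩
  · simpa using hcoe 1
  · intro z w
    obtain ⟨T, hz, hw⟩ := hpair z w
    rw [hf z hz, hf w hw, hf (z * w) (mul_mem hz hw), ← map_mul]
    rfl
  · simpa using hcoe 0
  · intro z w
    obtain ⟨T, hz, hw⟩ := hpair z w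
    rw [hf z hz, hf w hw, hf (z + w) (add_mem hz hw), ← map_add]
    rfl
  · intro i
    have hi : x i ∈ adjoin k (x '' ({i} : Finset κ)) := subset_adjoin _ _ ⟨i, by simp, rfl⟩
    exact (hf ⟨x i, subset_adjoin _ _ ⟨i, rfl⟩⟩ hi).trans (hΦx {i} i (Finset.mem_singleton_self i))

/-- A homomorphism `ψ` on `k` extends to `k(s)`, for `s` transcendental over `k`, with any value at
`s` that is transcendental over `ψ(k)`. -/
theorem exists_ringHom_adjoin_transcendental {s : Ω} (hs : Transcendental k s)
    (ψ : k →+* Ω') {s' : Ω'} (hs' : ∀ f : k[X], f ≠ 0 → eval₂ ψ s' f ≠ 0) :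
    ∃ φ : k⟮s⟯ →+* Ω', (∀ c, φ (algebraMap k _ c) = ψ c) ∧
      φ ⟨s, mem_adjoin_simple_self k s⟩ = s' := by
  have hinj : Function.Injective (eval₂RingHom ψ s') :=
    (injective_iff_map_eq_zero _).2 fun f hf => by_contra fun h => hs' f h hf
  let g : RatFunc k →+* Ω' := IsFractionRing.lift hinj
  let e := RatFunc.algEquivOfTranscendental s hs
  have hg : ∀ f : k[X], g (algebraMap k[X] (RatFunc k) f) = eval₂ ψ s' f := fun f =>
    IsFractionRing.lift_algebraMap hinj f
  refine ⟨g.comp e.symm.toRingEquiv.toRingHom, fun c => ?_, ?_⟩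
  · have : e.symm (algebraMap k _ c) = algebraMap k[X] (RatFunc k) (C c) := by
      rw [e.symm.commutes]; rfl
    change g (e.symm (algebraMap k _ c)) = _
    rw [this, hg, eval₂_C]
  · have : e.symm ⟨s, mem_adjoin_simple_self k s⟩ = algebraMap k[X] (RatFunc k) X := by
      rw [AlgEquiv.symm_apply_eq]
      apply Subtype.ext
      simp [e]
    change g (e.symm _) = _
    rw [this, hg, eval₂_X]

/-- A homomorphism on `K` extends to `K(r)`, for a square root `r ∉ K` of an element of `K`, with
any square root of the right element as its value at `r`. -/
theorem exists_ringHom_sup_adjoin_sqrt {K : IntermediateField k Ω} {r : Ω} (hr : r ^ 2 ∈ K)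
    (hrK : r ∉ K) (φ : K →+* Ω') {r' : Ω'} (hr' : r' ^ 2 = φ ⟨r ^ 2, hr⟩) :
    ∃ φ' : (K ⊔ k⟮r⟯ : IntermediateField k Ω) →+* Ω',
      (∀ z : K, φ' ⟨z, (le_sup_left : K ≤ _) z.2⟩ = φ z) ∧
      φ' ⟨r, (le_sup_right : k⟮r⟯ ≤ _) (mem_adjoin_simple_self k r)⟩ = r' := by
  let := φ.toAlgebra
  set Q : K[X] := X ^ 2 - C ⟨r ^ 2, hr⟩ with hQ
  have hm : Q.Monic := monic_X_pow_sub_C _ two_ne_zero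
  have h0 : aeval r Q = 0 := by
    rw [hQ, map_sub, map_pow, aeval_X, aeval_C]; exact sub_self _
  have hi : IsIntegral K r := ⟨Q, hm, h0⟩
  have h2 : 2 ≤ (minpoly K r).natDegree := by
    rw [minpoly.two_le_natDegree_iff hi]
    rintro ⟨x, hx⟩
    exact hrK (hx ▸ x.2)
  have hmin : minpoly K r = Q :=
    (Polynomial.eq_of_monic_of_dvd_of_natDegree_le (minpoly.monic hi) hm (minpoly.dvd K r h0)
      (by rw [hQ, natDegree_X_pow_sub_C]; exact h2)).symm
  have hmem : r' ∈ (minpoly K r).aroots Ω' := by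
    rw [mem_aroots, hmin]
    refine ⟨hm.ne_zero, ?_⟩
    rw [hQ, map_sub, map_pow, aeval_X, aeval_C, hr']
    exact sub_self _
  let g : K⟮r⟯ →ₐ[K] Ω' := (algHomAdjoinIntegralEquiv K hi).symm ⟨r', hmem⟩
  have hle : K ⊔ k⟮r⟯ ≤ K⟮r⟯.restrictScalars k := by
    rw [restrictScalars_adjoin, adjoin_union, adjoin_self]
  let j : (K ⊔ k⟮r⟯ : IntermediateField k Ω) →+* K⟮r⟯ :=
    (algebraMap (K ⊔ k⟮r⟯ : IntermediateField k Ω) Ω).codRestrict K⟮r⟯ fun z => hle z.2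
  refine ⟨g.toRingHom.comp j, fun z => g.commutes z, ?_⟩
  exact algHomAdjoinIntegralEquiv_symm_apply_gen K hi ⟨r', hmem⟩

/-- The restriction of a homomorphism to a smaller intermediate field. -/
def restrictHom {K L : IntermediateField k Ω} (hle : K ≤ L) (φ : L →+* Ω') : K →+* Ω' :=
  φ.comp (inclusion hle).toRingHom

theorem restrictHom_mk {K L : IntermediateField k Ω} (hle : K ≤ L) (φ : L →+* Ω') {x : Ω}
    (hx : x ∈ K) : restrictHom hle φ ⟨x, hx⟩ = φ ⟨x, hle hx⟩ := rfl

theorem restrictHom_algebraMap {K L : IntermediateField k Ω} (hle : K ≤ L) (φ : L →+* Ω') (c : k) :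
    restrictHom hle φ (algebraMap k K c) = φ (algebraMap k L c) := rfl

theorem s_mem_stepPart (s : ℕ → Ω) {ι : Type*} (r : ι → Ω) (l : ℕ) (J : Finset ι) :
    s l ∈ stepPart k s r l J :=
  (le_sup_left : k⟮s l⟯ ≤ _) (mem_adjoin_simple_self k _)

theorem r_mem_stepPart (s : ℕ → Ω) {ι : Type*} (r : ι → Ω) (l : ℕ) {J : Finset ι} {i : ι}
    (hi : i ∈ J) : r i ∈ stepPart k s r l J :=
  (le_sup_right : _ ≤ k⟮s l⟯ ⊔ _) (subset_adjoin _ _ ⟨i, hi, rfl⟩)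

theorem s_mem_stepField (s : ℕ → Ω) {ι : Type*} (r : ι → Ω) (l : ℕ) : s l ∈ stepField k s r :=
  subset_adjoin _ _ (Or.inl ⟨l, rfl⟩)

theorem r_mem_stepField (s : ℕ → Ω) {ι : Type*} (r : ι → Ω) (i : ι) : r i ∈ stepField k s r :=
  subset_adjoin _ _ (Or.inr ⟨i, rfl⟩)

namespace IsRadicalStep
variable {q : ℕ} {s : ℕ → Ω} {ι : Type*} {a ε : ι → k} {r : ι → Ω} (h : IsRadicalStep q s a ε r)
include h

theorem exists_ringHom_stepPart_insert [DecidableEq ι] {ψ : k →+* Ω'} {s' : Ω'} {s'' : Ω'}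
    {r' : ι → Ω'} (l : ℕ) (hroot : s' ^ q ^ l = s'')
    (hsq : ∀ i, r' i ^ 2 = ψ (ε i) * (s'' - ψ (a i))) {J : Finset ι} {i : ι} (hi : i ∉ J)
    {φ : stepPart k s r l J →+* Ω'} (h1 : ∀ c, φ (algebraMap k _ c) = ψ c)
    (h2 : φ ⟨s l, s_mem_stepPart s r l J⟩ = s') :
    ∃ φ' : stepPart k s r l (insert i J) →+* Ω',
      (∀ z (hz : z ∈ stepPart k s r l J),
        φ' ⟨z, h.stepPart_mono le_rfl (Finset.subset_insert i J) hz⟩ = φ ⟨z, hz⟩) ∧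
      φ' ⟨r i, r_mem_stepPart s r l (Finset.mem_insert_self i J)⟩ = r' i := by
  have hle0 : k⟮s l⟯ ≤ stepPart k s r l J := le_sup_left
  have hr : r i ^ 2 ∈ stepPart k s r l J := hle0 (h.sq_mem l i)
  have hs0 : φ ⟨s 0, hle0 (h.zero_mem l)⟩ = s'' := by
    have e : (⟨s 0, hle0 (h.zero_mem l)⟩ : stepPart k s r l J) =
      ⟨s l, s_mem_stepPart s r l J⟩ ^ q ^ l := Subtype.ext (h.pow_zero l).symm
    rw [e, map_pow, h2, hroot]
  obtain ⟨φ', h4, h5⟩ := exists_ringHom_sup_adjoin_sqrt hr (h.notMem_stepPart l hi) φ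
    (r' := r' i) (by
      have e : (⟨r i ^ 2, hr⟩ : stepPart k s r l J) = algebraMap k _ (ε i) *
        (⟨s 0, hle0 (h.zero_mem l)⟩ - algebraMap k _ (a i)) := Subtype.ext (h.sq i)
      rw [e, map_mul, map_sub, h1, h1, hs0, hsq])
  have hle : stepPart k s r l (insert i J) ≤ stepPart k s r l J ⊔ k⟮r i⟯ :=
    (sup_adjoin_image_insert _ _ _ _).le
  refine ⟨restrictHom hle φ', fun z hz => ?_, ?_⟩
  · rw [restrictHom_mk]
    exact h4 ⟨z, hz⟩
  · rw [restrictHom_mk, h5]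

/-- The extension of a homomorphism to the parts of a step field: one root `s l`, and then the
square roots one by one. That `r i` is not in the part already treated, for `i ∉ J`, is
`notMem_stepPart`. -/
theorem exists_ringHom_stepPart (ψ : k →+* Ω') {s' : ℕ → Ω'} {r' : ι → Ω'}
    (hroot : ∀ l, s' (l + 1) ^ q = s' l) (htr : ∀ l, ∀ f : k[X], f ≠ 0 → eval₂ ψ (s' l) f ≠ 0)
    (hsq : ∀ i, r' i ^ 2 = ψ (ε i) * (s' 0 - ψ (a i))) (l : ℕ) (J : Finset ι) :
    ∃ φ : stepPart k s r l J →+* Ω', (∀ c, φ (algebraMap k _ c) = ψ c) ∧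
      φ ⟨s l, s_mem_stepPart s r l J⟩ = s' l ∧
      ∀ i (hi : i ∈ J), φ ⟨r i, r_mem_stepPart s r l hi⟩ = r' i := by
  classical
  induction J using Finset.induction_on with
  | empty =>
    obtain ⟨φ, h1, h2⟩ := exists_ringHom_adjoin_transcendental (h.transcendental l) ψ (htr l)
    have hle : stepPart k s r l ∅ ≤ k⟮s l⟯ := by simp [stepPart]
    refine ⟨restrictHom hle φ, fun c => ?_, ?_, by simp⟩
    · rw [restrictHom_algebraMap, h1]
    · rw [restrictHom_mk, h2]
  | insert i J hi ih =>
    obtain ⟨φ, h1, h2, h3⟩ := ih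
    obtain ⟨φ', h4, h5⟩ := h.exists_ringHom_stepPart_insert l
      (by simpa using pow_pow_eq_of_root hroot 0 l) hsq hi h1 h2
    refine ⟨φ', fun c => ?_, ?_, fun i' hi' => ?_⟩
    · rw [← h1]
      exact h4 _ (_root_.algebraMap_mem _ c)
    · rw [← h2]
      exact h4 _ (s_mem_stepPart s r l J)
    · rcases Finset.mem_insert.1 hi' with rfl | hi'
      · exact h5
      · rw [← h3 i' hi']
        exact h4 _ (r_mem_stepPart s r l hi')

/-- A homomorphism on the base field of a radical step extends to the step field, with prescribed
values on the generators, as soon as these values satisfy the obvious equations. -/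
theorem exists_ringHom (ψ : k →+* Ω') {s' : ℕ → Ω'} {r' : ι → Ω'}
    (hroot : ∀ l, s' (l + 1) ^ q = s' l) (htr : ∀ l, ∀ f : k[X], f ≠ 0 → eval₂ ψ (s' l) f ≠ 0)
    (hsq : ∀ i, r' i ^ 2 = ψ (ε i) * (s' 0 - ψ (a i))) :
    ∃ φ : stepField k s r →+* Ω', (∀ c, φ (algebraMap k _ c) = ψ c) ∧
      (∀ l, φ ⟨s l, s_mem_stepField s r l⟩ = s' l) ∧
      ∀ i, φ ⟨r i, r_mem_stepField s r i⟩ = r' i := by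
  classical
  obtain ⟨φ, h1, h2⟩ := exists_ringHom_adjoin_range ψ (Sum.elim s r) (Sum.elim s' r') fun T => by
    obtain ⟨m, hm⟩ : ∃ m, m = T.toLeft.sup id := ⟨_, rfl⟩
    obtain ⟨φ, h1, h2, h3⟩ := h.exists_ringHom_stepPart ψ hroot htr hsq m T.toRight
    have hl : ∀ l, Sum.inl l ∈ T → ∃ d, m = l + d := fun l hl =>
      Nat.exists_eq_add_of_le (hm ▸ Finset.le_sup (f := id) (Finset.mem_toLeft.2 hl))
    have hle : adjoin k (Sum.elim s r '' T) ≤ stepPart k s r m T.toRight := by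
      rw [adjoin_le_iff]
      rintro _ ⟨l | i, hi, rfl⟩
      · obtain ⟨d, hd⟩ := hl l hi
        change s l ∈ stepPart k s r m T.toRight
        rw [← h.pow_pow l d, ← hd]
        exact pow_mem (s_mem_stepPart s r m _) _
      · exact r_mem_stepPart s r m (Finset.mem_toRight.2 hi)
    refine ⟨restrictHom hle φ, fun c => ?_, ?_⟩
    · rw [restrictHom_algebraMap, h1]
    rintro (l | i) hi
    · obtain ⟨d, hd⟩ := hl l hi
      have hsl : s l ∈ stepPart k s r m T.toRight := hle (subset_adjoin _ _ ⟨_, hi, rfl⟩)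
      have e : (⟨s l, hsl⟩ : stepPart k s r m T.toRight) =
        ⟨s m, s_mem_stepPart s r m _⟩ ^ q ^ d := Subtype.ext (by
          change s l = s m ^ q ^ d
          rw [hd, h.pow_pow])
      have e2 : φ ⟨s l, hsl⟩ = s' l := by
        rw [e, map_pow, h2, hd, pow_pow_eq_of_root hroot]
      rw [restrictHom_mk]
      exact e2
    · rw [restrictHom_mk]
      exact h3 i (Finset.mem_toRight.2 hi)
  have hle : stepField k s r ≤ adjoin k (Set.range (Sum.elim s r)) := by
    rw [Set.Sum.elim_range]; exact le_rfl
  refine ⟨restrictHom hle φ, fun c => ?_, fun l => ?_, fun i => ?_⟩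
  · rw [restrictHom_algebraMap, h1]
  · rw [restrictHom_mk]; exact h2 (Sum.inl l)
  · rw [restrictHom_mk]; exact h2 (Sum.inr i)

end IsRadicalStep

end Extension

/-! ### Towers of fields and high elements -/

section Tower
variable {F Ω : Type*} [Field F] [Field Ω] [Algebra F Ω]

/-- `K` is algebraically closed in `L`. -/
def IsClosedIn (K L : IntermediateField F Ω) : Prop :=
  ∀ z ∈ L, IsAlgebraic K z → z ∈ K

theorem mem_bot_coe_iff {K : IntermediateField F Ω} {z : Ω} :
    z ∈ (⊥ : IntermediateField K Ω) ↔ z ∈ K := by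
  rw [mem_bot]
  exact ⟨fun ⟨x, hx⟩ => hx ▸ x.2, fun h => ⟨⟨z, h⟩, rfl⟩⟩

theorem IsRadicalStep.isClosedIn {K L : IntermediateField F Ω} {q : ℕ} {s : ℕ → Ω} {ι : Type*}
    {a ε : ι → K} {r : ι → Ω} (h : IsRadicalStep q s a ε r)
    (hL : L = (stepField K s r).restrictScalars F) : IsClosedIn K L := fun z hz ha => by
  rw [hL] at hz
  exact mem_bot_coe_iff.1 (h.mem_bot_of_isAlgebraic hz ha)

theorem IsRadicalStep.mem_of_isHighIn {K L : IntermediateField F Ω} {q : ℕ} {s : ℕ → Ω} {ι : Type*}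
    {a ε : ι → K} {r : ι → Ω} (h : IsRadicalStep q s a ε r)
    (hL : L = (stepField K s r).restrictScalars F) {q' : ℕ} (hq' : q'.Prime) (hne : q' ≠ q)
    (hne2 : q' ≠ 2) {x : Ω} (hx : IsHighIn L q' x) : x ∈ K := by
  subst hL
  exact mem_bot_coe_iff.1 (h.mem_bot_of_isHighIn hq' hne hne2 hx)

theorem isAlgebraic_of_le {K L : IntermediateField F Ω} (hKL : K ≤ L) {z : Ω} (h : IsAlgebraic K z) :
    IsAlgebraic L z := by
  obtain ⟨f, hf, h0⟩ := h
  refine ⟨f.map (inclusion hKL).toRingHom,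
    (Polynomial.map_ne_zero_iff (inclusion hKL).toRingHom.injective).2 hf, ?_⟩
  rw [aeval_def, eval₂_map]
  exact h0

theorem IsHighIn.of_isClosedIn {K L : IntermediateField F Ω} (h : IsClosedIn K L) {q : ℕ} (hq : 0 < q)
    {x : Ω} (hx : IsHighIn L q x) (hxK : x ∈ K) : IsHighIn K q x := by
  refine ⟨hx.1, fun n => ?_⟩
  obtain ⟨y, hy, hyx⟩ := hx.2 n
  refine ⟨y, h y hy (IsAlgebraic.of_pow (pow_pos hq n) ?_), hyx⟩
  rw [hyx]
  exact isAlgebraic_algebraMap (⟨x, hxK⟩ : K)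

variable {K : ℕ → IntermediateField F Ω}

theorem mem_iSup_of_monotone (hK : Monotone K) {x : Ω} : x ∈ ⨆ n, K n ↔ ∃ n, x ∈ K n := by
  rw [← SetLike.mem_coe, coe_iSup_of_directed hK.directed_le]
  simp

theorem isClosedIn_of_le (hK : Monotone K) (hc : ∀ n, IsClosedIn (K n) (K (n + 1))) (n m : ℕ) :
    IsClosedIn (K n) (K (n + m)) := by
  induction m with
  | zero => exact fun z hz _ => hz
  | succ m ih =>
    exact fun z hz ha => ih z (hc (n + m) z hz (isAlgebraic_of_le (hK (Nat.le_add_right n m)) ha)) ha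

/-- Each member of a tower of relatively algebraically closed extensions is algebraically closed in
the union. -/
theorem isClosedIn_iSup (hK : Monotone K) (hc : ∀ n, IsClosedIn (K n) (K (n + 1))) (n : ℕ) :
    IsClosedIn (K n) (⨆ n, K n) := by
  intro z hz ha
  obtain ⟨m, hm⟩ := (mem_iSup_of_monotone hK).1 hz
  exact isClosedIn_of_le hK hc n m z (hK (Nat.le_add_left m n) hm) ha

/-- A high element of the union of a tower of relatively algebraically closed extensions is high in
some member, as its roots are algebraic over each member that contains it. -/
theorem IsHighIn.exists_of_iSup (hK : Monotone K) (hc : ∀ n, IsClosedIn (K n) (K (n + 1))) {q : ℕ}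
    (hq : 0 < q) {x : Ω} (hx : IsHighIn (⨆ n, K n) q x) : ∃ n, IsHighIn (K n) q x := by
  obtain ⟨n, hn⟩ := (mem_iSup_of_monotone hK).1 hx.mem
  exact ⟨n, hx.of_isClosedIn (isClosedIn_iSup hK hc n) hq hn⟩

/-- If no step of a tower of relatively algebraically closed extensions has new `q`-high elements,
then neither has the union. -/
theorem IsHighIn.of_iSup (hK : Monotone K) (hc : ∀ n, IsClosedIn (K n) (K (n + 1))) {q : ℕ}
    (hq : 0 < q) (hhigh : ∀ n x, IsHighIn (K (n + 1)) q x → x ∈ K n) {x : Ω}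
    (hx : IsHighIn (⨆ n, K n) q x) : IsHighIn (K 0) q x := by
  obtain ⟨n, hn⟩ := hx.exists_of_iSup hK hc hq
  induction n with
  | zero => exact hn
  | succ n ih => exact ih (hn.of_isClosedIn (hc n) hq (hhigh n x hn))

end Tower

namespace FriedKollar

/-! ### The generators of the fields `K_n(T)` -/

section Generators
variable (F : Type*) [Field F]

/-- The algebraically independent elements `v_i` and `t_n`, as one family. -/
noncomputable def gen (i : ℕ ⊕ ℕ) : Ambient F :=
  algebraMap (FractionRing (MvPolynomial (ℕ ⊕ ℕ) F)) (Ambient F)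
    (algebraMap (MvPolynomial (ℕ ⊕ ℕ) F) _ (MvPolynomial.X i))

theorem v_eq_gen (i : ℕ) : v F i = gen F (Sum.inl i) := rfl

theorem algebraicIndependent_gen : AlgebraicIndependent F (gen F) := by
  have h1 := MvPolynomial.algebraicIndependent_X (ℕ ⊕ ℕ) F
  have h2 := h1.map' (f := IsScalarTower.toAlgHom F (MvPolynomial (ℕ ⊕ ℕ) F)
    (FractionRing (MvPolynomial (ℕ ⊕ ℕ) F))) (IsFractionRing.injective _ _)
  exact h2.map' (f := IsScalarTower.toAlgHom F (FractionRing (MvPolynomial (ℕ ⊕ ℕ) F)) (Ambient F))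
    (algebraMap (FractionRing (MvPolynomial (ℕ ⊕ ℕ) F)) (Ambient F)).injective

/-- The relative algebraic closure of the field generated by some of the elements `v_i` and `t_n`.
-/
noncomputable def closureGen (S : Set (ℕ ⊕ ℕ)) : IntermediateField F (Ambient F) :=
  algClosureOver (adjoin F (gen F '' S))

variable {F}

theorem gen_mem_closureGen {S : Set (ℕ ⊕ ℕ)} {i : ℕ ⊕ ℕ} (hi : i ∈ S) : gen F i ∈ closureGen F S :=
  le_algClosureOver _ (subset_adjoin _ _ ⟨i, hi, rfl⟩)

theorem closureGen_mono {S S' : Set (ℕ ⊕ ℕ)} (h : S ⊆ S') : closureGen F S ≤ closureGen F S' := by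
  intro z hz
  exact mem_algClosureOver.2 (isAlgebraic_of_le (adjoin.mono _ _ _ (Set.image_mono h))
    (mem_algClosureOver.1 hz))

/-- A generator that is not in `S` is transcendental over every field of elements algebraic over the
generators in `S`. -/
theorem transcendental_gen {S : Set (ℕ ⊕ ℕ)} {K : IntermediateField F (Ambient F)}
    (hK : K ≤ closureGen F S) {i : ℕ ⊕ ℕ} (hi : i ∉ S) : Transcendental K (gen F i) := fun h => by
  have h1 := mem_algClosureOver.1 (mem_algClosureOver_of_isAlgebraic hK h)
  exact (transcendental_adjoin_iff.2 ((algebraicIndependent_gen F).transcendental_adjoin hi)) h1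

theorem transcendental_gen_base (i : ℕ ⊕ ℕ) : Transcendental F (gen F i) :=
  (algebraicIndependent_gen F).transcendental i

theorem rootSeq_succ_pow {q : ℕ} (hq : 0 < q) (x : Ambient F) (l : ℕ) :
    rootSeq q x (l + 1) ^ q = rootSeq q x l := root_pow hq _

theorem rootSeq_pow {q : ℕ} (hq : 0 < q) (x : Ambient F) (l : ℕ) : rootSeq q x l ^ q ^ l = x := by
  have h := pow_pow_eq_of_root (rootSeq_succ_pow hq x) 0 l
  rwa [zero_add] at h

theorem rootSeq_mem_closureGen {S : Set (ℕ ⊕ ℕ)} {i : ℕ ⊕ ℕ} (hi : i ∈ S) {q : ℕ} (hq : 0 < q)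
    (l : ℕ) : rootSeq q (gen F i) l ∈ closureGen F S :=
  mem_algClosureOver_of_pow_mem (pow_pos hq l) (by
    rw [rootSeq_pow hq]; exact gen_mem_closureGen hi)

theorem gen_injective : Function.Injective (gen F) := (algebraicIndependent_gen F).injective

end Generators

/-! ### The fields `K_n(T)` as radical steps -/

section Stages
variable (F : Type*) [Field F] (q : ℕ → ℕ)

/-- The conditions on the characteristic of `F` and the sequence of primes `q` that are used
throughout. -/
structure Admissible : Prop where
  two_ne : (2 : F) ≠ 0
  inj : Function.Injective q
  prime : ∀ n, (q n).Prime
  ne_two : ∀ n, q n ≠ 2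
  cast_ne : ∀ n, (q n : F) ≠ 0

variable {F q}

theorem Admissible.pos (h : Admissible F q) (n : ℕ) : 0 < q n := (h.prime n).pos

theorem root_sq (x : Ambient F) : root 2 x ^ 2 = x := root_pow two_pos x

theorem coe_natCast_ne_zero {n : ℕ} (h : (n : F) ≠ 0) (K : IntermediateField F (Ambient F)) :
    (n : K) ≠ 0 := by
  have := (map_ne_zero (algebraMap F K)).2 h
  rwa [map_natCast] at this

theorem rootSeq_v_mem_KStage_zero (T : CombTree) (i l : ℕ) :
    rootSeq (q 0) (v F i) l ∈ KStage F q T 0 :=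
  subset_adjoin F {x | ∃ i l, x = rootSeq (q 0) (v F i) l} ⟨i, l, rfl⟩

theorem v_mem_KStage_zero (T : CombTree) (i : ℕ) : v F i ∈ KStage F q T 0 :=
  rootSeq_v_mem_KStage_zero T i 0

theorem H_subset_KStage (T : CombTree) (n : ℕ) : H F T n ⊆ KStage F q T n := by
  cases n with
  | zero =>
    rintro _ ⟨i, j, -, rfl⟩
    exact add_mem (v_mem_KStage_zero T i) (v_mem_KStage_zero T j)
  | succ n =>
    rintro _ ⟨a, ha, rfl⟩
    have h : root 2 (t F n - a) ∈ (KStage F q T n : Set (Ambient F)) ∪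
        {x | ∃ l, x = rootSeq (q (n + 1)) (t F n) l} ∪ {x | ∃ a ∈ H F T n, x ^ 2 = t F n - a} :=
      Or.inr ⟨a, ha, root_sq _⟩
    exact subset_adjoin F _ h

theorem KStage_zero_le_closureGen (hq : Admissible F q) (T : CombTree) :
    KStage F q T 0 ≤ closureGen F (Set.range Sum.inl) := by
  refine adjoin_le_iff.2 ?_
  rintro _ ⟨i, l, rfl⟩
  exact rootSeq_mem_closureGen (Set.mem_range_self i) (hq.pos 0) l

theorem KStage_le_closureGen (hq : Admissible F q) (T : CombTree) (n : ℕ) :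
    KStage F q T n ≤ closureGen F (Set.range Sum.inl ∪ Sum.inr '' Set.Iio n) := by
  induction n with
  | zero => exact (KStage_zero_le_closureGen hq T).trans (closureGen_mono Set.subset_union_left)
  | succ n ih =>
    have hmono : closureGen F (Set.range Sum.inl ∪ Sum.inr '' Set.Iio n) ≤
        closureGen F (Set.range Sum.inl ∪ Sum.inr '' Set.Iio (n + 1)) :=
      closureGen_mono (Set.union_subset_union_right _ (Set.image_mono
        (Set.Iio_subset_Iio n.le_succ)))
    have ht : (Sum.inr n : ℕ ⊕ ℕ) ∈ Set.range Sum.inl ∪ Sum.inr '' Set.Iio (n + 1) :=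
      Or.inr ⟨n, Nat.lt_succ_self n, rfl⟩
    refine adjoin_le_iff.2 ?_
    rintro x ((hx | ⟨l, rfl⟩) | ⟨a, ha, hx⟩)
    · exact hmono (ih hx)
    · exact rootSeq_mem_closureGen ht (hq.pos _) l
    · refine mem_algClosureOver_of_pow_mem two_pos ?_
      rw [hx]
      exact sub_mem (gen_mem_closureGen ht) (hmono (ih (H_subset_KStage T n ha)))

theorem transcendental_t (hq : Admissible F q) (T : CombTree) (n : ℕ) :
    Transcendental (KStage F q T n) (t F n) :=
  transcendental_gen (KStage_le_closureGen hq T n) (by simp)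

theorem v_add_v_ne_zero {i j : ℕ} (hij : i ≠ j) : v F i + v F j ≠ 0 := by
  intro h
  have h1 := transcendental_gen (F := F) (S := {Sum.inl j}) (i := Sum.inl i)
    (le_algClosureOver _) (by simpa using hij)
  refine h1 ?_
  rw [← v_eq_gen, eq_neg_of_add_eq_zero_left h]
  exact (isAlgebraic_algebraMap (⟨v F j, subset_adjoin _ _ ⟨Sum.inl j, rfl, rfl⟩⟩ :
    adjoin F (gen F '' {Sum.inl j}))).neg

theorem ne_zero_of_mem_H (hq : Admissible F q) (T : CombTree) {n : ℕ} {a : Ambient F}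
    (ha : a ∈ H F T n) : a ≠ 0 := by
  cases n with
  | zero =>
    obtain ⟨i, j, hij, rfl⟩ := ha
    exact v_add_v_ne_zero hij.ne
  | succ n =>
    obtain ⟨a, ha, rfl⟩ := ha
    intro h0
    have h1 := root_sq (t F n - a)
    simp only at h0
    rw [h0, zero_pow two_ne_zero, eq_comm, sub_eq_zero] at h1
    exact transcendental_t hq T n
      (h1 ▸ isAlgebraic_algebraMap (⟨a, H_subset_KStage T n ha⟩ : KStage F q T n))

/-- The passage from `K_n(T)` to `K_{n+1}(T)` is a radical step for the prime `q (n + 1)`. -/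
theorem isRadicalStep_KStage (hq : Admissible F q) (T : CombTree) (n : ℕ) :
    IsRadicalStep (k := KStage F q T n) (q (n + 1)) (rootSeq (q (n + 1)) (t F n))
      (fun a : H F T n => ⟨a, H_subset_KStage T n a.2⟩) (fun _ => 1)
      (fun a : H F T n => root 2 (t F n - a)) where
  prime := hq.prime _
  two_ne := coe_natCast_ne_zero (n := 2) (by exact_mod_cast hq.two_ne) _
  q_ne := coe_natCast_ne_zero (hq.cast_ne _) _
  root := rootSeq_succ_pow (hq.pos _) _
  trans := transcendental_t hq T n
  inj := fun a b h => Subtype.ext (Subtype.mk.inj h)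
  a_ne := fun a h => ne_zero_of_mem_H hq T a.2 (congrArg Subtype.val h)
  ε_ne := fun _ => one_ne_zero
  sq := fun a => by rw [root_sq, map_one, one_mul]; rfl

/-- The roots in the definition of `K_{n+1}(T)` are both square roots of each `t_n - a`; one of them
suffices. -/
theorem KStage_succ_eq (T : CombTree) (n : ℕ) :
    KStage F q T (n + 1) = (stepField (KStage F q T n) (rootSeq (q (n + 1)) (t F n))
      (fun a : H F T n => root 2 (t F n - a))).restrictScalars F := by
  rw [stepField, restrictScalars_adjoin]
  apply le_antisymm
  · refine adjoin_le_iff.2 ?_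
    rintro x ((hx | ⟨l, rfl⟩) | ⟨a, ha, hx⟩)
    · exact subset_adjoin _ _ (Or.inl hx)
    · exact subset_adjoin _ _ (Or.inr (Or.inl ⟨l, rfl⟩))
    · have hr : root 2 (t F n - a) ∈ adjoin F ((KStage F q T n : Set (Ambient F)) ∪
          (Set.range (rootSeq (q (n + 1)) (t F n)) ∪
            Set.range fun a : H F T n => root 2 (t F n - a))) :=
        subset_adjoin _ _ (Or.inr (Or.inr ⟨⟨a, ha⟩, rfl⟩))
      rw [← root_sq (t F n - a), sq_eq_sq_iff_eq_or_eq_neg] at hx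
      rcases hx with rfl | rfl
      · exact hr
      · exact neg_mem hr
  · refine adjoin_le_iff.2 ?_
    rintro x (hx | ⟨l, rfl⟩ | ⟨a, rfl⟩)
    · exact subset_adjoin _ _ (Or.inl (Or.inl hx))
    · exact subset_adjoin _ _ (Or.inl (Or.inr ⟨l, rfl⟩))
    · exact subset_adjoin _ _ (Or.inr ⟨a, a.2, root_sq _⟩)

theorem KStage_monotone (T : CombTree) : Monotone (KStage F q T) :=
  monotone_nat_of_le_succ (KStage_le_succ F q T)

theorem KStage_isClosedIn_succ (hq : Admissible F q) (T : CombTree) (n : ℕ) :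
    IsClosedIn (KStage F q T n) (KStage F q T (n + 1)) :=
  (isRadicalStep_KStage hq T n).isClosedIn (KStage_succ_eq T n)

theorem KStage_isClosedIn (hq : Admissible F q) (T : CombTree) (n : ℕ) :
    IsClosedIn (KStage F q T n) (KTree F q T) :=
  isClosedIn_iSup (KStage_monotone T) (KStage_isClosedIn_succ hq T) n

/-- The `q m`-high elements of `K_T` lie in `K_m(T)`. -/
theorem IsHighIn.KStage_of_KTree (hq : Admissible F q) (T : CombTree) (m : ℕ) {x : Ambient F}
    (hx : IsHighIn (KTree F q T) (q m) x) : IsHighIn (KStage F q T m) (q m) x := by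
  have hmono : Monotone fun n => KStage F q T (m + n) := fun a b hab =>
    KStage_monotone T (Nat.add_le_add_left hab m)
  have e : KTree F q T = ⨆ n, KStage F q T (m + n) := by
    apply le_antisymm
    · exact iSup_le fun n => (KStage_monotone T (Nat.le_add_left n m)).trans
        (le_iSup (fun n => KStage F q T (m + n)) n)
    · exact iSup_le fun n => le_iSup (KStage F q T) (m + n)
  rw [e] at hx
  refine hx.of_iSup hmono (fun n => KStage_isClosedIn_succ hq T (m + n)) (hq.pos m) fun n x hx => ?_
  exact (isRadicalStep_KStage hq T (m + n)).mem_of_isHighIn (KStage_succ_eq T (m + n)) (hq.prime m)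
    (fun h => by have := hq.inj h; omega) (hq.ne_two m) hx

end Stages
end FriedKollar

end

/-! ### Monomials in algebraically independent elements -/

section Monomial
variable {F Ω σ : Type*} [Field F] [Field Ω] [Algebra F Ω]

variable (F) in
/-- `x` is a Laurent monomial with nonzero coefficient in `F` in the elements `w j`: a quotient
of two monomials. -/
def IsMonomial (w : σ → Ω) (x : Ω) : Prop :=
  ∃ (c : F) (a b : σ →₀ ℕ), c ≠ 0 ∧ x * MvPolynomial.aeval w (MvPolynomial.monomial b (1 : F)) =
    MvPolynomial.aeval w (MvPolynomial.monomial a c)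

theorem IsMonomial.const (w : σ → Ω) {c : F} (hc : c ≠ 0) :
    IsMonomial F w (algebraMap F Ω c) :=
  ⟨c, 0, 0, hc, by simp⟩

theorem IsMonomial.var (w : σ → Ω) (j : σ) : IsMonomial F w (w j) :=
  ⟨1, Finsupp.single j 1, 0, one_ne_zero, by simp [MvPolynomial.aeval_monomial]⟩

theorem IsMonomial.mul {w : σ → Ω} {x y : Ω} (hx : IsMonomial F w x) (hy : IsMonomial F w y) :
    IsMonomial F w (x * y) := by
  obtain ⟨c, a, b, hc, h⟩ := hx
  obtain ⟨c', a', b', hc', h'⟩ := hy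
  refine ⟨c * c', a + a', b + b', mul_ne_zero hc hc', ?_⟩
  rw [← MvPolynomial.monomial_mul, map_mul, ← h, ← h', ← one_mul (1 : F),
    ← MvPolynomial.monomial_mul, map_mul, one_mul]
  ring

theorem aeval_monomial_ne_zero {w : σ → Ω} (hw : ∀ j, w j ≠ 0) (a : σ →₀ ℕ) {c : F} (hc : c ≠ 0) :
    MvPolynomial.aeval w (MvPolynomial.monomial a c) ≠ 0 := by
  rw [MvPolynomial.aeval_monomial]
  refine mul_ne_zero ((_root_.map_ne_zero _).2 hc) ?_
  exact Finset.prod_ne_zero_iff.2 fun j _ => pow_ne_zero _ (hw j)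

theorem IsMonomial.inv {w : σ → Ω} (hw : ∀ j, w j ≠ 0) {x : Ω} (hx : IsMonomial F w x) :
    IsMonomial F w x⁻¹ := by
  obtain ⟨c, a, b, hc, h⟩ := hx
  have hb := aeval_monomial_ne_zero hw b (one_ne_zero (α := F))
  have ha := aeval_monomial_ne_zero hw a hc
  have hx0 : x ≠ 0 := by rintro rfl; exact ha (by rw [← h, zero_mul])
  refine ⟨c⁻¹, b, a, inv_ne_zero hc, ?_⟩
  have e1 : MvPolynomial.aeval w (MvPolynomial.monomial a (1 : F)) =
      algebraMap F Ω c⁻¹ * MvPolynomial.aeval w (MvPolynomial.monomial a c) := by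
    rw [MvPolynomial.aeval_monomial, MvPolynomial.aeval_monomial, ← mul_assoc, ← map_mul,
      inv_mul_cancel₀ hc]
  have e2 : MvPolynomial.aeval w (MvPolynomial.monomial b c⁻¹) =
      algebraMap F Ω c⁻¹ * MvPolynomial.aeval w (MvPolynomial.monomial b (1 : F)) := by
    simp [MvPolynomial.aeval_monomial]
  rw [e1, e2, ← h]
  field_simp

theorem IsMonomial.one (w : σ → Ω) : IsMonomial F w 1 := by
  simpa using IsMonomial.const (F := F) w one_ne_zero

theorem IsMonomial.pow {w : σ → Ω} {x : Ω} (hx : IsMonomial F w x) (n : ℕ) :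
    IsMonomial F w (x ^ n) := by
  induction n with
  | zero => simpa using IsMonomial.one w
  | succ n ih => rw [pow_succ]; exact ih.mul hx

theorem IsMonomial.zpow {w : σ → Ω} (hw : ∀ j, w j ≠ 0) {x : Ω} (hx : IsMonomial F w x) (n : ℤ) :
    IsMonomial F w (x ^ n) := by
  cases n with
  | ofNat n => simpa using hx.pow n
  | negSucc n => rw [zpow_negSucc]; exact (hx.pow _).inv hw

theorem IsMonomial.trans {w w' : σ → Ω} (hw : ∀ j, w j ≠ 0) (hw' : ∀ j, w' j ≠ 0)
    (h : ∀ j, IsMonomial F w' (w j)) {x : Ω} (hx : IsMonomial F w x) : IsMonomial F w' x := by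
  obtain ⟨c, a, b, hc, hx⟩ := hx
  have key : ∀ (a : σ →₀ ℕ) {c : F}, c ≠ 0 →
      IsMonomial F w' (MvPolynomial.aeval w (MvPolynomial.monomial a c)) := by
    intro a c hc
    rw [MvPolynomial.aeval_monomial]
    refine (IsMonomial.const w' hc).mul ?_
    exact Finset.prod_induction _ (IsMonomial F w') (fun _ _ => IsMonomial.mul) (IsMonomial.one w')
      fun j _ => (h j).pow _
  have hb := aeval_monomial_ne_zero hw b (one_ne_zero (α := F))
  rw [← mul_inv_cancel_right₀ hb x, hx]
  exact (key a hc).mul ((key b one_ne_zero).inv hw')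

section Coefficients
open MvPolynomial

theorem exists_X_pow_add_X_pow_pow (u u' : σ) (M N : ℕ) (hM : M ≠ 0) :
    ∃ R : MvPolynomial σ F, ((X u : MvPolynomial σ F) ^ M + X u' ^ M) ^ N =
      X u ^ (M * N) + X u' * R := by
  have h := sub_dvd_pow_sub_pow ((X u : MvPolynomial σ F) ^ M + X u' ^ M) (X u ^ M) N
  rw [add_sub_cancel_left] at h
  obtain ⟨R, hR⟩ := h
  obtain ⟨M, rfl⟩ := Nat.exists_eq_succ_of_ne_zero hM
  refine ⟨X u' ^ M * R, ?_⟩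
  rw [← mul_assoc, ← pow_succ', pow_mul, ← hR]
  ring

theorem coeff_X_pow_add_X_pow_pow {u u' : σ} (huu : u ≠ u') (M N : ℕ) (hM : M ≠ 0) :
    coeff (Finsupp.single u (M * N)) (((X u : MvPolynomial σ F) ^ M + X u' ^ M) ^ N) = 1 := by
  classical
  obtain ⟨R, hR⟩ := exists_X_pow_add_X_pow_pow (F := F) u u' M N hM
  rw [hR, coeff_add, coeff_X_pow, if_pos rfl, mul_comm (X u') R, coeff_mul_X', if_neg, add_zero]
  rw [Finsupp.mem_support_iff, not_not, Finsupp.single_eq_of_ne huu.symm]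

/-- If the sum of two monomials is `c * X ^ b * (X u ^ M + X u' ^ M) ^ N`, then the two monomials
are the two extreme terms of the expansion. -/
theorem monomial_add_monomial_eq {u u' : σ} (huu : u ≠ u') {M N : ℕ} (hM : M ≠ 0) (hN : N ≠ 0)
    {c c₁ c₂ : F} (hc : c ≠ 0) {b a₁ a₂ : σ →₀ ℕ}
    (h : monomial a₁ c₁ + monomial a₂ c₂ =
      monomial b c * ((X u : MvPolynomial σ F) ^ M + X u' ^ M) ^ N) :
    (monomial a₁ c₁ = monomial b c * (X u : MvPolynomial σ F) ^ (M * N) ∧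
      monomial a₂ c₂ = monomial b c * (X u' : MvPolynomial σ F) ^ (M * N)) ∨
    (monomial a₁ c₁ = monomial b c * (X u' : MvPolynomial σ F) ^ (M * N) ∧
      monomial a₂ c₂ = monomial b c * (X u : MvPolynomial σ F) ^ (M * N)) := by
  classical
  have hX : ∀ j : σ, monomial b c * (X j : MvPolynomial σ F) ^ (M * N) =
      monomial (b + Finsupp.single j (M * N)) c := by
    intro j
    rw [X_pow_eq_monomial, monomial_mul, mul_one]
  have h1 := congrArg (coeff (b + Finsupp.single u (M * N))) h
  have h2 := congrArg (coeff (b + Finsupp.single u' (M * N))) h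
  rw [coeff_monomial_mul, coeff_X_pow_add_X_pow_pow huu _ _ hM, mul_one, coeff_add, coeff_monomial,
    coeff_monomial] at h1
  rw [coeff_monomial_mul, add_comm ((X u : MvPolynomial σ F) ^ M),
    coeff_X_pow_add_X_pow_pow huu.symm _ _ hM, mul_one, coeff_add, coeff_monomial,
    coeff_monomial] at h2
  have hne : b + Finsupp.single u (M * N) ≠ b + Finsupp.single u' (M * N) := by
    intro he
    have := Finsupp.single_left_injective (mul_ne_zero hM hN) (add_left_cancel he)
    exact huu this
  rw [hX, hX]
  by_cases e1 : a₁ = b + Finsupp.single u (M * N)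
  · rw [if_pos e1] at h1
    rw [if_neg (e1 ▸ hne)] at h2
    have e2 : a₂ = b + Finsupp.single u' (M * N) := by
      by_contra e2
      rw [if_neg e2, add_zero] at h2
      exact hc h2.symm
    rw [if_neg (e2 ▸ hne.symm)] at h1
    rw [if_pos e2] at h2
    left
    rw [e1, e2, ← h2, zero_add]
    rw [add_zero] at h1
    exact ⟨by rw [h1, ← h2, zero_add], rfl⟩
  · rw [if_neg e1] at h1
    have e2 : a₂ = b + Finsupp.single u (M * N) := by
      by_contra e2
      rw [if_neg e2, add_zero] at h1
      exact hc h1.symm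
    rw [if_pos e2] at h1
    rw [if_neg (c := a₂ = _) (e2 ▸ hne), add_zero] at h2
    have e1 : a₁ = b + Finsupp.single u' (M * N) := by
      by_contra e1
      rw [if_neg e1] at h2
      exact hc h2.symm
    rw [if_pos e1] at h2
    right
    rw [zero_add] at h1
    exact ⟨by rw [e1, h2], by rw [e2, h1]⟩

/-- A monomial is not divisible by a positive power of `X u ^ M + X u' ^ M` with `M` odd, as
`X u ^ M + X u' ^ M` vanishes at a point with nonzero coordinates. -/
theorem monomial_ne_mul_X_pow_add_X_pow_pow {u u' : σ} (huu : u ≠ u') {M N : ℕ} (hM : Odd M)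
    (hN : N ≠ 0) {c : F} (hc : c ≠ 0) {b : σ →₀ ℕ} (f : MvPolynomial σ F) :
    f * ((X u : MvPolynomial σ F) ^ M + X u' ^ M) ^ N ≠ monomial b c := by
  classical
  intro h
  let p : σ → F := fun j => if j = u' then -1 else 1
  have h1 := congrArg (eval p) h
  rw [map_mul, map_pow, map_add, map_pow, map_pow, eval_X, eval_X, eval_monomial] at h1
  simp only [p, if_neg huu, if_true, hM.neg_one_pow, one_pow, add_neg_cancel, zero_pow hN,
    mul_zero] at h1
  refine mul_ne_zero hc (Finset.prod_ne_zero_iff.2 fun j _ => pow_ne_zero _ ?_) h1.symm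
  split_ifs
  · exact neg_ne_zero.2 one_ne_zero
  · exact one_ne_zero

/-- If a sum of two Laurent monomials is `c * (w u ^ M + w u' ^ M) ^ N`, for algebraically
independent elements `w j`, then `N > 0` and the two monomials are the two extreme terms. -/
theorem IsMonomial.add_eq {w : σ → Ω} (hw : AlgebraicIndependent F w) {u u' : σ} (huu : u ≠ u')
    {M : ℕ} (hM : Odd M) {N : ℤ} (hN : N ≠ 0) {c : F} (hc : c ≠ 0) {A₁ A₂ : Ω}
    (h₁ : IsMonomial F w A₁) (h₂ : IsMonomial F w A₂)
    (h : A₁ + A₂ = algebraMap F Ω c * (w u ^ M + w u' ^ M) ^ N) :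
    (A₁ = algebraMap F Ω c * (w u ^ M) ^ N ∧ A₂ = algebraMap F Ω c * (w u' ^ M) ^ N) ∨
    (A₁ = algebraMap F Ω c * (w u' ^ M) ^ N ∧ A₂ = algebraMap F Ω c * (w u ^ M) ^ N) := by
  obtain ⟨c₁, a₁, b₁, hc₁, e₁⟩ := h₁
  obtain ⟨c₂, a₂, b₂, hc₂, e₂⟩ := h₂
  have hw0 : ∀ j, w j ≠ 0 := fun j => hw.ne_zero j
  have hm : ∀ (a : σ →₀ ℕ) {c : F}, c ≠ 0 → aeval w (monomial a c) ≠ 0 := fun a c hc =>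
    aeval_monomial_ne_zero hw0 a hc
  have hsplit : ∀ (b : σ →₀ ℕ) (c : F), aeval w (monomial b c) =
      algebraMap F Ω c * aeval w (monomial b (1 : F)) := by
    intro b c
    simp [aeval_monomial]
  have e : aeval w (monomial (a₁ + b₂) c₁ + monomial (a₂ + b₁) c₂) =
      (A₁ + A₂) * aeval w (monomial (b₁ + b₂) (1 : F)) := by
    have f1 : (monomial (a₁ + b₂) c₁ : MvPolynomial σ F) = monomial a₁ c₁ * monomial b₂ 1 := by
      rw [monomial_mul, mul_one]
    have f2 : (monomial (a₂ + b₁) c₂ : MvPolynomial σ F) = monomial a₂ c₂ * monomial b₁ 1 := by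
      rw [monomial_mul, mul_one]
    have f3 : (monomial (b₁ + b₂) 1 : MvPolynomial σ F) = monomial b₁ 1 * monomial b₂ 1 := by
      rw [monomial_mul, mul_one]
    rw [f1, f2, f3, map_add, map_mul, map_mul, map_mul, ← e₁, ← e₂]
    ring
  rw [h] at e
  -- clearing the denominators of the two monomials yields an identity of polynomials
  obtain ⟨n, rfl | rfl⟩ := N.eq_nat_or_neg
  · have hn : n ≠ 0 := by rintro rfl; exact hN rfl
    have e' : (monomial (a₁ + b₂) c₁ + monomial (a₂ + b₁) c₂ : MvPolynomial σ F) =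
        monomial (b₁ + b₂) c * (X u ^ M + X u' ^ M) ^ n := by
      refine hw ?_
      rw [e, map_mul, map_pow, map_add, map_pow, map_pow, aeval_X, aeval_X, zpow_natCast,
        hsplit _ c]
      ring
    have hM0 : M ≠ 0 := by rintro rfl; simp at hM
    have fin : ∀ {x : σ} {A : Ω} {a a' b : σ →₀ ℕ} {d : F} {b' : σ →₀ ℕ}, b + b' = b₁ + b₂ →
        A * aeval w (monomial b (1 : F)) = aeval w (monomial a d) →
        (monomial (a + b') d : MvPolynomial σ F) = monomial (b₁ + b₂) c * X x ^ (M * n) →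
        A = algebraMap F Ω c * (w x ^ M) ^ (n : ℤ) := by
      intro x A a a' b d b' hb hA hmon
      have := congrArg (aeval w) hmon
      have f1 : (monomial (a + b') d : MvPolynomial σ F) = monomial a d * monomial b' 1 := by
        rw [monomial_mul, mul_one]
      have f2 : (monomial (b + b') 1 : MvPolynomial σ F) = monomial b 1 * monomial b' 1 := by
        rw [monomial_mul, mul_one]
      rw [f1, map_mul, ← hA, map_mul, map_pow, aeval_X, hsplit _ c, ← hb, f2, map_mul, pow_mul] at this
      refine mul_right_cancel₀ (mul_ne_zero (hm b one_ne_zero) (hm b' (one_ne_zero (α := F)))) ?_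
      rw [zpow_natCast]
      linear_combination this
    rcases monomial_add_monomial_eq huu hM0 hn hc e' with ⟨g1, g2⟩ | ⟨g1, g2⟩
    · exact Or.inl ⟨fin (a' := 0) rfl e₁ g1, fin (a' := 0) (add_comm _ _) e₂ g2⟩
    · exact Or.inr ⟨fin (a' := 0) rfl e₁ g1, fin (a' := 0) (add_comm _ _) e₂ g2⟩
  -- a negative exponent would make a monomial divisible by `X u ^ M + X u' ^ M`
  · exfalso
    have hn : n ≠ 0 := by rintro rfl; exact hN (by simp)
    have hM0 : M ≠ 0 := by rintro rfl; simp at hM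
    have hne : w u ^ M + w u' ^ M ≠ 0 := by
      intro h0
      have h0' : (X u ^ M + X u' ^ M : MvPolynomial σ F) = 0 := by
        refine hw ?_
        rw [map_add, map_pow, map_pow, aeval_X, aeval_X, h0, map_zero]
      have := coeff_X_pow_add_X_pow_pow (F := F) huu M 1 hM0
      rw [h0', pow_one, coeff_zero] at this
      exact zero_ne_one this
    refine monomial_ne_mul_X_pow_add_X_pow_pow huu hM hn hc (b := b₁ + b₂)
      (monomial (a₁ + b₂) c₁ + monomial (a₂ + b₁) c₂) (hw ?_)
    rw [map_mul, e, map_pow, map_add, map_pow, map_pow, aeval_X, aeval_X, zpow_neg, zpow_natCast,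
      hsplit _ c]
    field_simp

end Coefficients
end Monomial

section
open Polynomial IntermediateField

/-! ### Step fields inside a larger extension -/

section StepField
variable {F Ω : Type*} [Field F] [Field Ω] [Algebra F Ω]

theorem le_stepField (K : IntermediateField F Ω) (s : ℕ → Ω) {ι : Type*} (r : ι → Ω) :
    K ≤ (stepField K s r).restrictScalars F := fun x hx =>
  _root_.algebraMap_mem (stepField K s r) (⟨x, hx⟩ : K)

theorem stepField_le {K L : IntermediateField F Ω} {s : ℕ → Ω} {ι : Type*} {r : ι → Ω}
    (hK : K ≤ L) (hs : ∀ l, s l ∈ L) (hr : ∀ i, r i ∈ L) :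
    (stepField K s r).restrictScalars F ≤ L := by
  rw [stepField, restrictScalars_adjoin]
  refine adjoin_le_iff.2 ?_
  rintro x (hx | ⟨l, rfl⟩ | ⟨i, rfl⟩)
  · exact hK hx
  · exact hs l
  · exact hr i

theorem s_mem_restrictScalars_stepField (K : IntermediateField F Ω) (s : ℕ → Ω) {ι : Type*}
    (r : ι → Ω) (l : ℕ) : s l ∈ (stepField K s r).restrictScalars F :=
  s_mem_stepField s r l

theorem r_mem_restrictScalars_stepField (K : IntermediateField F Ω) (s : ℕ → Ω) {ι : Type*}
    (r : ι → Ω) (i : ι) : r i ∈ (stepField K s r).restrictScalars F :=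
  r_mem_stepField s r i

theorem IsRadicalStep.of_isEmpty {k : Type*} [Field k] [Algebra k Ω] {q : ℕ} {s : ℕ → Ω}
    {ι : Type*} [IsEmpty ι] (a ε : ι → k) (r : ι → Ω) (hq : q.Prime) (h2 : (2 : k) ≠ 0)
    (hq0 : (q : k) ≠ 0) (hroot : ∀ l, s (l + 1) ^ q = s l) (htr : Transcendental k (s 0)) :
    IsRadicalStep q s a ε r :=
  ⟨hq, h2, hq0, hroot, htr, fun i => isEmptyElim i, isEmptyElim, isEmptyElim, isEmptyElim⟩

end StepField

namespace FriedKollar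

/-! ### High elements of `K_T` -/

section High
variable {F : Type*} [Field F] {q : ℕ → ℕ}

theorem isHighIn_bot_iff {Ω : Type*} [Field Ω] [Algebra F Ω] {K : IntermediateField F Ω} {q : ℕ}
    {x : Ω} : IsHighIn (⊥ : IntermediateField K Ω) q x ↔ IsHighIn K q x := by
  simp only [IsHighIn, mem_bot_coe_iff]

theorem rootSeq_ne_zero {q : ℕ} (hq : 0 < q) (i : ℕ ⊕ ℕ) (l : ℕ) : rootSeq q (gen F i) l ≠ 0 := by
  intro h
  have h1 := rootSeq_pow hq (gen F i) l
  rw [h, zero_pow (pow_pos hq l).ne'] at h1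
  exact (algebraicIndependent_gen F).ne_zero i h1.symm

theorem algebraicIndependent_rootSeq_v {q : ℕ} (hq : 0 < q) (l : ℕ) :
    AlgebraicIndependent F fun j => rootSeq q (v F j) l := by
  refine algebraicIndependent_of_finite_type' (algebraMap F (Ambient F)).injective
    fun S _ _ i hi => ?_
  rw [← transcendental_adjoin_iff]
  intro ha
  have hle : adjoin F ((fun j => rootSeq q (v F j) l) '' S) ≤ closureGen F (Sum.inl '' S) := by
    refine adjoin_le_iff.2 ?_
    rintro _ ⟨j, hj, rfl⟩
    exact rootSeq_mem_closureGen (Set.mem_image_of_mem _ hj) hq l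
  have h1 := (isAlgebraic_of_le hle ha).pow (q ^ l)
  rw [rootSeq_pow hq] at h1
  exact transcendental_gen (i := Sum.inl i) le_rfl (by simpa using hi) h1

theorem isMonomial_rootSeq_of_le {q : ℕ} (hq : 0 < q) {l m : ℕ} (hlm : l ≤ m) {x : Ambient F}
    (hx : IsMonomial F (fun j => rootSeq q (v F j) l) x) :
    IsMonomial F (fun j => rootSeq q (v F j) m) x := by
  refine hx.trans (fun j => rootSeq_ne_zero hq _ _) (fun j => rootSeq_ne_zero hq _ _) fun j => ?_
  obtain ⟨d, rfl⟩ := Nat.exists_eq_add_of_le hlm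
  have h := pow_pow_eq_of_root (rootSeq_succ_pow hq (v F j)) l d
  change IsMonomial F _ (rootSeq q (v F j) l)
  rw [← h]
  exact (IsMonomial.var (fun j => rootSeq q (v F j) (l + d)) j).pow _

variable (F q) in
/-- The field generated over `F` by the iterated `q 0`-th roots of `v_0, …, v_{i-1}`. -/
noncomputable def vTower (i : ℕ) : IntermediateField F (Ambient F) :=
  adjoin F {x | ∃ j l, j < i ∧ x = rootSeq (q 0) (v F j) l}

theorem rootSeq_mem_vTower {i j : ℕ} (h : j < i) (l : ℕ) :
    rootSeq (q 0) (v F j) l ∈ vTower F q i :=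
  subset_adjoin F {x | ∃ j l, j < i ∧ x = rootSeq (q 0) (v F j) l} ⟨j, l, h, rfl⟩

theorem vTower_monotone : Monotone (vTower F q) := fun i i' h => by
  refine adjoin_le_iff.2 ?_
  rintro _ ⟨j, l, hj, rfl⟩
  exact rootSeq_mem_vTower (hj.trans_le h) l

theorem iSup_vTower (T : CombTree) : ⨆ i, vTower F q i = KStage F q T 0 := by
  apply le_antisymm
  · refine iSup_le fun i => adjoin_le_iff.2 ?_
    rintro _ ⟨j, l, -, rfl⟩
    exact rootSeq_v_mem_KStage_zero T j l
  · refine adjoin_le_iff.2 ?_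
    rintro _ ⟨j, l, rfl⟩
    exact le_iSup (vTower F q) (j + 1) (rootSeq_mem_vTower j.lt_succ_self l)

theorem vTower_succ_eq (i : ℕ) :
    vTower F q (i + 1) = (stepField (vTower F q i) (rootSeq (q 0) (v F i))
      (Empty.elim : Empty → Ambient F)).restrictScalars F := by
  apply le_antisymm
  · refine adjoin_le_iff.2 ?_
    rintro _ ⟨j, l, hj, rfl⟩
    rcases Nat.lt_succ_iff_lt_or_eq.1 hj with hj | rfl
    · exact le_stepField _ _ _ (rootSeq_mem_vTower hj l)
    · exact s_mem_restrictScalars_stepField _ _ _ l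
  · exact stepField_le (vTower_monotone i.le_succ)
      (fun l => rootSeq_mem_vTower i.lt_succ_self l) fun a => a.elim

theorem isRadicalStep_vTower (hq : Admissible F q) (i : ℕ) :
    IsRadicalStep (k := vTower F q i) (q 0) (rootSeq (q 0) (v F i))
      (Empty.elim : Empty → vTower F q i) Empty.elim (Empty.elim : Empty → Ambient F) := by
  have htr : Transcendental (vTower F q i) (v F i) := by
    refine transcendental_gen (S := Sum.inl '' Set.Iio i) (i := Sum.inl i) ?_ (by simp)
    refine adjoin_le_iff.2 ?_
    rintro _ ⟨j, l, hj, rfl⟩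
    have hj' : (Sum.inl j : ℕ ⊕ ℕ) ∈ Sum.inl '' Set.Iio i := ⟨j, hj, rfl⟩
    exact rootSeq_mem_closureGen hj' (hq.pos 0) l
  exact IsRadicalStep.of_isEmpty _ _ _ (hq.prime _)
    (coe_natCast_ne_zero (n := 2) (by exact_mod_cast hq.two_ne) _)
    (coe_natCast_ne_zero (hq.cast_ne _) _) (rootSeq_succ_pow (hq.pos _) _) htr

/-- By induction along the tower, each step of which contributes a power of a root of one `v_i`. -/
theorem IsHighIn.exists_isMonomial_of_vTower (hq : Admissible F q) (i : ℕ) {x : Ambient F}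
    (hx : IsHighIn (vTower F q i) (q 0) x) :
    ∃ l, IsMonomial F (fun j => rootSeq (q 0) (v F j) l) x := by
  induction i generalizing x with
  | zero =>
    have h0 : vTower F q 0 = ⊥ := by simp [vTower]
    have hm := hx.mem
    rw [h0] at hm
    obtain ⟨c, rfl⟩ := mem_bot.1 hm
    exact ⟨0, IsMonomial.const _ ((_root_.map_ne_zero _).1 hx.1)⟩
  | succ i ih =>
    rw [vTower_succ_eq] at hx
    obtain ⟨l, m, c, hc, rfl⟩ := (isRadicalStep_vTower hq i).exists_eq_mul_zpow_of_isHighIn hx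
    obtain ⟨l', hl'⟩ := ih (isHighIn_bot_iff.1 hc)
    have hv : IsMonomial F (fun j => rootSeq (q 0) (v F j) l) (rootSeq (q 0) (v F i) l) :=
      IsMonomial.var (fun j => rootSeq (q 0) (v F j) l) i
    refine ⟨max l l', (isMonomial_rootSeq_of_le (hq.pos 0) (le_max_right _ _) hl').mul ?_⟩
    exact (isMonomial_rootSeq_of_le (hq.pos 0) (le_max_left _ _) hv).zpow
      (fun j => rootSeq_ne_zero (hq.pos 0) _ _) m

/-- The `q 0`-high elements of `K_T` are Laurent monomials in iterated `q 0`-th roots of the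
elements `v_i`. -/
theorem IsHighIn.exists_isMonomial (hq : Admissible F q) (T : CombTree) {x : Ambient F}
    (hx : IsHighIn (KTree F q T) (q 0) x) :
    ∃ l, IsMonomial F (fun j => rootSeq (q 0) (v F j) l) x := by
  have h := IsHighIn.KStage_of_KTree hq T 0 hx
  rw [← iSup_vTower] at h
  obtain ⟨i, hi⟩ := h.exists_of_iSup vTower_monotone
    (fun i => (isRadicalStep_vTower hq i).isClosedIn (vTower_succ_eq i)) (hq.pos 0)
  exact IsHighIn.exists_isMonomial_of_vTower hq i hi

variable (F q) in
/-- The field generated over `F` by the iterated `q 1`-th roots of `t_0`, the iterated `q 0`-th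
roots of `v_0, …, v_{i-1}`, and the square roots of the elements `t_0 - (v_j + v_k)` for the edges
`(v_j, v_k)` of `T` with `j, k < i`. -/
noncomputable def tTower (T : CombTree) (i : ℕ) : IntermediateField F (Ambient F) :=
  adjoin F ({x | ∃ l, x = rootSeq (q 1) (t F 0) l} ∪
    {x | ∃ j l, j < i ∧ x = rootSeq (q 0) (v F j) l} ∪
    {x | ∃ j k, j < i ∧ k < i ∧ T.1.Adj j k ∧ x = root 2 (t F 0 - (v F j + v F k))})

section
variable {T : CombTree}

theorem rootSeq_t_mem_tTower (i l : ℕ) : rootSeq (q 1) (t F 0) l ∈ tTower F q T i := by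
  have h : rootSeq (q 1) (t F 0) l ∈ {x | ∃ l, x = rootSeq (q 1) (t F 0) l} ∪
    {x | ∃ j l, j < i ∧ x = rootSeq (q 0) (v F j) l} ∪
    {x | ∃ j k, j < i ∧ k < i ∧ T.1.Adj j k ∧ x = root 2 (t F 0 - (v F j + v F k))} :=
    Or.inl (Or.inl ⟨l, rfl⟩)
  exact subset_adjoin F _ h

theorem rootSeq_v_mem_tTower {i j : ℕ} (hj : j < i) (l : ℕ) :
    rootSeq (q 0) (v F j) l ∈ tTower F q T i := by
  have h : rootSeq (q 0) (v F j) l ∈ {x | ∃ l, x = rootSeq (q 1) (t F 0) l} ∪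
    {x | ∃ j l, j < i ∧ x = rootSeq (q 0) (v F j) l} ∪
    {x | ∃ j k, j < i ∧ k < i ∧ T.1.Adj j k ∧ x = root 2 (t F 0 - (v F j + v F k))} :=
    Or.inl (Or.inr ⟨j, l, hj, rfl⟩)
  exact subset_adjoin F _ h

theorem root_mem_tTower {i j k : ℕ} (hj : j < i) (hk : k < i) (hjk : T.1.Adj j k) :
    root 2 (t F 0 - (v F j + v F k)) ∈ tTower F q T i := by
  have h : root 2 (t F 0 - (v F j + v F k)) ∈ {x | ∃ l, x = rootSeq (q 1) (t F 0) l} ∪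
    {x | ∃ j l, j < i ∧ x = rootSeq (q 0) (v F j) l} ∪
    {x | ∃ j k, j < i ∧ k < i ∧ T.1.Adj j k ∧ x = root 2 (t F 0 - (v F j + v F k))} :=
    Or.inr ⟨j, k, hj, hk, hjk, rfl⟩
  exact subset_adjoin F _ h

theorem tTower_le {i : ℕ} {K : IntermediateField F (Ambient F)}
    (h1 : ∀ l, rootSeq (q 1) (t F 0) l ∈ K) (h2 : ∀ j l, j < i → rootSeq (q 0) (v F j) l ∈ K)
    (h3 : ∀ j k, j < i → k < i → T.1.Adj j k → root 2 (t F 0 - (v F j + v F k)) ∈ K) :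
    tTower F q T i ≤ K := by
  refine adjoin_le_iff.2 ?_
  rintro _ ((⟨l, rfl⟩ | ⟨j, l, hj, rfl⟩) | ⟨j, k, hj, hk, hjk, rfl⟩)
  · exact h1 l
  · exact h2 j l hj
  · exact h3 j k hj hk hjk

theorem tTower_monotone : Monotone (tTower F q T) := fun _ _ h =>
  tTower_le (fun l => rootSeq_t_mem_tTower _ l)
    (fun _ l hj => rootSeq_v_mem_tTower (hj.trans_le h) l)
    fun _ _ hj hk hjk => root_mem_tTower (hj.trans_le h) (hk.trans_le h) hjk

/-- In `tTower`, the element `t_0` is adjoined before the elements `v_i`, but the union is `K_1(T)`.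
-/
theorem iSup_tTower : ⨆ i, tTower F q T i = KStage F q T 1 := by
  apply le_antisymm
  · refine iSup_le fun i => ?_
    rw [KStage_succ_eq]
    refine tTower_le (fun l => s_mem_restrictScalars_stepField _ _ _ l)
      (fun j l _ => le_stepField _ _ _ (rootSeq_v_mem_KStage_zero T j l)) fun j k _ _ hjk => ?_
    exact r_mem_restrictScalars_stepField (KStage F q T 0) _
      (fun a : H F T 0 => root 2 (t F 0 - a)) ⟨v F j + v F k, j, k, hjk, rfl⟩
  · rw [KStage_succ_eq]
    refine stepField_le (adjoin_le_iff.2 ?_) (fun l => ?_) ?_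
    · rintro _ ⟨j, l, rfl⟩
      exact le_iSup (tTower F q T) (j + 1) (rootSeq_v_mem_tTower j.lt_succ_self l)
    · exact le_iSup (tTower F q T) 0 (rootSeq_t_mem_tTower 0 l)
    · rintro ⟨_, j, k, hjk, rfl⟩
      exact le_iSup (tTower F q T) (j + k + 1) (root_mem_tTower (by omega) (by omega) hjk)

theorem v_mem_tTower {i j : ℕ} (hj : j < i) : v F j ∈ tTower F q T i :=
  rootSeq_v_mem_tTower hj 0

theorem t_mem_tTower (i : ℕ) : t F 0 ∈ tTower F q T i := rootSeq_t_mem_tTower i 0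

theorem tTower_le_closureGen (hq : Admissible F q) (i : ℕ) :
    tTower F q T i ≤ closureGen F (insert (Sum.inr 0) (Sum.inl '' Set.Iio i)) := by
  have hv : ∀ j < i, (Sum.inl j : ℕ ⊕ ℕ) ∈ insert (Sum.inr 0) (Sum.inl '' Set.Iio i) :=
    fun j hj => Or.inr ⟨j, hj, rfl⟩
  have ht : (Sum.inr 0 : ℕ ⊕ ℕ) ∈ insert (Sum.inr 0) (Sum.inl '' Set.Iio i : Set (ℕ ⊕ ℕ)) :=
    Or.inl rfl
  refine tTower_le (fun l => rootSeq_mem_closureGen ht (hq.pos 1) l)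
    (fun j l hj => rootSeq_mem_closureGen (hv j hj) (hq.pos 0) l) fun j k hj hk _ => ?_
  refine mem_algClosureOver_of_pow_mem two_pos ?_
  rw [root_sq]
  exact sub_mem (gen_mem_closureGen ht)
    (add_mem (gen_mem_closureGen (hv j hj)) (gen_mem_closureGen (hv k hk)))

variable (T) in
/-- The neighbours `j < i` of the vertex `i`. -/
abbrev LowerNbr (i : ℕ) : Type := {j : ℕ // j < i ∧ T.1.Adj i j}

theorem tTower_succ_eq (i : ℕ) :
    tTower F q T (i + 1) = (stepField (tTower F q T i) (rootSeq (q 0) (v F i))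
      (fun j : LowerNbr T i => root 2 (t F 0 - (v F i + v F j)))).restrictScalars F := by
  set r := fun j : LowerNbr T i => root 2 (t F 0 - (v F i + v F j)) with hr
  have hbase := le_stepField (tTower F q T i) (rootSeq (q 0) (v F i)) r
  apply le_antisymm
  · refine tTower_le (fun l => hbase (rootSeq_t_mem_tTower i l)) (fun j l hj => ?_)
      fun j k hj hk hjk => ?_
    · rcases Nat.lt_succ_iff_lt_or_eq.1 hj with hj | rfl
      · exact hbase (rootSeq_v_mem_tTower hj l)
      · exact s_mem_restrictScalars_stepField _ _ _ l
    · rcases Nat.lt_succ_iff_lt_or_eq.1 hj with hj | rfl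
      · rcases Nat.lt_succ_iff_lt_or_eq.1 hk with hk | rfl
        · exact hbase (root_mem_tTower hj hk hjk)
        · rw [add_comm (v F j)]
          exact r_mem_restrictScalars_stepField (tTower F q T k) _ r ⟨j, hj, hjk.symm⟩
      · rcases Nat.lt_succ_iff_lt_or_eq.1 hk with hk | rfl
        · exact r_mem_restrictScalars_stepField (tTower F q T j) _ r ⟨k, hk, hjk⟩
        · exact absurd hjk (T.1.loopless.irrefl _)
  · exact stepField_le (tTower_monotone i.le_succ) (fun l => rootSeq_v_mem_tTower i.lt_succ_self l)
      fun a => root_mem_tTower i.lt_succ_self (a.2.1.trans i.lt_succ_self) a.2.2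

/-- The field `K_1(T)` is also the union of a tower of radical steps for `q 0`, the first of which
has the field generated by the roots of `t_0` as its base. The square root of `t_0 - (v_i + v_j)`
is now regarded as a square root of `-(v_i - (t_0 - v_j))`. -/
theorem isRadicalStep_tTower (hq : Admissible F q) (i : ℕ) :
    IsRadicalStep (k := tTower F q T i) (q 0) (rootSeq (q 0) (v F i))
      (fun j : LowerNbr T i => ⟨t F 0 - v F j, sub_mem (t_mem_tTower i) (v_mem_tTower j.2.1)⟩)
      (fun _ => -1) (fun j : LowerNbr T i => root 2 (t F 0 - (v F i + v F j))) where
  prime := hq.prime _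
  two_ne := coe_natCast_ne_zero (n := 2) (by exact_mod_cast hq.two_ne) _
  q_ne := coe_natCast_ne_zero (hq.cast_ne _) _
  root := rootSeq_succ_pow (hq.pos _) _
  trans := transcendental_gen (i := Sum.inl i) (tTower_le_closureGen hq i) (by simp)
  inj := fun j k h => Subtype.ext (Sum.inl_injective
    (gen_injective (F := F) (sub_right_injective (Subtype.mk.inj h))))
  a_ne := fun j h => by
    have h1 := Subtype.mk.inj h
    exact Sum.inr_ne_inl (gen_injective (F := F) (sub_eq_zero.1 h1))
  ε_ne := fun _ => neg_ne_zero.2 one_ne_zero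
  sq := fun j => by
    rw [root_sq, map_neg, map_one]
    change _ = -1 * (v F i - (t F 0 - v F j))
    ring

theorem isRadicalStep_t_zero (hq : Admissible F q) :
    IsRadicalStep (k := F) (q 1) (rootSeq (q 1) (t F 0))
      (Empty.elim : Empty → F) Empty.elim (Empty.elim : Empty → Ambient F) :=
  IsRadicalStep.of_isEmpty _ _ _ (hq.prime _) hq.two_ne (hq.cast_ne _)
    (rootSeq_succ_pow (hq.pos _) _) (transcendental_gen_base (Sum.inr 0))

theorem tTower_zero : tTower F q T 0 = stepField F (rootSeq (q 1) (t F 0))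
    (Empty.elim : Empty → Ambient F) := by
  apply le_antisymm
  · exact tTower_le (fun l => s_mem_stepField _ _ l) (fun _ _ hj => absurd hj (Nat.not_lt_zero _))
      fun _ _ hj => absurd hj (Nat.not_lt_zero _)
  · refine adjoin_le_iff.2 ?_
    rintro _ (⟨l, rfl⟩ | ⟨a, rfl⟩)
    · exact rootSeq_t_mem_tTower 0 l
    · exact a.elim

/-- The `q 1`-high elements of `K_T` are, up to a factor in `F`, powers of iterated `q 1`-th roots
of `t_0`. -/
theorem IsHighIn.exists_eq_mul_zpow (hq : Admissible F q) {x : Ambient F}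
    (hx : IsHighIn (KTree F q T) (q 1) x) :
    ∃ (l : ℕ) (m : ℤ) (c : F), IsHigh (q 1) c ∧
      x = algebraMap F (Ambient F) c * rootSeq (q 1) (t F 0) l ^ m := by
  have h := IsHighIn.KStage_of_KTree hq T 1 hx
  rw [← iSup_tTower] at h
  have h0 := h.of_iSup tTower_monotone
    (fun i => (isRadicalStep_tTower hq i).isClosedIn (tTower_succ_eq i)) (hq.pos 1)
    fun i x hx => (isRadicalStep_tTower hq i).mem_of_isHighIn (tTower_succ_eq i) (hq.prime 1)
      (fun h => absurd (hq.inj h) one_ne_zero) (hq.ne_two 1) hx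
  rw [tTower_zero] at h0
  obtain ⟨l, m, c, hc, rfl⟩ := (isRadicalStep_t_zero hq).exists_eq_mul_zpow_of_isHighIn h0
  refine ⟨l, m, c, ⟨(_root_.map_ne_zero _).1 hc.1, fun n => ?_⟩, rfl⟩
  obtain ⟨y, hy, hyc⟩ := hc.2 n
  obtain ⟨d, rfl⟩ := mem_bot.1 hy
  exact ⟨d, (algebraMap F (Ambient F)).injective (by rw [map_pow, hyc])⟩

end
end High
end FriedKollar

/-! ### Injective homomorphisms of trees -/

/-- An injective homomorphism from a connected graph to an acyclic graph is an embedding: the path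
between two vertices with adjacent images has to be mapped to the edge. -/
theorem SimpleGraph.Hom.adj_of_adj {V W : Type*} {G : SimpleGraph V} {G' : SimpleGraph W}
    (hG : G.Connected) (hG' : G'.IsAcyclic) (f : G →g G') (hf : Function.Injective f) {x y : V}
    (h : G'.Adj (f x) (f y)) : G.Adj x y := by
  obtain ⟨p, hp⟩ := hG.exists_isPath x y
  have h1 := (hG'.subsingleton_path (f x) (f y)).elim ⟨p.map f, hp.map hf⟩
    (SimpleGraph.Path.singleton h)
  have h2 := congrArg (fun p : G'.Path (f x) (f y) => p.1.length) h1
  have h2 : p.length = 1 := (p.length_map f).symm.trans h2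
  exact SimpleGraph.Walk.adj_of_length_eq_one h2

/-! ### Homomorphisms and elements algebraic over the prime field -/

theorem RingHom.apply_algebraMap_of_mem_bot {F K L : Type*} [Field F] [Field K] [Field L]
    [Algebra F K] [Algebra F L] (φ : K →+* L) {x : F} (hx : x ∈ (⊥ : Subfield F)) :
    φ (algebraMap F K x) = algebraMap F L x :=
  (bot_le : ⊥ ≤ RingHom.eqLocusField (φ.comp (algebraMap F K)) (algebraMap F L)) hx

/-- If a homomorphism maps `x` to an element of `F` that is algebraic over the prime field, then
`x` is algebraic over `F`. -/
theorem IsAlgebraic.of_ringHom_eq_algebraMap {F K L : Type*} [Field F] [Field K] [Field L]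
    [Algebra F K] [Algebra F L] (φ : K →+* L) {x : K} {c : F} (hc : IsAlgebraic (⊥ : Subfield F) c)
    (h : φ x = algebraMap F L c) : IsAlgebraic F x := by
  obtain ⟨f, hf, hfc⟩ := hc
  let ι : (⊥ : Subfield F) →+* F := (⊥ : Subfield F).subtype
  refine ⟨f.map ι, (Polynomial.map_ne_zero_iff ι.injective).2 hf, φ.injective ?_⟩
  have e : φ.comp ((algebraMap F K).comp ι) = (algebraMap F L).comp ι :=
    RingHom.ext fun z =>
    RingHom.apply_algebraMap_of_mem_bot (F := F) φ z.2
  rw [aeval_def, eval₂_map, hom_eval₂, e, h, map_zero, ← hom_eval₂]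
  have h0 : eval₂ ι c f = 0 := hfc
  rw [h0, map_zero]

section Coe
variable {F Ω : Type*} [Field F] [Field Ω] [Algebra F Ω] {K L : IntermediateField F Ω}

theorem coe_ringHom_sq_eq (φ : K →+* L) {x y a b : Ω} (hx : x ∈ K) (hy : y ∈ K) (ha : a ∈ K)
    (hb : b ∈ K) (h : y ^ 2 = x - (a + b)) :
    (φ ⟨y, hy⟩ : Ω) ^ 2 = (φ ⟨x, hx⟩ : Ω) - ((φ ⟨a, ha⟩ : Ω) + φ ⟨b, hb⟩) := by
  have h1 : (⟨y, hy⟩ : K) ^ 2 = ⟨x, hx⟩ - (⟨a, ha⟩ + ⟨b, hb⟩) := Subtype.ext h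
  have h2 := congrArg (algebraMap L Ω) (congrArg φ h1)
  rwa [map_pow, map_pow, map_sub, map_sub, map_add, map_add] at h2

theorem coe_ringHom_add_ne_zero (φ : K →+* L) {a b : Ω} (ha : a ∈ K) (hb : b ∈ K)
    (h : a + b ≠ 0) : (φ ⟨a, ha⟩ : Ω) + φ ⟨b, hb⟩ ≠ 0 := by
  intro h0
  have h1 : φ (⟨a, ha⟩ + ⟨b, hb⟩) = 0 := by
    rw [map_add]
    exact Subtype.ext h0
  rw [map_eq_zero] at h1
  exact h (congrArg Subtype.val h1)

theorem IsRadicalStep.exists_of_mul_zpow_sub_eq_sq_of_mem {q : ℕ} {s : ℕ → Ω} {ι : Type*}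
    {a ε : ι → K} {r : ι → Ω} (h : IsRadicalStep q s a ε r) {c : F} (hc : c ≠ 0) {A : Ω}
    (hA : A ∈ K) (hA0 : A ≠ 0) {l : ℕ} {m : ℤ} (hm : m ≠ 0) {z : Ω}
    (hz : z ∈ (stepField K s r).restrictScalars F)
    (hz2 : z ^ 2 = algebraMap F Ω c * s l ^ m - A) :
    ∃ (i : ι) (N : ℤ), m = (q ^ l : ℕ) * N ∧ A = algebraMap F Ω c * (a i : Ω) ^ N := by
  obtain ⟨i, N, h1, h2⟩ := h.exists_of_mul_zpow_sub_eq_sq (c := algebraMap F K c) (A := ⟨A, hA⟩)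
    ((_root_.map_ne_zero _).2 hc) (fun h => hA0 (congrArg Subtype.val h)) hm hz hz2
  refine ⟨i, N, h1, ?_⟩
  have h3 := congrArg (algebraMap K Ω) h2
  rwa [map_mul, map_zpow₀, ← IsScalarTower.algebraMap_apply] at h3

end Coe

namespace FriedKollar

/-! ### From homomorphisms of fields to embeddings of trees -/

section Reverse
variable {F : Type*} [Field F] {q : ℕ → ℕ} {S T : CombTree}

theorem KStage_le_KTree (T : CombTree) (n : ℕ) : KStage F q T n ≤ KTree F q T :=
  le_iSup (KStage F q T) n

/-- Homomorphisms map high elements to high elements. -/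
theorem isHighIn_map {K L : IntermediateField F (Ambient F)} (φ : K →+* L) {q : ℕ} {x : K}
    (hx : IsHighIn K q (x : Ambient F)) : IsHighIn L q (φ x : Ambient F) := by
  refine ⟨?_, fun n => ?_⟩
  · have h0 : x ≠ 0 := fun h => hx.1 (by rw [h]; rfl)
    exact fun h => (_root_.map_ne_zero φ).2 h0 (Subtype.ext h)
  · obtain ⟨y, hy, hyx⟩ := hx.2 n
    refine ⟨φ ⟨y, hy⟩, (φ ⟨y, hy⟩).2, ?_⟩
    have h : (⟨y, hy⟩ : K) ^ q ^ n = x := Subtype.ext hyx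
    rw [← h, map_pow]
    rfl

theorem isHighIn_rootSeq {q : ℕ} (hq : 0 < q) (i : ℕ ⊕ ℕ) {K : IntermediateField F (Ambient F)}
    (h : ∀ l, rootSeq q (gen F i) l ∈ K) : IsHighIn K q (gen F i) :=
  ⟨(algebraicIndependent_gen F).ne_zero i, fun n => ⟨_, h n, rootSeq_pow hq _ n⟩⟩

theorem v_zpow_injective {N : ℤ} (hN : N ≠ 0) {i j : ℕ} (h : v F i ^ N = v F j ^ N) : i = j := by
  by_contra hij
  have h1 := transcendental_gen (F := F) (S := {Sum.inl j}) (i := Sum.inl i)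
    (le_algClosureOver _) (by simpa using hij)
  have hj : v F j ∈ adjoin F (gen F '' {Sum.inl j}) := subset_adjoin _ _ ⟨Sum.inl j, rfl, rfl⟩
  have h2 : ∀ n : ℕ, n ≠ 0 → v F i ^ n = v F j ^ n → False := by
    intro n hn h
    refine h1 (IsAlgebraic.of_pow (Nat.pos_of_ne_zero hn) (n := n) ?_)
    rw [← v_eq_gen, h]
    exact isAlgebraic_algebraMap (⟨v F j ^ n, pow_mem hj n⟩ : adjoin F (gen F '' {Sum.inl j}))
  obtain ⟨n, rfl | rfl⟩ := N.eq_nat_or_neg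
  · exact h2 n (by rintro rfl; exact hN rfl) (by simpa using h)
  · exact h2 n (by rintro rfl; exact hN (by simp)) (by simpa using h)

theorem rootSeq_t_mem_KStage (T : CombTree) (n l : ℕ) :
    rootSeq (q (n + 1)) (t F n) l ∈ KStage F q T (n + 1) := by
  rw [KStage_succ_eq]
  exact s_mem_restrictScalars_stepField _ _ _ l

theorem root_mem_KStage (T : CombTree) {n : ℕ} {a : Ambient F} (ha : a ∈ H F T n) :
    root 2 (t F n - a) ∈ KStage F q T (n + 1) := by
  rw [KStage_succ_eq]
  exact r_mem_restrictScalars_stepField (KStage F q T n) _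
    (fun a : H F T n => root 2 (t F n - (a : Ambient F))) ⟨a, ha⟩

/-- A homomorphism `K_S → K_T` maps `t_0` to a non-trivial power of a root of `t_0`, up to a factor
`c` in `F`: were the exponent zero, the high element `c` would be algebraic over the prime field,
and so would be `t_0`. -/
theorem exists_map_t_zero (hq : Admissible F q)
    (hhigh : ∀ k : F, IsHigh (q 1) k → IsAlgebraic (⊥ : Subfield F) k)
    (φ : KTree F q S →+* KTree F q T)
    (ht : t F 0 ∈ KTree F q S) :
    ∃ (l : ℕ) (m : ℤ) (c : F), c ≠ 0 ∧ m ≠ 0 ∧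
      (φ ⟨t F 0, ht⟩ : Ambient F) = algebraMap F (Ambient F) c * rootSeq (q 1) (t F 0) l ^ m := by
  have h1 : IsHighIn (KTree F q S) (q 1) (t F 0) := isHighIn_rootSeq (hq.pos 1) _ fun l =>
    KStage_le_KTree S 1 (rootSeq_t_mem_KStage S 0 l)
  obtain ⟨l, m, c, hc, he⟩ := IsHighIn.exists_eq_mul_zpow hq (isHighIn_map φ (x := ⟨t F 0, ht⟩) h1)
  refine ⟨l, m, c, hc.1, ?_, he⟩
  rintro rfl
  rw [zpow_zero, mul_one] at he
  have h2 := IsAlgebraic.of_ringHom_eq_algebraMap φ (x := ⟨t F 0, ht⟩) (hhigh c hc)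
    (Subtype.ext he)
  exact transcendental_gen_base (Sum.inr 0) (h2.algebraMap (A := Ambient F))

theorem isHighIn_map_v (hq : Admissible F q) (φ : KTree F q S →+* KTree F q T) (i : ℕ)
    (hv : v F i ∈ KTree F q S) :
    IsHighIn (KTree F q T) (q 0) (φ ⟨v F i, hv⟩ : Ambient F) :=
  isHighIn_map φ (x := ⟨v F i, hv⟩) (isHighIn_rootSeq (hq.pos 0) _ fun l =>
    KStage_le_KTree S 0 (rootSeq_v_mem_KStage_zero S i l))

/-- A square root in `K_T` of an element `c * s ^ m - A`, where `s` is an iterated root of `t_0`,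
forces `A` to be, up to a factor in `F`, a power of the sum of the ends of an edge of `T`. -/
theorem exists_adj_of_sq_eq (hq : Admissible F q) {l : ℕ} {m : ℤ} {c : F} (hc : c ≠ 0)
    (hm : m ≠ 0) {A z : Ambient F} (hA : A ∈ KStage F q T 0) (hA0 : A ≠ 0) (hz : z ∈ KTree F q T)
    (hz2 : z ^ 2 = algebraMap F (Ambient F) c * rootSeq (q 1) (t F 0) l ^ m - A) :
    ∃ (u u' : ℕ) (N : ℤ), T.1.Adj u u' ∧ m = (q 1 ^ l : ℕ) * N ∧
      A = algebraMap F (Ambient F) c * (v F u + v F u') ^ N := by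
  have hz1 : z ∈ KStage F q T 1 := by
    refine KStage_isClosedIn hq T 1 z hz (IsAlgebraic.of_pow two_pos ?_)
    have hmem : z ^ 2 ∈ KStage F q T 1 := by
      rw [hz2]
      exact sub_mem (mul_mem (_root_.algebraMap_mem _ _)
        (zpow_mem (rootSeq_t_mem_KStage T 0 l) m)) (KStage_le_succ F q T 0 hA)
    exact isAlgebraic_algebraMap (⟨_, hmem⟩ : KStage F q T 1)
  rw [KStage_succ_eq] at hz1
  obtain ⟨⟨a, ha⟩, N, hN, hAN⟩ :=
    (isRadicalStep_KStage hq T 0).exists_of_mul_zpow_sub_eq_sq_of_mem hc hA hA0 hm hz1 hz2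
  obtain ⟨u, u', huu, rfl⟩ := ha
  exact ⟨u, u', N, huu, hN, hAN⟩

/-- The image of the square root of `t_0 - (v_i + v_j)`, for an edge of `S`, yields an edge of `T`.
-/
theorem exists_add_eq_of_adj (hq : Admissible F q) {l : ℕ} {m : ℤ} {c : F} (hc : c ≠ 0) (hm : m ≠ 0)
    (φ : KTree F q S →+* KTree F q T) {ht : t F 0 ∈ KTree F q S}
    (he : (φ ⟨t F 0, ht⟩ : Ambient F) =
      algebraMap F (Ambient F) c * rootSeq (q 1) (t F 0) l ^ m)
    {i j : ℕ} (hij : S.1.Adj i j) (hi : v F i ∈ KTree F q S) (hj : v F j ∈ KTree F q S) :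
    ∃ (u u' : ℕ) (N : ℤ), T.1.Adj u u' ∧ m = (q 1 ^ l : ℕ) * N ∧
      (φ ⟨v F i, hi⟩ : Ambient F) + φ ⟨v F j, hj⟩ =
        algebraMap F (Ambient F) c * (v F u + v F u') ^ N := by
  have hz : root 2 (t F 0 - (v F i + v F j)) ∈ KTree F q S :=
    KStage_le_KTree S 1 (root_mem_KStage S ⟨i, j, hij, rfl⟩)
  have hA0 := fun i hi => (IsHighIn.KStage_of_KTree hq T 0 (isHighIn_map_v hq φ i hi)).mem
  refine exists_adj_of_sq_eq hq hc hm (add_mem (hA0 i hi) (hA0 j hj))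
    (coe_ringHom_add_ne_zero φ hi hj (v_add_v_ne_zero hij.ne)) (φ ⟨_, hz⟩).2 ?_
  rw [← he]
  exact coe_ringHom_sq_eq φ ht hz hi hj (root_sq _)

/-- The images of the two ends of an edge of `S` are, up to a common factor, powers of the two
ends of an edge of `T`. -/
theorem exists_adj_of_ringHom (hq : Admissible F q)
    (hhigh : ∀ k : F, IsHigh (q 1) k → IsAlgebraic (⊥ : Subfield F) k)
    (φ : KTree F q S →+* KTree F q T) (hv : ∀ i, v F i ∈ KTree F q S) :
    ∃ (c : F) (N : ℤ), c ≠ 0 ∧ N ≠ 0 ∧ ∀ i j, S.1.Adj i j → ∃ u u', T.1.Adj u u' ∧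
      (φ ⟨v F i, hv i⟩ : Ambient F) = algebraMap F (Ambient F) c * v F u ^ N ∧
      (φ ⟨v F j, hv j⟩ : Ambient F) = algebraMap F (Ambient F) c * v F u' ^ N := by
  have ht : t F 0 ∈ KTree F q S := KStage_le_KTree S 1 (rootSeq_t_mem_KStage S 0 0)
  obtain ⟨l, m, c, hc, hm, he⟩ := exists_map_t_zero hq hhigh φ ht
  have key := fun i j (hij : S.1.Adj i j) =>
    exists_add_eq_of_adj hq hc hm φ he hij (hv i) (hv j)
  obtain ⟨i₀, j₀, hij₀⟩ : ∃ i j, S.1.Adj i j := by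
    obtain ⟨j, hj⟩ := S.2.1.preconnected.exists_adj_of_nontrivial 0
    exact ⟨0, j, hj⟩
  obtain ⟨_, _, N, -, hN, -⟩ := key i₀ j₀ hij₀
  have hN0 : N ≠ 0 := by rintro rfl; exact hm (by simpa using hN)
  refine ⟨c, N, hc, hN0, fun i j hij => ?_⟩
  obtain ⟨u, u', N', huu, hN', hsum⟩ := key i j hij
  -- the exponent is determined by `m` and `l`, which come from the image of `t_0`
  have hNN : N' = N := by
    rw [hN] at hN'
    exact (mul_left_cancel₀ (by exact_mod_cast (pow_pos (hq.pos 1) l).ne') hN').symm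
  subst hNN
  obtain ⟨l₁, h₁⟩ := IsHighIn.exists_isMonomial hq T (isHighIn_map_v hq φ i (hv i))
  obtain ⟨l₂, h₂⟩ := IsHighIn.exists_isMonomial hq T (isHighIn_map_v hq φ j (hv j))
  have h₁' := isMonomial_rootSeq_of_le (hq.pos 0) (le_max_left l₁ l₂) h₁
  have h₂' := isMonomial_rootSeq_of_le (hq.pos 0) (le_max_right l₁ l₂) h₂
  have hodd : Odd (q 0 ^ max l₁ l₂) := ((hq.prime 0).odd_of_ne_two (hq.ne_two 0)).pow
  rw [← rootSeq_pow (hq.pos 0) (v F u) (max l₁ l₂), ← rootSeq_pow (hq.pos 0) (v F u') (max l₁ l₂)]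
    at hsum
  have := IsMonomial.add_eq (algebraicIndependent_rootSeq_v (hq.pos 0) (max l₁ l₂)) huu.ne hodd hN0
    hc h₁' h₂' hsum
  simp only [rootSeq_pow (hq.pos 0)] at this
  rcases this with ⟨e₁, e₂⟩ | ⟨e₁, e₂⟩
  · exact ⟨u, u', huu, e₁, e₂⟩
  · exact ⟨u', u, huu.symm, e₁, e₂⟩

/-- A homomorphism `K_S → K_T` yields an embedding of `S` in `T`. -/
theorem embeds_of_ringHom (hq : Admissible F q)
    (hhigh : ∀ k : F, IsHigh (q 1) k → IsAlgebraic (⊥ : Subfield F) k)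
    (φ : KTree F q S →+* KTree F q T) : CombTree.Embeds S T := by
  have hv : ∀ i, v F i ∈ KTree F q S := fun i => KStage_le_KTree S 0 (v_mem_KStage_zero S i)
  obtain ⟨c, N, hc, hN, hadj⟩ := exists_adj_of_ringHom hq hhigh φ hv
  have hc' : algebraMap F (Ambient F) c ≠ 0 := (_root_.map_ne_zero _).2 hc
  have hex : ∀ i, ∃ u, (φ ⟨v F i, hv i⟩ : Ambient F) = algebraMap F (Ambient F) c * v F u ^ N := by
    intro i
    obtain ⟨j, hj⟩ := S.2.1.preconnected.exists_adj_of_nontrivial i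
    obtain ⟨u, _, _, hu, _⟩ := hadj i j hj
    exact ⟨u, hu⟩
  choose g hg using hex
  have hguniq : ∀ i u, (φ ⟨v F i, hv i⟩ : Ambient F) = algebraMap F (Ambient F) c * v F u ^ N →
      u = g i := by
    intro i u hu
    rw [hg i] at hu
    exact v_zpow_injective hN (mul_left_cancel₀ hc' hu).symm
  have hinj : Function.Injective g := by
    intro i j hij
    have h1 : φ ⟨v F i, hv i⟩ = φ ⟨v F j, hv j⟩ := Subtype.ext (by rw [hg i, hg j, hij])
    exact Sum.inl_injective (gen_injective (F := F) (Subtype.mk.inj (φ.injective h1)))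
  have hhom : ∀ {i j}, S.1.Adj i j → T.1.Adj (g i) (g j) := by
    intro i j hij
    obtain ⟨u, u', huu, h1, h2⟩ := hadj i j hij
    rwa [hguniq i u h1, hguniq j u' h2] at huu
  exact ⟨⟨⟨g, hinj⟩, fun {i j} => ⟨fun h => SimpleGraph.Hom.adj_of_adj S.2.1 T.2.2
    ⟨g, fun h => hhom h⟩ hinj h, fun h => hhom h⟩⟩⟩

end Reverse
end FriedKollar

/-! ### Homomorphisms on unions of towers -/

section Glue
variable {F Ω Ω' : Type*} [Field F] [Field Ω] [Algebra F Ω] [Field Ω']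

/-- Homomorphisms on the members of a tower that extend each other have a common extension to the
union. -/
theorem exists_ringHom_iSup {K : ℕ → IntermediateField F Ω} (hK : Monotone K)
    (φ : ∀ n, K n →+* Ω')
    (hφ : ∀ n x (hx : x ∈ K n), φ (n + 1) ⟨x, hK n.le_succ hx⟩ = φ n ⟨x, hx⟩) :
    ∃ Φ : ↥(⨆ n, K n) →+* Ω', ∀ n x (hx : x ∈ K n), Φ ⟨x, le_iSup K n hx⟩ = φ n ⟨x, hx⟩ := by
  have hle : ∀ {m n : ℕ} (hmn : m ≤ n) {x : Ω} (hx : x ∈ K m) (hx' : x ∈ K n),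
      φ n ⟨x, hx'⟩ = φ m ⟨x, hx⟩ := by
    intro m n hmn
    induction hmn with
    | refl => exact fun _ _ => rfl
    | step h ih => exact fun hx hx' => (hφ _ _ (hK h hx)).trans (ih hx (hK h hx))
  have hmem : ∀ x : ↥(⨆ n, K n), ∃ n, (x : Ω) ∈ K n := fun x => (mem_iSup_of_monotone hK).1 x.2
  choose N hN using hmem
  have hval : ∀ (x : ↥(⨆ n, K n)) (n : ℕ) (hx : (x : Ω) ∈ K n),
      φ (N x) ⟨x, hN x⟩ = φ n ⟨x, hx⟩ := by
    intro x n hx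
    rw [← hle (le_max_left n (N x)) hx (hK (le_max_left _ _) hx),
      ← hle (le_max_right n (N x)) (hN x) (hK (le_max_right _ _) (hN x))]
  let Φ : ↥(⨆ n, K n) →+* Ω' :=
    { toFun := fun x => φ (N x) ⟨x, hN x⟩
      map_one' := (hval 1 0 (one_mem _)).trans (map_one (φ 0))
      map_zero' := (hval 0 0 (zero_mem _)).trans (map_zero (φ 0))
      map_mul' := fun x y => by
        have hx := hK (le_max_left (N x) (N y)) (hN x)
        have hy := hK (le_max_right (N x) (N y)) (hN y)
        rw [hval x _ hx, hval y _ hy, hval (x * y) _ (mul_mem hx hy), ← map_mul]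
        rfl
      map_add' := fun x y => by
        have hx := hK (le_max_left (N x) (N y)) (hN x)
        have hy := hK (le_max_right (N x) (N y)) (hN y)
        rw [hval x _ hx, hval y _ hy, hval (x + y) _ (add_mem hx hy), ← map_add]
        rfl }
  exact ⟨Φ, fun n x hx => hval ⟨x, _⟩ n hx⟩

/-- Homomorphisms on the members of a tower can be extended step by step to the union. -/
theorem exists_ringHom_iSup_of_forall {K : ℕ → IntermediateField F Ω} (hK : Monotone K)
    (P : ∀ n, (K n →+* Ω') → Prop) (h0 : ∃ ψ, P 0 ψ)
    (hs : ∀ n ψ, P n ψ → ∃ ψ' : K (n + 1) →+* Ω', P (n + 1) ψ' ∧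
      ∀ x (hx : x ∈ K n), ψ' ⟨x, hK n.le_succ hx⟩ = ψ ⟨x, hx⟩) :
    ∃ Φ : ↥(⨆ n, K n) →+* Ω', ∀ n, ∃ ψ, P n ψ ∧
      ∀ x (hx : x ∈ K n), Φ ⟨x, le_iSup K n hx⟩ = ψ ⟨x, hx⟩ := by
  choose ψ₀ hψ₀ using h0
  choose next hnext hext using hs
  let ψ : ∀ n, {ψ : K n →+* Ω' // P n ψ} := fun n =>
    Nat.rec ⟨ψ₀, hψ₀⟩ (fun n ψ => ⟨next n ψ.1 ψ.2, hnext n ψ.1 ψ.2⟩) n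
  obtain ⟨Φ, hΦ⟩ := exists_ringHom_iSup hK (fun n => (ψ n).1) fun n x hx =>
    hext n (ψ n).1 (ψ n).2 x hx
  exact ⟨Φ, fun n => ⟨(ψ n).1, (ψ n).2, hΦ n⟩⟩

theorem ringHom_adjoin_mem {S : Set Ω} (φ : adjoin F S →+* Ω') (L : Subfield Ω')
    (hF : ∀ c, φ (algebraMap F _ c) ∈ L) (hS : ∀ x (hx : x ∈ S), φ ⟨x, subset_adjoin F S hx⟩ ∈ L)
    (x : adjoin F S) : φ x ∈ L := by
  obtain ⟨x, hx⟩ := x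
  induction hx using adjoin_induction with
  | mem x hx => exact hS x hx
  | algebraMap c => exact hF c
  | add x y hx hy h1 h2 =>
    have : (⟨x + y, add_mem hx hy⟩ : adjoin F S) = ⟨x, hx⟩ + ⟨y, hy⟩ := rfl
    rw [this, map_add]
    exact add_mem h1 h2
  | mul x y hx hy h1 h2 =>
    have : (⟨x * y, mul_mem hx hy⟩ : adjoin F S) = ⟨x, hx⟩ * ⟨y, hy⟩ := rfl
    rw [this, map_mul]
    exact mul_mem h1 h2
  | inv x hx h1 =>
    have : (⟨x⁻¹, inv_mem hx⟩ : adjoin F S) = ⟨x, hx⟩⁻¹ := rfl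
    rw [this, map_inv₀]
    exact inv_mem h1

/-- Extension of homomorphisms along a radical step, for intermediate fields of `Ω / F`. -/
theorem IsRadicalStep.exists_ringHom_of_eq {K K₁ : IntermediateField F Ω} {q : ℕ} {s : ℕ → Ω}
    {ι : Type*} {a ε : ι → K} {r : ι → Ω} (h : IsRadicalStep q s a ε r)
    (hK₁ : K₁ = (stepField K s r).restrictScalars F) (ψ : K →+* Ω') {s' : ℕ → Ω'} {r' : ι → Ω'}
    (hroot : ∀ l, s' (l + 1) ^ q = s' l) (htr : ∀ l, ∀ f : K[X], f ≠ 0 → eval₂ ψ (s' l) f ≠ 0)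
    (hsq : ∀ i, r' i ^ 2 = ψ (ε i) * (s' 0 - ψ (a i))) :
    ∃ φ : K₁ →+* Ω', (∀ x (hx : x ∈ K) (hx₁ : x ∈ K₁), φ ⟨x, hx₁⟩ = ψ ⟨x, hx⟩) ∧
      (∀ l (hl : s l ∈ K₁), φ ⟨s l, hl⟩ = s' l) ∧ (∀ i (hi : r i ∈ K₁), φ ⟨r i, hi⟩ = r' i) ∧
      ∀ L : Subfield Ω', (∀ x, ψ x ∈ L) → (∀ l, s' l ∈ L) → (∀ i, r' i ∈ L) → ∀ x, φ x ∈ L := by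
  subst hK₁
  obtain ⟨φ, h1, h2, h3⟩ := h.exists_ringHom ψ hroot htr hsq
  refine ⟨φ, fun x hx _ => h1 ⟨x, hx⟩, fun l _ => h2 l, fun i _ => h3 i, fun L hψ hs hr x => ?_⟩
  refine ringHom_adjoin_mem φ L (fun c => ?_) ?_ x
  · exact Set.mem_of_eq_of_mem (h1 c) (hψ c)
  · rintro _ (⟨l, rfl⟩ | ⟨i, rfl⟩)
    · exact Set.mem_of_eq_of_mem (h2 l) (hs l)
    · exact Set.mem_of_eq_of_mem (h3 i) (hr i)

end Glue

namespace FriedKollar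

/-! ### From embeddings of trees to homomorphisms of fields -/

section Forward
variable {F : Type*} [Field F] {q : ℕ → ℕ} {S T : CombTree}

theorem transcendental_rootSeq {K : IntermediateField F (Ambient F)} {q : ℕ} (hq : 0 < q)
    {x : Ambient F} (h : Transcendental K x) (l : ℕ) : Transcendental K (rootSeq q x l) := fun ha =>
  h (rootSeq_pow hq x l ▸ ha.pow _)

theorem eval₂_rootSeq_ne_zero {k : Type*} [Field k] {K : IntermediateField F (Ambient F)}
    (ψ : k →+* Ambient F) (hψ : ∀ x, ψ x ∈ K) {q : ℕ} (hq : 0 < q) {x : Ambient F}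
    (h : Transcendental K x) (l : ℕ) {f : k[X]} (hf : f ≠ 0) : eval₂ ψ (rootSeq q x l) f ≠ 0 :=
  fun h0 => transcendental_rootSeq hq h l ⟨f.map (ψ.codRestrict K hψ),
    (Polynomial.map_ne_zero_iff (ψ.codRestrict K hψ).injective).2 hf, by
      rw [aeval_def, eval₂_map]; exact h0⟩

/-- The homomorphism `K_0(S) → K_0(T)` induced by an injection of the vertices. -/
theorem exists_ringHom_KStage_zero (hq : Admissible F q) (S T : CombTree) {g : ℕ → ℕ}
    (hg : Function.Injective g) :
    ∃ φ : KStage F q S 0 →+* Ambient F, (∀ x, φ x ∈ KStage F q T 0) ∧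
      ∀ i (hi : v F i ∈ KStage F q S 0), φ ⟨v F i, hi⟩ = v F (g i) := by
  let P : ∀ i, (vTower F q i →+* Ambient F) → Prop := fun i ψ =>
    (∀ j l (hj : j < i), ψ ⟨rootSeq (q 0) (v F j) l, rootSeq_mem_vTower hj l⟩ =
      rootSeq (q 0) (v F (g j)) l) ∧
    ∀ L : IntermediateField F (Ambient F), (∀ j l, j < i → rootSeq (q 0) (v F (g j)) l ∈ L) →
      ∀ x, ψ x ∈ L
  have h0 : ∃ ψ, P 0 ψ := by
    have hbot : vTower F q 0 ≤ ⊥ := by simp [vTower]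
    refine ⟨(algebraMap F (Ambient F)).comp ((botEquiv F (Ambient F)).toRingEquiv.toRingHom.comp
      (inclusion hbot).toRingHom), fun j l hj => absurd hj (Nat.not_lt_zero j), fun L _ x => ?_⟩
    exact _root_.algebraMap_mem L _
  have hs : ∀ i ψ, P i ψ → ∃ ψ' : vTower F q (i + 1) →+* Ambient F, P (i + 1) ψ' ∧
      ∀ x (hx : x ∈ vTower F q i), ψ' ⟨x, vTower_monotone i.le_succ hx⟩ = ψ ⟨x, hx⟩ := by
    rintro i ψ ⟨h1, h2⟩
    have hψ : ∀ x, ψ x ∈ closureGen F (Sum.inl '' (g '' Set.Iio i)) := h2 _ fun j l hj => by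
      have hj' : (Sum.inl (g j) : ℕ ⊕ ℕ) ∈ Sum.inl '' (g '' Set.Iio i) := ⟨g j, ⟨j, hj, rfl⟩, rfl⟩
      exact rootSeq_mem_closureGen hj' (hq.pos 0) l
    have htr : Transcendental (closureGen F (Sum.inl '' (g '' Set.Iio i))) (v F (g i)) := by
      refine transcendental_gen (i := Sum.inl (g i)) le_rfl ?_
      rintro ⟨_, ⟨j, hj, rfl⟩, hji⟩
      exact absurd (hg (Sum.inl_injective hji)) (ne_of_lt hj)
    obtain ⟨φ, f1, f2, -, f4⟩ := (isRadicalStep_vTower hq i).exists_ringHom_of_eq (vTower_succ_eq i)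
      ψ (s' := rootSeq (q 0) (v F (g i))) (r' := Empty.elim) (rootSeq_succ_pow (hq.pos 0) _)
      (fun l f hf => eval₂_rootSeq_ne_zero ψ hψ (hq.pos 0) htr l hf) (fun e => e.elim)
    refine ⟨φ, ⟨fun j l hj => ?_, fun L hL => ?_⟩, fun x hx => f1 x hx _⟩
    · rcases Nat.lt_succ_iff_lt_or_eq.1 hj with hj | rfl
      · rw [f1 _ (rootSeq_mem_vTower hj l), h1 j l hj]
      · exact f2 l _
    · exact f4 L.toSubfield (h2 L fun j l hj => hL j l (hj.trans i.lt_succ_self))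
        (fun l => hL i l i.lt_succ_self) fun e => e.elim
  obtain ⟨Φ, hΦ⟩ := exists_ringHom_iSup_of_forall vTower_monotone P h0 hs
  have hle : KStage F q S 0 ≤ ⨆ i, vTower F q i := (iSup_vTower S).ge
  refine ⟨restrictHom hle Φ, fun x => ?_, fun i hi => ?_⟩
  · obtain ⟨x, hx⟩ := x
    obtain ⟨i, hi⟩ := (mem_iSup_of_monotone vTower_monotone).1 (hle hx)
    obtain ⟨ψ, ⟨-, h2⟩, h3⟩ := hΦ i
    rw [restrictHom_mk, h3 x hi]
    exact h2 _ (fun j l _ => rootSeq_v_mem_KStage_zero T (g j) l) _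
  · obtain ⟨ψ, ⟨h1, -⟩, h3⟩ := hΦ (i + 1)
    rw [restrictHom_mk]
    exact (h3 _ (rootSeq_mem_vTower i.lt_succ_self 0)).trans (h1 i 0 i.lt_succ_self)

/-- An embedding of `S` in `T` yields a homomorphism `K_S → K_T`, constructed along the stages. -/
theorem exists_ringHom_of_embeds (hq : Admissible F q) (h : CombTree.Embeds S T) :
    Nonempty (KTree F q S →+* KTree F q T) := by
  obtain ⟨g⟩ := h
  let P : ∀ n, (KStage F q S n →+* Ambient F) → Prop := fun n ψ =>
    (∀ x, ψ x ∈ KStage F q T n) ∧ ∀ a (ha : a ∈ H F S n), ψ ⟨a, H_subset_KStage S n ha⟩ ∈ H F T n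
  have h0 : ∃ ψ, P 0 ψ := by
    obtain ⟨φ, h1, h2⟩ := exists_ringHom_KStage_zero hq S T g.injective
    refine ⟨φ, h1, ?_⟩
    rintro _ ⟨i, j, hij, rfl⟩
    refine ⟨g i, g j, g.map_rel_iff.2 hij, ?_⟩
    rw [← h2 i (v_mem_KStage_zero S i), ← h2 j (v_mem_KStage_zero S j), ← map_add]
    rfl
  have hs : ∀ n ψ, P n ψ → ∃ ψ' : KStage F q S (n + 1) →+* Ambient F, P (n + 1) ψ' ∧
      ∀ x (hx : x ∈ KStage F q S n), ψ' ⟨x, KStage_monotone S n.le_succ hx⟩ = ψ ⟨x, hx⟩ := by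
    rintro n ψ ⟨h1, h2⟩
    obtain ⟨φ, f1, -, f3, f4⟩ := (isRadicalStep_KStage hq S n).exists_ringHom_of_eq
      (KStage_succ_eq S n) ψ (s' := rootSeq (q (n + 1)) (t F n))
      (r' := fun a => root 2 (t F n - ψ ⟨a, H_subset_KStage S n a.2⟩))
      (rootSeq_succ_pow (hq.pos _) _)
      (fun l f hf => eval₂_rootSeq_ne_zero ψ h1 (hq.pos _) (transcendental_t hq T n) l hf)
      (fun a => by rw [root_sq, map_one, one_mul]; rfl)
    refine ⟨φ, ⟨?_, ?_⟩, fun x hx => f1 x hx _⟩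
    · exact f4 (KStage F q T (n + 1)).toSubfield (fun x => KStage_le_succ F q T n (h1 x))
        (fun l => rootSeq_t_mem_KStage T n l) fun a => root_mem_KStage T (h2 a a.2)
    · rintro _ ⟨a, ha, rfl⟩
      rw [f3 ⟨a, ha⟩]
      exact ⟨_, h2 a ha, rfl⟩
  obtain ⟨Φ, hΦ⟩ := exists_ringHom_iSup_of_forall (KStage_monotone S) P h0 hs
  refine ⟨RingHom.codRestrict Φ (KTree F q T) fun x => ?_⟩
  obtain ⟨x, hx⟩ := x
  obtain ⟨n, hn⟩ := (mem_iSup_of_monotone (KStage_monotone S)).1 hx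
  obtain ⟨ψ, ⟨h1, -⟩, h3⟩ := hΦ n
  rw [h3 x hn]
  exact KStage_le_KTree T n (h1 _)

end Forward
end FriedKollar

/-! ### Coding countable fields -/

section Coding
open Function

variable {K : Type*} [Field K] {p : ℕ}

/-- The structure on `ℕ` obtained from a field by transport along a bijection. -/
def FieldStr.ofEquiv (b : ℕ ≃ K) : FieldStr :=
  (fun m n => b.symm (b m + b n), fun m n => b.symm (b m * b n), b.symm 0, b.symm 1)

@[simp]
theorem FieldStr.ofEquiv_add (b : ℕ ≃ K) (m n : ℕ) :
    (FieldStr.ofEquiv b).add m n = b.symm (b m + b n) := rfl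

@[simp]
theorem FieldStr.ofEquiv_mul (b : ℕ ≃ K) (m n : ℕ) :
    (FieldStr.ofEquiv b).mul m n = b.symm (b m * b n) := rfl

@[simp]
theorem FieldStr.ofEquiv_zero (b : ℕ ≃ K) : (FieldStr.ofEquiv b).zero = b.symm 0 := rfl

@[simp]
theorem FieldStr.ofEquiv_one (b : ℕ ≃ K) : (FieldStr.ofEquiv b).one = b.symm 1 := rfl

/-- The axioms of fields are preserved by transport along a bijection. -/
theorem isFieldStr_ofEquiv [CharP K p] (b : ℕ ≃ K) : IsFieldStr p (FieldStr.ofEquiv b) where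
  add_assoc x y z := by simp [add_assoc]
  add_comm x y := by simp [add_comm]
  zero_add x := by simp
  exists_neg x := ⟨b.symm (-b x), by simp⟩
  mul_assoc x y z := by simp [mul_assoc]
  mul_comm x y := by simp [mul_comm]
  one_mul x := by simp
  mul_add x y z := by simp [mul_add]
  zero_ne_one := by simp
  exists_inv x hx := ⟨b.symm (b x)⁻¹, by
    have h : b x ≠ 0 := fun h => hx (by simp [← h])
    simp [h]⟩
  char n := by
    have h : ∀ n : ℕ, ((FieldStr.ofEquiv b).add (FieldStr.ofEquiv b).one)^[n]
        (FieldStr.ofEquiv b).zero = b.symm (n : K) := by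
      intro n
      induction n with
      | zero => simp
      | succ n ih =>
        rw [iterate_succ_apply', ih]
        simp [add_comm]
    rw [h, ← CharP.cast_eq_zero_iff K p n]
    exact b.symm.apply_eq_iff_eq

/-- The field coded by `FieldStr.ofEquiv b` is isomorphic to the original field. -/
def Fld.ofEquivRingEquiv [CharP K p] (b : ℕ ≃ K) :
    Fld.Carrier (⟨FieldStr.ofEquiv b, isFieldStr_ofEquiv b⟩ : Fld p) ≃+* K where
  toEquiv := b
  map_mul' x y := b.apply_symm_apply (b x * b y)
  map_add' x y := b.apply_symm_apply (b x + b y)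

theorem measurableSet_count_eq {X : Type*} [MeasurableSpace X] {P : X → ℕ → Prop}
    [∀ x, DecidablePred (P x)] (hP : ∀ n, MeasurableSet {x | P x n}) (n m : ℕ) :
    MeasurableSet {x | Nat.count (P x) n = m} := by
  induction n generalizing m with
  | zero => simp only [Nat.count_zero]; exact MeasurableSet.const _
  | succ n ih =>
    have : {x | Nat.count (P x) (n + 1) = m} =
        ({x | P x n} ∩ {x | Nat.count (P x) n + 1 = m}) ∪
          ({x | P x n}ᶜ ∩ {x | Nat.count (P x) n = m}) := by
      ext x
      by_cases h : P x n <;> simp [Nat.count_succ, h]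
    rw [this]
    refine ((hP n).inter ?_).union ((hP n).compl.inter (ih m))
    cases m with
    | zero => simp
    | succ m => simpa using ih m

theorem measurableSet_nth_eq {X : Type*} [MeasurableSpace X] {P : X → ℕ → Prop}
    (hP : ∀ n, MeasurableSet {x | P x n}) (hinf : ∀ x, {n | P x n}.Infinite) (n m : ℕ) :
    MeasurableSet {x | Nat.nth (P x) n = m} := by
  classical
  have : {x | Nat.nth (P x) n = m} = {x | P x m} ∩ {x | Nat.count (P x) m = n} := by
    ext x
    constructor
    · rintro rfl
      exact ⟨Nat.nth_mem_of_infinite (hinf x) n, Nat.count_nth_of_infinite (hinf x) n⟩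
    · rintro ⟨h1, rfl⟩
      exact Nat.nth_count h1
  rw [this]
  exact (hP m).inter (measurableSet_count_eq hP m n)

/-- A Borel family of infinite subsets of a countable set can be enumerated in a Borel way. -/
theorem exists_measurable_enumeration {Ω X : Type*} [Countable Ω] [MeasurableSpace X]
    (V : X → Set Ω) (hV : ∀ y, MeasurableSet {x | y ∈ V x}) (hinf : ∀ x, (V x).Infinite) :
    ∃ b : ∀ x, ℕ ≃ V x, ∀ n y, MeasurableSet {x | (b x n : Ω) = y} := by
  classical
  rcases isEmpty_or_nonempty X with hX | ⟨⟨x₀⟩⟩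
  · exact ⟨fun x => isEmptyElim x, fun n y => by
      rw [Set.eq_empty_of_isEmpty {x | _}]; exact MeasurableSet.empty⟩
  have : Infinite Ω := Set.infinite_univ_iff.1 ((hinf x₀).mono (Set.subset_univ _))
  obtain ⟨e⟩ : Nonempty (Ω ≃ ℕ) := nonempty_equiv_of_countable
  let P : X → ℕ → Prop := fun x n => e.symm n ∈ V x
  have hP : ∀ n, MeasurableSet {x | P x n} := fun n => hV _
  have hPe : ∀ x y, y ∈ V x → P x (e y) := fun x y hy => by
    change e.symm (e y) ∈ V x
    rwa [e.symm_apply_apply]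
  have hPinf : ∀ x, {n | P x n}.Infinite := fun x =>
    ((hinf x).image e.injective.injOn).mono (by
      rintro _ ⟨y, hy, rfl⟩
      exact hPe x y hy)
  let b : ∀ x, ℕ ≃ V x := fun x => Equiv.ofBijective
    (fun n => ⟨e.symm (Nat.nth (P x) n), Nat.nth_mem_of_infinite (hPinf x) n⟩)
    ⟨fun m n h => Nat.nth_injective (hPinf x) (e.symm.injective (Subtype.mk.inj h)), fun y =>
      ⟨Nat.count (P x) (e y), Subtype.ext (by simp [Nat.nth_count (hPe x y y.2)])⟩⟩
  refine ⟨b, fun n y => ?_⟩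
  have : {x | (b x n : Ω) = y} = {x | Nat.nth (P x) n = e y} := by
    ext x
    exact e.symm_apply_eq
  rw [this]
  exact measurableSet_nth_eq hP hPinf n (e y)

/-- A Borel family of infinite subfields of a countable field can be coded in a Borel way by points
of the space of fields with domain `ℕ`. -/
theorem exists_measurable_fld {F Ω X : Type*} [Field F] [Field Ω] [Algebra F Ω] [Countable Ω]
    [CharP F p] [MeasurableSpace X] (K : X → IntermediateField F Ω)
    (hK : ∀ y, MeasurableSet {x | y ∈ K x}) (hinf : ∀ x, (K x : Set Ω).Infinite) :
    ∃ f : X → Fld p, Measurable f ∧ ∀ x, Nonempty ((f x).Carrier ≃+* K x) := by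
  obtain ⟨b, hb⟩ : ∃ b : ∀ x, ℕ ≃ K x, ∀ n y, MeasurableSet {x | (b x n : Ω) = y} :=
    exists_measurable_enumeration (fun x => (K x : Set Ω)) hK hinf
  have hop : ∀ (op : Ω → Ω → Ω) (g : X → ℕ) (m n : ℕ),
      (∀ x, (b x (g x) : Ω) = op (b x m) (b x n)) → Measurable g := by
    intro op g m n hg
    refine measurable_to_countable' fun k => ?_
    have : g ⁻¹' {k} = ⋃ (y : Ω), ⋃ (z : Ω), {x | (b x m : Ω) = y} ∩ {x | (b x n : Ω) = z} ∩
        {x | (b x k : Ω) = op y z} := by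
      ext x
      simp only [Set.mem_preimage, Set.mem_singleton_iff, Set.mem_iUnion, Set.mem_inter_iff,
        Set.mem_ofPred_eq]
      constructor
      · rintro rfl
        exact ⟨_, _, ⟨rfl, rfl⟩, hg x⟩
      · rintro ⟨_, _, ⟨rfl, rfl⟩, h⟩
        rw [← hg x] at h
        exact (b x).injective (Subtype.ext h).symm
    rw [this]
    exact .iUnion fun y => .iUnion fun z => ((hb m y).inter (hb n z)).inter (hb k _)
  have hchar : ∀ x, CharP (K x) p := fun x =>
    charP_of_injective_algebraMap (algebraMap F (K x)).injective p
  refine ⟨fun x => ⟨FieldStr.ofEquiv (b x), isFieldStr_ofEquiv (b x)⟩, Measurable.subtype_mk ?_,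
    fun x => ⟨Fld.ofEquivRingEquiv (b x)⟩⟩
  refine Measurable.prodMk ?_ (Measurable.prodMk ?_ (Measurable.prodMk ?_ ?_))
  · refine measurable_pi_iff.2 fun m => measurable_pi_iff.2 fun n =>
      hop (· + ·) _ m n fun x => ?_
    rw [Equiv.apply_symm_apply]; rfl
  · refine measurable_pi_iff.2 fun m => measurable_pi_iff.2 fun n =>
      hop (· * ·) _ m n fun x => ?_
    rw [Equiv.apply_symm_apply]; rfl
  · refine hop (fun _ _ => 0) _ 0 0 fun x => ?_
    rw [Equiv.apply_symm_apply]; rfl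
  · refine hop (fun _ _ => 1) _ 0 0 fun x => ?_
    rw [Equiv.apply_symm_apply]; rfl

end Coding

namespace FriedKollar

/-! ### The fields `K_T` as a Borel family -/

section Borel
variable {F : Type*} [Field F] {q : ℕ → ℕ}

instance instCountableAmbient [Countable F] : Countable (Ambient F) := by
  have h1 : Countable (MvPolynomial (ℕ ⊕ ℕ) F) := by
    rw [← Cardinal.mk_le_aleph0_iff]
    exact (MvPolynomial.cardinalMk_le_max_lift (σ := ℕ ⊕ ℕ) (R := F)).trans (by simp)
  have h2 : Countable (FractionRing (MvPolynomial (ℕ ⊕ ℕ) F)) :=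
    (IsLocalization.mk'_surjective (nonZeroDivisors (MvPolynomial (ℕ ⊕ ℕ) F))).countable
  rw [← Cardinal.mk_le_aleph0_iff]
  exact (Algebra.IsAlgebraic.cardinalMk_le_max (FractionRing (MvPolynomial (ℕ ⊕ ℕ) F)) _).trans
    (by simp)

theorem measurableSet_mem_H [Countable F] (n : ℕ) (x : Ambient F) :
    MeasurableSet {T : CombTree | x ∈ H F T n} := by
  induction n generalizing x with
  | zero =>
    have : {T : CombTree | x ∈ H F T 0} =
        ⋃ (i : ℕ), ⋃ (j : ℕ), {T : CombTree | T.1.Adj i j} ∩ {_T | x = v F i + v F j} := by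
      ext T
      simp [H]
    rw [this]
    exact .iUnion fun i => .iUnion fun j =>
      (measurable_subtype_coe (measurableSet_adj i j)).inter (MeasurableSet.const _)
  | succ n ih =>
    have : {T : CombTree | x ∈ H F T (n + 1)} =
        ⋃ a : Ambient F, {T : CombTree | a ∈ H F T n} ∩ {_T | root 2 (t F n - a) = x} := by
      ext T
      simp [H]
    rw [this]
    exact .iUnion fun a => (ih a).inter (MeasurableSet.const _)

/-- Generators of `K_T`: the iterated roots of the `v_i` and the `t_n`, and the elements of the sets
`H_{n+1}(T)`. -/
def treeGens (q : ℕ → ℕ) (T : CombTree) : Set (Ambient F) :=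
  {x | ∃ i l, x = rootSeq (q 0) (v F i) l} ∪ {x | ∃ n l, x = rootSeq (q (n + 1)) (t F n) l} ∪
    {x | ∃ n, x ∈ H F T (n + 1)}

theorem KTree_eq_adjoin (T : CombTree) : KTree F q T = adjoin F (treeGens q T) := by
  apply le_antisymm
  · refine iSup_le fun n => ?_
    have h1 : ∀ i l, rootSeq (q 0) (v F i) l ∈ adjoin F (treeGens q T) := fun i l =>
      subset_adjoin F (treeGens q T) (Or.inl (Or.inl ⟨i, l, rfl⟩))
    have h2 : ∀ n l, rootSeq (q (n + 1)) (t F n) l ∈ adjoin F (treeGens q T) := fun n l =>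
      subset_adjoin F (treeGens q T) (Or.inl (Or.inr ⟨n, l, rfl⟩))
    have h3 : ∀ n, ∀ x ∈ H F T (n + 1), x ∈ adjoin F (treeGens q T) := fun n x hx =>
      subset_adjoin F (treeGens q T) (Or.inr ⟨n, hx⟩)
    induction n with
    | zero =>
      refine adjoin_le_iff.2 ?_
      rintro _ ⟨i, l, rfl⟩
      exact h1 i l
    | succ n ih =>
      rw [KStage_succ_eq]
      exact stepField_le ih (h2 n) fun a => h3 n _ ⟨a, a.2, rfl⟩
  · refine adjoin_le_iff.2 ?_
    rintro x ((⟨i, l, rfl⟩ | ⟨n, l, rfl⟩) | ⟨n, hx⟩)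
    · exact KStage_le_KTree T 0 (rootSeq_v_mem_KStage_zero T i l)
    · exact KStage_le_KTree T (n + 1) (rootSeq_t_mem_KStage T n l)
    · exact KStage_le_KTree T (n + 1) (H_subset_KStage T (n + 1) hx)

/-- Each element of a generated field is in the field generated by a finite set of generators, so
membership of `x` in `K_T` is a countable Boolean combination of Borel conditions on `T`. -/
theorem measurableSet_mem_KTree [Countable F] (q : ℕ → ℕ) (x : Ambient F) :
    MeasurableSet {T : CombTree | x ∈ KTree F q T} := by
  have hgen : ∀ y : Ambient F, MeasurableSet {T : CombTree | y ∈ treeGens q T} := by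
    intro y
    have : {T : CombTree | y ∈ treeGens q T} = {_T | ∃ i l, y = rootSeq (q 0) (v F i) l} ∪
        {_T | ∃ n l, y = rootSeq (q (n + 1)) (t F n) l} ∪ ⋃ n, {T | y ∈ H F T (n + 1)} := by
      ext T
      simp [treeGens]
    rw [this]
    exact ((MeasurableSet.const _).union (MeasurableSet.const _)).union
      (.iUnion fun n => measurableSet_mem_H (n + 1) y)
  have : {T : CombTree | x ∈ KTree F q T} = ⋃ A : Finset (Ambient F),
      {_T | x ∈ adjoin F (A : Set (Ambient F))} ∩ ⋂ y ∈ A, {T | y ∈ treeGens q T} := by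
    ext T
    simp only [Set.mem_ofPred_eq, Set.mem_iUnion, Set.mem_inter_iff, Set.mem_iInter]
    rw [KTree_eq_adjoin]
    constructor
    · intro h
      obtain ⟨A, hA, hx⟩ := exists_finset_of_mem_adjoin h
      exact ⟨A, hx, hA⟩
    · rintro ⟨A, hx, hA⟩
      exact adjoin.mono F _ _ hA hx
  rw [this]
  exact .iUnion fun A => (MeasurableSet.const _).inter
    (A.measurableSet_biInter fun y _ => hgen y)

theorem infinite_KTree (q : ℕ → ℕ) (T : CombTree) : (KTree F q T : Set (Ambient F)).Infinite :=
  Set.infinite_coe_iff.1 <|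
  Infinite.of_injective
    (fun i : ℕ => (⟨v F i, KStage_le_KTree T 0 (v_mem_KStage_zero T i)⟩ : KTree F q T))
    fun _ _ h => Sum.inl_injective (gen_injective (F := F) (Subtype.mk.inj h))

/-- The map `T ↦ K_T` is a Borel reduction of the embeddability of trees to the embeddability of
fields. -/
theorem exists_isBorelReduction [Countable F] {p : ℕ} [CharP F p] (hq : Admissible F q)
    (hhigh : ∀ k : F, IsHigh (q 1) k → IsAlgebraic (⊥ : Subfield F) k) :
    ∃ f : CombTree → Fld p, (∀ T, Nonempty ((f T).Carrier ≃+* KTree F q T)) ∧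
      IsBorelReduction CombTree.Embeds Fld.Embeds f := by
  obtain ⟨f, hf, he⟩ := exists_measurable_fld (p := p) (fun T => KTree F q T)
    (measurableSet_mem_KTree q) (infinite_KTree q)
  refine ⟨f, he, hf, fun S T => ⟨fun h => ?_, fun ⟨φ⟩ => ?_⟩⟩
  · obtain ⟨φ⟩ := exists_ringHom_of_embeds hq h
    exact ⟨((he T).some.symm.toRingHom.comp φ).comp (he S).some.toRingHom⟩
  · exact embeds_of_ringHom hq hhigh
      (((he T).some.toRingHom.comp φ).comp (he S).some.symm.toRingHom)

theorem admissible_of {p : ℕ} [CharP F p] (hp : p = 0 ∨ (p.Prime ∧ Odd p))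
    (hinj : Function.Injective q) (hprime : ∀ n, (q n).Prime) (hodd : ∀ n, Odd (q n))
    (hne : ∀ n, q n ≠ p) : Admissible F q := by
  have hcast : ∀ r : ℕ, r.Prime → r ≠ p → (r : F) ≠ 0 := by
    intro r hr hrp h0
    have hd := (CharP.cast_eq_zero_iff F p r).1 h0
    rcases hp with rfl | ⟨hp, -⟩
    · exact hr.ne_zero (zero_dvd_iff.1 hd)
    · exact hrp ((Nat.prime_dvd_prime_iff_eq hp hr).1 hd).symm
  refine ⟨?_, hinj, hprime, fun n h => ?_, fun n => hcast _ (hprime n) (hne n)⟩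
  · have := hcast 2 Nat.prime_two (by
      rintro rfl
      rcases hp with h | ⟨-, h⟩
      · exact two_ne_zero h
      · exact absurd h (by decide))
    exact_mod_cast this
  · have := hodd n
    rw [h] at this
    exact absurd this (by decide)

end Borel
end FriedKollar

end

/-! ### Finite approximations of an analytic quasi-order -/

section Chain
open Filter Topology

/-- `Chain f n x y a` says that, as far as the first `n` terms of the sequences can tell, `x` and
`y` are joined by a finite sequence of pairs in the range of `f`, and that the sum of the `γ + 1`
over the points `γ` which `f` maps to these pairs is at most `a`. -/
inductive Chain (f : (ℕ → ℕ) → (ℕ → Bool) × (ℕ → Bool)) (n : ℕ) :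
    (ℕ → Bool) → (ℕ → Bool) → (ℕ → ℕ) → Prop
  | refl {x y : ℕ → Bool} {a : ℕ → ℕ} (h : ∀ i < n, x i = y i) : Chain f n x y a
  | step {x z y : ℕ → Bool} {a c γ : ℕ → ℕ} (hx : ∀ i < n, (f γ).1 i = x i)
      (hz : ∀ i < n, (f γ).2 i = z i) (ha : ∀ i < n, γ i + 1 + c i ≤ a i) (h : Chain f n z y c) :
      Chain f n x y a

namespace Chain
variable {f : (ℕ → ℕ) → (ℕ → Bool) × (ℕ → Bool)} {n : ℕ} {x y : ℕ → Bool} {a : ℕ → ℕ}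

theorem mono {m : ℕ} (hmn : m ≤ n) (h : Chain f n x y a) : Chain f m x y a := by
  induction h with
  | refl h => exact .refl fun i hi => h i (hi.trans_le hmn)
  | step hx hz ha _ ih =>
    exact .step (fun i hi => hx i (hi.trans_le hmn)) (fun i hi => hz i (hi.trans_le hmn))
      (fun i hi => ha i (hi.trans_le hmn)) ih

theorem congr {x' y' : ℕ → Bool} {a' : ℕ → ℕ} (h : Chain f n x y a) (hx : ∀ i < n, x i = x' i)
    (hy : ∀ i < n, y i = y' i) (ha : ∀ i < n, a i ≤ a' i) : Chain f n x' y' a' := by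
  induction h generalizing x' a' with
  | refl h => exact .refl fun i hi => (hx i hi).symm.trans ((h i hi).trans (hy i hi))
  | step hx' hz ha' _ ih =>
    exact .step (fun i hi => (hx' i hi).trans (hx i hi)) hz
      (fun i hi => (ha' i hi).trans (ha i hi)) (ih (fun _ _ => rfl) hy fun _ _ => le_rfl)

/-- Chains can be concatenated, and their bounds add up. -/
theorem trans {z : ℕ → Bool} {b : ℕ → ℕ} (h : Chain f n x y a) (h' : Chain f n y z b) :
    Chain f n x z (a + b) := by
  induction h with
  | refl h =>
    exact h'.congr (fun i hi => (h i hi).symm) (fun _ _ => rfl) fun i _ => Nat.le_add_left _ _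
  | step hx hz ha _ ih =>
    refine .step hx hz (fun i hi => ?_) (ih h')
    have := ha i hi
    simp only [Pi.add_apply]
    omega

/-- A bounded sequence of natural numbers is constant along an ultrafilter. -/
theorem exists_eventually_eq_of_le {ι : Type*} (U : Ultrafilter ι) {h : ι → ℕ} {B : ℕ}
    (hB : ∀ᶠ i in U, h i ≤ B) : ∃ k, ∀ᶠ i in U, h i = k := by
  have h1 : ∀ᶠ i in U, ∃ k ∈ Set.Iic B, h i = k := hB.mono fun i hi => ⟨_, hi, rfl⟩
  obtain ⟨k, -, hk⟩ := (Ultrafilter.eventually_exists_mem_iff (Set.finite_Iic B)).1 h1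
  exact ⟨k, hk⟩

/-- If `x` and `y` are joined by chains with a common bound `a` up to every precision, then they are
joined by a chain: its points are limits along an ultrafilter, which exist by the bound. The number
of points is at most `a 0`. -/
theorem eq_or_mem_range (hf : Continuous f)
    (htrans : ∀ x y z, (x, y) ∈ Set.range f → (y, z) ∈ Set.range f → (x, z) ∈ Set.range f)
    (h : ∀ n, Chain f n x y a) : x = y ∨ (x, y) ∈ Set.range f := by
  induction hk : a 0 using Nat.strong_induction_on generalizing x a with
  | _ k ih =>
  let U : Ultrafilter ℕ := hyperfilter ℕ
  have hlarge : ∀ m : ℕ, ∀ᶠ n in (U : Filter ℕ), m < n := fun m =>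
    (eventually_gt_atTop m).filter_mono Nat.hyperfilter_le_atTop
  have hcases : ∀ n, (∀ i < n, x i = y i) ∨ ∃ (z : ℕ → Bool) (c γ : ℕ → ℕ),
      (∀ i < n, (f γ).1 i = x i) ∧ (∀ i < n, (f γ).2 i = z i) ∧ (∀ i < n, γ i + 1 + c i ≤ a i) ∧
      Chain f n z y c := by
    intro n
    cases h n with
    | refl h => exact Or.inl h
    | step hx hz ha h => exact Or.inr ⟨_, _, _, hx, hz, ha, h⟩
  by_cases hU : ∀ᶠ n in U, ∀ i < n, x i = y i
  · left
    funext i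
    obtain ⟨n, hn, hi⟩ := (hU.and (hlarge i)).exists
    exact hn i hi
  -- otherwise the chains have a first point `γ n` for almost all `n`, leading from `x` to `z n`
  rw [← Ultrafilter.eventually_not] at hU
  have hex : ∀ n, ∃ (z : ℕ → Bool) (c γ : ℕ → ℕ), (¬ ∀ i < n, x i = y i) →
      (∀ i < n, (f γ).1 i = x i) ∧ (∀ i < n, (f γ).2 i = z i) ∧ (∀ i < n, γ i + 1 + c i ≤ a i) ∧
      Chain f n z y c := by
    intro n
    rcases hcases n with h1 | ⟨z, c, γ, h1⟩
    · exact ⟨x, a, a, fun h2 => absurd h1 h2⟩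
    · exact ⟨z, c, γ, fun _ => h1⟩
  choose z c γ hdata using hex
  replace hdata := hU.mono hdata
  -- the limits of the three sequences
  have hz' : ∀ i, ∃ k, ∀ᶠ n in U, z n i = k := fun i =>
    Ultrafilter.eventually_exists_iff.1 (Eventually.of_forall fun n => ⟨z n i, rfl⟩)
  have hc' : ∀ i, ∃ k, ∀ᶠ n in U, c n i = k := fun i =>
    exists_eventually_eq_of_le U (B := a i) ((hdata.and (hlarge i)).mono fun n hn => by
      have := hn.1.2.2.1 i hn.2
      omega)
  have hγ' : ∀ i, ∃ k, ∀ᶠ n in U, γ n i = k := fun i =>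
    exists_eventually_eq_of_le U (B := a i) ((hdata.and (hlarge i)).mono fun n hn => by
      have := hn.1.2.2.1 i hn.2
      omega)
  choose z' hz' using hz'
  choose c' hc' using hc'
  choose γ' hγ' using hγ'
  have hlim : Tendsto (fun n => f (γ n)) U (𝓝 (f γ')) := by
    refine (hf.tendsto γ').comp (tendsto_pi_nhds.2 fun i => ?_)
    exact tendsto_const_nhds.congr' ((hγ' i).mono fun n hn => hn.symm)
  have h1 : ∀ i, ∀ᶠ n in U, (f (γ n)).1 i = (f γ').1 i := fun i => by
    have h := ((continuous_apply i).comp continuous_fst).continuousAt.tendsto.comp hlim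
    rw [nhds_discrete] at h
    exact tendsto_pure.1 h
  have h2 : ∀ i, ∀ᶠ n in U, (f (γ n)).2 i = (f γ').2 i := fun i => by
    have h := ((continuous_apply i).comp continuous_snd).continuousAt.tendsto.comp hlim
    rw [nhds_discrete] at h
    exact tendsto_pure.1 h
  have hfγ : f γ' = (x, z') := by
    refine Prod.ext (funext fun i => ?_) (funext fun i => ?_)
    · obtain ⟨n, ⟨hn1, hn2⟩, hn3⟩ := ((hdata.and (hlarge i)).and (h1 i)).exists
      exact hn3.symm.trans (hn1.1 i hn2)
    · obtain ⟨n, ⟨⟨hn1, hn2⟩, hn3⟩, hn4⟩ := (((hdata.and (hlarge i)).and (h2 i)).and (hz' i)).exists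
      exact hn3.symm.trans ((hn1.2.1 i hn2).trans hn4)
  have hchain : ∀ m, Chain f m z' y c' := by
    intro m
    have e1 : ∀ᶠ n in U, ∀ i ∈ Set.Iio m, z n i = z' i :=
      (eventually_all_finite (Set.finite_Iio m)).2 fun i _ => hz' i
    have e2 : ∀ᶠ n in U, ∀ i ∈ Set.Iio m, c n i = c' i :=
      (eventually_all_finite (Set.finite_Iio m)).2 fun i _ => hc' i
    obtain ⟨n, ⟨⟨hn1, hn2⟩, hn3⟩, hn4⟩ := (((hdata.and (hlarge m)).and e1).and e2).exists
    exact (hn1.2.2.2.mono hn2.le).congr hn3 (fun _ _ => rfl) fun i hi => (hn4 i hi).le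
  have hlt : c' 0 < k := by
    obtain ⟨n, ⟨hn1, hn2⟩, hn3⟩ := ((hdata.and (hlarge 0)).and (hc' 0)).exists
    have := hn1.2.2.1 0 hn2
    omega
  right
  rcases ih _ hlt hchain rfl with rfl | hR
  · exact ⟨γ', hfγ⟩
  · exact htrans x z' y ⟨γ', hfγ⟩ hR

end Chain

/-- The relation given by the range of a continuous map, if transitive, is the intersection of its
finite approximations. -/
theorem exists_forall_chain_iff {f : (ℕ → ℕ) → (ℕ → Bool) × (ℕ → Bool)} (hf : Continuous f)
    (htrans : ∀ x y z, (x, y) ∈ Set.range f → (y, z) ∈ Set.range f → (x, z) ∈ Set.range f)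
    {x y : ℕ → Bool} :
    (∃ a, ∀ n, Chain f n x y a) ↔ x = y ∨ (x, y) ∈ Set.range f := by
  constructor
  · rintro ⟨a, ha⟩
    exact Chain.eq_or_mem_range hf htrans ha
  · rintro (rfl | ⟨γ, hγ⟩)
    · exact ⟨0, fun n => .refl fun _ _ => rfl⟩
    · refine ⟨γ + 1, fun n => .step (z := y) (c := 0) (γ := γ) ?_ ?_ ?_ (.refl fun _ _ => rfl)⟩
      all_goals simp [hγ]

end Chain

/-! ### Trees given by a parent function -/

section ParentGraph
variable {V : Type*}

/-- The graph in which each vertex is joined to its parent. -/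
def parentGraph (parent : V → Option V) (rank : V → ℕ)
    (h : ∀ v w, parent v = some w → rank v = rank w + 1) : SimpleGraph V where
  Adj v w := parent v = some w ∨ parent w = some v
  symm := ⟨fun _ _ h => h.symm⟩
  loopless := ⟨fun v hv => by
    have := h v v (hv.elim id id)
    omega⟩

variable {parent : V → Option V} {rank : V → ℕ}
  {h : ∀ v w, parent v = some w → rank v = rank w + 1}

/-- A graph of vertices and parents is acyclic, as both neighbours in a cycle of a vertex of maximal
rank would be its parent. -/
theorem isAcyclic_comap_parentGraph {W : Type*} (b : W ↪ V) :
    ((parentGraph parent rank h).comap b).IsAcyclic := by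
  rw [SimpleGraph.isAcyclic_iff_free_cycleGraph]
  rintro n hn ⟨c⟩
  obtain ⟨n, rfl⟩ := Nat.exists_eq_add_of_le' hn
  obtain ⟨i, hi⟩ := Finite.exists_max fun i => rank (b (c i))
  have hpar : ∀ j, (SimpleGraph.cycleGraph (n + 3)).Adj i j → parent (b (c i)) = some (b (c j)) := by
    intro j hij
    rcases c.toHom.map_rel hij with h1 | h1
    · exact h1
    · have h2 := h _ _ h1
      have h3 := hi j
      simp only [SimpleGraph.Copy.toHom_apply] at h2
      omega
  have h1 := hpar (i + 1) (by rw [SimpleGraph.cycleGraph_adj]; right; simp)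
  have h2 := hpar (i - 1) (by rw [SimpleGraph.cycleGraph_adj]; left; simp)
  have h3 := c.injective (b.injective (Option.some_injective _ (h1.symm.trans h2)))
  have h4 : (1 + 1 : Fin (n + 3)) = 0 :=
    calc (1 + 1 : Fin (n + 3)) = i + 1 - (i - 1) := by abel
      _ = 0 := sub_eq_zero.2 h3
  have h5 := congrArg Fin.val h4
  rw [Fin.val_add, Fin.val_one, Fin.val_zero, Nat.mod_eq_of_lt (by omega)] at h5
  omega

/-- If a set of vertices is closed under taking parents and has only one vertex without a parent,
then the graph of vertices and parents in this set is a tree. -/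
theorem isTree_comap_parentGraph {W : Type*} (b : W ↪ V) (root : W)
    (hroot : ∀ v, parent (b v) = none → v = root)
    (hclosed : ∀ v w, parent (b v) = some w → ∃ w', b w' = w) :
    ((parentGraph parent rank h).comap b).IsTree := by
  refine ⟨?_, isAcyclic_comap_parentGraph b⟩
  have hreach : ∀ n v, rank (b v) = n → ((parentGraph parent rank h).comap b).Reachable v root := by
    intro n
    induction n with
    | zero =>
      intro v hv
      cases hp : parent (b v) with
      | none => rw [hroot v hp]
      | some w =>
        have := h _ _ hp
        omega
    | succ n ih =>
      intro v hv
      cases hp : parent (b v) with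
      | none => rw [hroot v hp]
      | some w =>
        obtain ⟨w, rfl⟩ := hclosed v w hp
        have h1 := h _ _ hp
        have hadj : ((parentGraph parent rank h).comap b).Adj v w := Or.inl hp
        exact hadj.reachable.trans (ih w (by omega))
  have : Nonempty W := ⟨root⟩
  exact ⟨fun v w => (hreach _ v rfl).trans (hreach _ w rfl).symm⟩

end ParentGraph

/-! ### The tree of approximations of a point -/

/-- The vertices of the trees that are used to reduce an analytic quasi-order. A finite sequence of
natural numbers is represented by the list of its terms in reverse order. -/
inductive Node
  /-- The vertex of the finite sequence `s`, with infinitely many neighbours. -/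
  | seq (s : List ℕ)
  /-- The vertex between the sequence `s` and its extension by `k`. -/
  | mid (s : List ℕ) (k : ℕ)
  /-- The `i`-th vertex of the path that is attached to `s` as a part of the gadget with label `θ`.
  -/
  | path (s : List ℕ) (θ i : ℕ)
  /-- The leaf attached to the first vertex of the path of a gadget. -/
  | leaf (s : List ℕ) (θ : ℕ)
  /-- The leaf attached to the vertex `θ + 1` of the path of the gadget with label `θ`. -/
  | leaf' (s : List ℕ) (θ : ℕ)

namespace Node

/-- The parent of a vertex. -/
def parent : Node → Option Node
  | seq [] => none
  | seq (k :: s) => some (mid s k)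
  | mid s _ => some (seq s)
  | path s _ 0 => some (seq s)
  | path s θ (i + 1) => some (path s θ i)
  | leaf s θ => some (path s θ 0)
  | leaf' s θ => some (path s θ (θ + 1))

/-- The distance of a vertex to the root. -/
def rank : Node → ℕ
  | seq s => 2 * s.length
  | mid s _ => 2 * s.length + 1
  | path s _ i => 2 * s.length + i + 1
  | leaf s _ => 2 * s.length + 2
  | leaf' s θ => 2 * s.length + θ + 3

theorem rank_eq_of_parent (v w : Node) (h : parent v = some w) : rank v = rank w + 1 := by
  rcases v with (_ | ⟨k, s⟩) | ⟨s, k⟩ | ⟨s, θ, _ | i⟩ | ⟨s, θ⟩ | ⟨s, θ⟩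
  · exact absurd h (by simp [parent])
  all_goals
    obtain rfl := Option.some_injective _ h
    simp [rank] <;> omega

/-- The graph on all the vertices. -/
def graph : SimpleGraph Node := parentGraph parent rank rank_eq_of_parent

theorem graph_adj {v w : Node} : graph.Adj v w ↔ parent v = some w ∨ parent w = some v := Iff.rfl

theorem parent_eq_seq {v : Node} {s : List ℕ} (h : parent v = some (seq s)) :
    (∃ k, v = mid s k) ∨ ∃ θ, v = path s θ 0 := by
  rcases v with (_ | ⟨k, t⟩) | ⟨t, k⟩ | ⟨t, θ, _ | i⟩ | ⟨t, θ⟩ | ⟨t, θ⟩ <;> simp_all [parent]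

theorem parent_eq_mid {v : Node} {s : List ℕ} {k : ℕ} (h : parent v = some (mid s k)) :
    v = seq (k :: s) := by
  rcases v with (_ | ⟨k, t⟩) | ⟨t, k⟩ | ⟨t, θ, _ | i⟩ | ⟨t, θ⟩ | ⟨t, θ⟩ <;> simp_all [parent]

theorem parent_eq_path {v : Node} {s : List ℕ} {θ i : ℕ} (h : parent v = some (path s θ i)) :
    v = path s θ (i + 1) ∨ (i = 0 ∧ v = leaf s θ) ∨ (i = θ + 1 ∧ v = leaf' s θ) := by
  rcases v with (_ | ⟨k, t⟩) | ⟨t, k⟩ | ⟨t, θ', _ | j⟩ | ⟨t, θ'⟩ | ⟨t, θ'⟩ <;>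
    simp [parent] at h <;> obtain ⟨rfl, rfl, h⟩ := h <;> simp_all

theorem not_parent_eq_leaf {v : Node} {s : List ℕ} {θ : ℕ} : parent v ≠ some (leaf s θ) := by
  rcases v with (_ | ⟨k, t⟩) | ⟨t, k⟩ | ⟨t, θ', _ | j⟩ | ⟨t, θ'⟩ | ⟨t, θ'⟩ <;> simp [parent]

theorem not_parent_eq_leaf' {v : Node} {s : List ℕ} {θ : ℕ} : parent v ≠ some (leaf' s θ) := by
  rcases v with (_ | ⟨k, t⟩) | ⟨t, k⟩ | ⟨t, θ', _ | j⟩ | ⟨t, θ'⟩ | ⟨t, θ'⟩ <;> simp [parent]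

theorem adj_mid {v : Node} {s : List ℕ} {k : ℕ} (h : graph.Adj (mid s k) v) :
    v = seq s ∨ v = seq (k :: s) := by
  rcases h with h | h
  · exact Or.inl (Option.some_injective _ h).symm
  · exact Or.inr (parent_eq_mid h)

theorem adj_leaf {v : Node} {s : List ℕ} {θ : ℕ} (h : graph.Adj (leaf s θ) v) :
    v = path s θ 0 := by
  rcases h with h | h
  · exact (Option.some_injective _ h).symm
  · exact absurd h not_parent_eq_leaf

theorem adj_leaf' {v : Node} {s : List ℕ} {θ : ℕ} (h : graph.Adj (leaf' s θ) v) :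
    v = path s θ (θ + 1) := by
  rcases h with h | h
  · exact (Option.some_injective _ h).symm
  · exact absurd h not_parent_eq_leaf'

theorem adj_path_zero {v : Node} {s : List ℕ} {θ : ℕ} (h : graph.Adj (path s θ 0) v) :
    v = seq s ∨ v = path s θ 1 ∨ v = leaf s θ := by
  rcases h with h | h
  · exact Or.inl (Option.some_injective _ h).symm
  · rcases parent_eq_path h with h | ⟨-, h⟩ | ⟨h, -⟩
    · exact Or.inr (Or.inl h)
    · exact Or.inr (Or.inr h)
    · omega

theorem adj_path_succ {v : Node} {s : List ℕ} {θ i : ℕ} (h : graph.Adj (path s θ (i + 1)) v) :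
    v = path s θ i ∨ v = path s θ (i + 2) ∨ (i = θ ∧ v = leaf' s θ) := by
  rcases h with h | h
  · exact Or.inl (Option.some_injective _ h).symm
  · rcases parent_eq_path h with h | ⟨h, -⟩ | ⟨h, h'⟩
    · exact Or.inr (Or.inl h)
    · omega
    · exact Or.inr (Or.inr ⟨by omega, h'⟩)

theorem adj_seq {v : Node} {s : List ℕ} (h : graph.Adj (seq s) v) :
    (∃ t k, v = mid t k) ∨ ∃ θ, v = path s θ 0 := by
  rcases h with h | h
  · rcases s with _ | ⟨k, s⟩
    · exact absurd h (by simp [parent])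
    · exact Or.inl ⟨s, k, (Option.some_injective _ h).symm⟩
  · rcases parent_eq_seq h with ⟨k, h⟩ | h
    · exact Or.inl ⟨s, k, h⟩
    · exact Or.inr h

/-- Only the vertices `seq s` have infinitely many neighbours. -/
theorem exists_eq_seq_of_infinite {v : Node} {A : Set Node} (hA : A.Infinite)
    (h : ∀ w ∈ A, graph.Adj v w) : ∃ s, v = seq s := by
  have hfin : ∀ B : Finset Node, (∀ w ∈ A, w ∈ B) → False := fun B hB =>
    hA (B.finite_toSet.subset hB)
  classical
  rcases v with s | ⟨s, k⟩ | ⟨s, θ, _ | i⟩ | ⟨s, θ⟩ | ⟨s, θ⟩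
  · exact ⟨s, rfl⟩
  · exact (hfin {seq s, seq (k :: s)} fun w hw => by simpa using adj_mid (h w hw)).elim
  · exact (hfin {seq s, path s θ 1, leaf s θ} fun w hw => by
      simpa using adj_path_zero (h w hw)).elim
  · refine (hfin {path s θ i, path s θ (i + 2), leaf' s θ} fun w hw => ?_).elim
    rcases adj_path_succ (h w hw) with h | h | ⟨-, h⟩ <;> simp [h]
  · exact (hfin {path s θ 0} fun w hw => by simpa using adj_leaf (h w hw)).elim
  · exact (hfin {path s θ (θ + 1)} fun w hw => by simpa using adj_leaf' (h w hw)).elim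

/-- The part of the graph whose gadgets are those given by `P`: the gadget with label `θ` is
attached to the sequence `s` if `P s θ`. -/
def Valid (P : List ℕ → ℕ → Prop) : Node → Prop
  | seq _ => True
  | mid _ _ => True
  | path s θ i => P s θ ∧ i ≤ θ + 2
  | leaf s θ => P s θ
  | leaf' s θ => P s θ

variable {P Q : List ℕ → ℕ → Prop}

theorem Valid.parent {v w : Node} (hv : Valid P v) (h : parent v = some w) : Valid P w := by
  rcases v with (_ | ⟨k, s⟩) | ⟨s, k⟩ | ⟨s, θ, _ | i⟩ | ⟨s, θ⟩ | ⟨s, θ⟩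
  · exact absurd h (by simp [Node.parent])
  all_goals
    obtain rfl := Option.some_injective _ h
    simp only [Valid] at *
  · exact ⟨hv.1, by omega⟩
  · exact ⟨hv, by omega⟩
  · exact ⟨hv, by omega⟩

/-- An embedding of the parts of the graph given by `P` and `Q`. -/
structure IsEmbedding (P Q : List ℕ → ℕ → Prop) (F : Node → Node) : Prop where
  valid : ∀ v, Valid P v → Valid Q (F v)
  inj : ∀ v w, Valid P v → Valid P w → F v = F w → v = w
  adj : ∀ v w, Valid P v → Valid P w → graph.Adj v w → graph.Adj (F v) (F w)

namespace IsEmbedding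
variable {F : Node → Node} (hF : IsEmbedding P Q F)
include hF

theorem ne {v w : Node} (hv : Valid P v) (hw : Valid P w) (h : v ≠ w) : F v ≠ F w :=
  fun h' => h (hF.inj v w hv hw h')

theorem exists_seq (s : List ℕ) : ∃ s', F (seq s) = seq s' := by
  refine exists_eq_seq_of_infinite (A := Set.range fun k => F (mid s k)) ?_ ?_
  · refine Set.infinite_range_of_injective fun k l hkl => ?_
    have := hF.inj (mid s k) (mid s l) trivial trivial hkl
    exact (Node.mid.inj this).2
  · rintro _ ⟨k, rfl⟩
    exact hF.adj _ _ trivial trivial (Or.inr rfl)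

/-- Consecutive sequences are mapped to consecutive sequences, in one of the two orders. -/
theorem cons_or_cons {s s' s'' : List ℕ} {k : ℕ} (h1 : F (seq s) = seq s')
    (h2 : F (seq (k :: s)) = seq s'') : (∃ j, s'' = j :: s') ∨ ∃ j, s' = j :: s'' := by
  have a1 : graph.Adj (seq s') (F (mid s k)) := h1 ▸ hF.adj _ _ trivial trivial (Or.inr rfl)
  have a2 : graph.Adj (F (mid s k)) (seq s'') := h2 ▸ hF.adj _ _ trivial trivial (Or.inr rfl)
  have hne : seq s' ≠ seq s'' := h1 ▸ h2 ▸ hF.ne trivial trivial (by simp)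
  rcases adj_seq a1 with ⟨t, j, h⟩ | ⟨θ, h⟩
  · rw [h] at a1 a2
    rcases adj_mid a1.symm with b1 | b1 <;> rcases adj_mid a2 with b2 | b2
    · exact absurd (b1.trans b2.symm) hne
    · rw [seq.injEq] at b1 b2
      exact Or.inl ⟨j, by rw [b1, b2]⟩
    · rw [seq.injEq] at b1 b2
      exact Or.inr ⟨j, by rw [b1, b2]⟩
    · exact absurd (b1.trans b2.symm) hne
  · rw [h] at a2
    rcases adj_path_zero a2 with h | h | h
    · exact absurd h.symm hne
    · simp at h
    · simp at h

/-- A gadget is mapped to a gadget with the same label. This is because the distance of the two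
vertices of degree three in a gadget determines its label. -/
theorem label_eq {s s' : List ℕ} {θ : ℕ} (hθ : P s θ) (h1 : F (seq s) = seq s') : Q s' θ := by
  have vp : ∀ i ≤ θ + 2, Valid P (path s θ i) := fun i hi => ⟨hθ, hi⟩
  have v0 := vp 0 (by omega)
  have vl : Valid P (leaf s θ) := hθ
  have vl' : Valid P (leaf' s θ) := hθ
  have adjp : ∀ i, i + 1 ≤ θ + 2 → graph.Adj (F (path s θ i)) (F (path s θ (i + 1))) :=
    fun i hi => hF.adj _ _ (vp i (by omega)) (vp _ hi) (Or.inr rfl)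
  -- the first vertex of the path has three neighbours, so it is not mapped to a vertex `mid`
  obtain ⟨θ', h0⟩ : ∃ θ', F (path s θ 0) = path s' θ' 0 := by
    have a1 : graph.Adj (seq s') (F (path s θ 0)) := h1 ▸ hF.adj _ _ trivial v0 (Or.inr rfl)
    rcases adj_seq a1 with ⟨t, j, h⟩ | h
    · exfalso
      have a2 := adjp 0 (by omega)
      have a3 := hF.adj _ _ v0 vl (Or.inr rfl)
      have n1 := h1 ▸ hF.ne trivial (vp 1 (by omega)) (v := seq s) (by simp)
      have n2 := h1 ▸ hF.ne trivial vl (v := seq s) (by simp)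
      have n3 := hF.ne (vp 1 (by omega)) vl (by simp)
      rw [h] at a1 a2 a3
      rcases adj_mid a1.symm with b1 | b1 <;> rcases adj_mid a2 with b2 | b2 <;>
        rcases adj_mid a3 with b3 | b3 <;> simp_all
    · exact h
  -- the path cannot leave the image path through a leaf, as it continues
  have hpath : ∀ i ≤ θ, F (path s θ i) = path s' θ' i ∧ F (path s θ (i + 1)) = path s' θ' (i + 1) := by
    intro i hi
    induction i with
    | zero =>
      refine ⟨h0, ?_⟩
      have a1 := adjp 0 (by omega)
      have a2 := adjp 1 (by omega)
      have n1 := h1 ▸ hF.ne trivial (vp 1 (by omega)) (v := seq s) (by simp)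
      have n2 := hF.ne v0 (vp 2 (by omega)) (by simp)
      rw [h0] at a1 n2
      rcases adj_path_zero a1 with b | b | b
      · exact absurd b.symm n1
      · exact b
      · rw [zero_add] at b
        rw [b] at a2
        exact absurd (adj_leaf a2).symm n2
    | succ i ih =>
      obtain ⟨e1, e2⟩ := ih (by omega)
      refine ⟨e2, ?_⟩
      have a1 := adjp (i + 1) (by omega)
      have a2 := adjp (i + 2) (by omega)
      have n1 := hF.ne (vp i (by omega)) (vp (i + 2) (by omega)) (by simp)
      have n2 := hF.ne (vp (i + 1) (by omega)) (vp (i + 3) (by omega)) (by simp)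
      rw [e2] at a1 n2
      rw [e1] at n1
      rcases adj_path_succ a1 with b | b | ⟨rfl, b⟩
      · exact absurd b.symm n1
      · exact b
      · rw [b] at a2
        exact absurd (adj_leaf' a2).symm n2
  -- the vertex `θ + 1` has three neighbours, so its image is the branching vertex `θ' + 1`
  obtain ⟨e1, e2⟩ := hpath θ le_rfl
  have hQ : Q s' θ' := by
    have := hF.valid _ v0
    rw [h0] at this
    exact this.1
  have a1 := adjp (θ + 1) le_rfl
  have a2 := hF.adj _ _ (vp (θ + 1) (by omega)) vl' (Or.inr rfl)
  have n1 := hF.ne (vp θ (by omega)) (vp (θ + 2) le_rfl) (by simp)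
  have n2 := hF.ne (vp θ (by omega)) vl' (by simp)
  have n3 := hF.ne (vp (θ + 2) le_rfl) vl' (by simp)
  rw [e2] at a1 a2
  rw [e1] at n1 n2
  rcases adj_path_succ a1 with b | b | ⟨b, -⟩
  · exact absurd b.symm n1
  · rcases adj_path_succ a2 with b' | b' | ⟨b', -⟩
    · exact absurd b'.symm n2
    · exact absurd (b.trans b'.symm) n3
    · rwa [b']
  · rwa [b]

end IsEmbedding

/-- The termwise sum of a finite sequence with `a`. -/
def shift (a : ℕ → ℕ) : List ℕ → List ℕ
  | [] => []
  | k :: s => (k + a s.length) :: shift a s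

theorem length_shift (a : ℕ → ℕ) (s : List ℕ) : (shift a s).length = s.length := by
  induction s with
  | nil => rfl
  | cons k s ih => simp [shift, ih]

theorem shift_injective (a : ℕ → ℕ) : Function.Injective (shift a) := by
  intro s t h
  induction s generalizing t with
  | nil =>
    cases t with
    | nil => rfl
    | cons l t => simp [shift] at h
  | cons k s ih =>
    cases t with
    | nil => simp [shift] at h
    | cons l t =>
      simp only [shift, List.cons.injEq] at h
      obtain rfl := ih h.2
      simpa using h.1

/-- The map on the vertices induced by adding `a` to the sequences. -/
def shiftNode (a : ℕ → ℕ) : Node → Node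
  | seq s => seq (shift a s)
  | mid s k => mid (shift a s) (k + a s.length)
  | path s θ i => path (shift a s) θ i
  | leaf s θ => leaf (shift a s) θ
  | leaf' s θ => leaf' (shift a s) θ

theorem parent_shiftNode (a : ℕ → ℕ) (v : Node) :
    parent (shiftNode a v) = (parent v).map (shiftNode a) := by
  rcases v with (_ | ⟨k, s⟩) | ⟨s, k⟩ | ⟨s, θ, _ | i⟩ | ⟨s, θ⟩ | ⟨s, θ⟩ <;> rfl

theorem shiftNode_injective (a : ℕ → ℕ) : Function.Injective (shiftNode a) := by
  intro v w h
  rcases v with s | ⟨s, k⟩ | ⟨s, θ, i⟩ | ⟨s, θ⟩ | ⟨s, θ⟩ <;>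
    rcases w with t | ⟨t, l⟩ | ⟨t, θ', j⟩ | ⟨t, θ'⟩ | ⟨t, θ'⟩ <;>
    simp only [shiftNode, seq.injEq, mid.injEq, path.injEq, leaf.injEq, leaf'.injEq,
      reduceCtorEq] at h
  · rw [shift_injective a h]
  · obtain rfl := shift_injective a h.1
    rw [Nat.add_right_cancel h.2]
  · rw [shift_injective a h.1, h.2.1, h.2.2]
  · rw [shift_injective a h.1, h.2]
  · rw [shift_injective a h.1, h.2]

theorem isEmbedding_shiftNode {a : ℕ → ℕ} (h : ∀ s θ, P s θ → Q (shift a s) θ) :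
    IsEmbedding P Q (shiftNode a) where
  valid v hv := by
    rcases v with s | ⟨s, k⟩ | ⟨s, θ, i⟩ | ⟨s, θ⟩ | ⟨s, θ⟩
    · trivial
    · trivial
    · exact ⟨h s θ hv.1, hv.2⟩
    · exact h s θ hv
    · exact h s θ hv
  inj v w _ _ hvw := shiftNode_injective a hvw
  adj v w _ _ hvw := by
    rw [graph_adj, parent_shiftNode, parent_shiftNode]
    exact hvw.imp (fun h => by rw [h]; rfl) fun h => by rw [h]; rfl

end Node

/-! ### Embeddability of trees is complete -/

section Reduction
open Node

/-- The infinite sequence that extends the finite sequence `s` by zeros. -/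
def seqFun (s : List ℕ) (i : ℕ) : ℕ := s.reverse.getD i 0

theorem seqFun_cons_of_lt {s : List ℕ} {i : ℕ} (k : ℕ) (hi : i < s.length) :
    seqFun (k :: s) i = seqFun s i := by
  rw [seqFun, seqFun, List.reverse_cons, List.getD_append _ _ _ _ (by simpa using hi)]

theorem seqFun_cons_length (k : ℕ) (s : List ℕ) : seqFun (k :: s) s.length = k := by
  rw [seqFun, List.reverse_cons, List.getD_append_right _ _ _ _ (by simp)]
  simp

theorem seqFun_shift (a : ℕ → ℕ) (s : List ℕ) {i : ℕ} (hi : i < s.length) :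
    seqFun (shift a s) i = seqFun s i + a i := by
  induction s with
  | nil => exact absurd hi (Nat.not_lt_zero i)
  | cons k s ih =>
    rcases Nat.lt_succ_iff_lt_or_eq.1 (List.length_cons ▸ hi) with hi | rfl
    · rw [shift, seqFun_cons_of_lt _ (by rwa [length_shift]), seqFun_cons_of_lt _ hi, ih hi]
    · rw [shift, seqFun_cons_length]
      have := seqFun_cons_length (k + a s.length) (shift a s)
      rwa [length_shift] at this

/-- A natural number that codes the first `n` terms of `u`. -/
def label (n : ℕ) (u : ℕ → Bool) : ℕ := Encodable.encode (List.ofFn fun i : Fin n => u i)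

theorem eq_of_label_eq {n m : ℕ} {u x : ℕ → Bool} (h : label n u = label m x) :
    n = m ∧ ∀ i < n, u i = x i := by
  have h1 := Encodable.encode_injective h
  have h2 : n = m := by simpa using congrArg List.length h1
  subst h2
  exact ⟨rfl, fun i hi => congrFun (List.ofFn_injective h1) ⟨i, hi⟩⟩

variable (f : (ℕ → ℕ) → (ℕ → Bool) × (ℕ → Bool))

/-- The gadgets in the tree of `x`: there is one at the finite sequence `s`, of length `n`, for each
sequence `u` that is joined to `x` by a chain with bound `s`, as far as `n` terms can tell, and it
is labelled by the first `n` terms of `u`. -/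
def Gadget (x : ℕ → Bool) (s : List ℕ) (θ : ℕ) : Prop :=
  ∃ u, θ = label s.length u ∧ Chain f s.length u x (seqFun s)

variable {f}

/-- Adding a bound `a` to the finite sequences is an embedding of the tree of `x` in that of `y`, as
chains from `u` to `x` can be continued to `y`. -/
theorem isEmbedding_shiftNode_of_chain {x y : ℕ → Bool} {a : ℕ → ℕ} (ha : ∀ n, Chain f n x y a) :
    IsEmbedding (Gadget f x) (Gadget f y) (shiftNode a) := by
  refine isEmbedding_shiftNode fun s θ => ?_
  rintro ⟨u, rfl, hu⟩
  refine ⟨u, by rw [length_shift], ?_⟩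
  rw [length_shift]
  exact (hu.trans (ha s.length)).congr (fun _ _ => rfl) (fun _ _ => rfl)
    fun i hi => (seqFun_shift a s hi).ge

/-- The sequences of zeros have to be mapped to initial segments of one sequence, as an embedding
preserves the labels of the gadgets, which determine the length; this sequence is a bound. -/
theorem exists_forall_chain_of_isEmbedding {x y : ℕ → Bool} {F : Node → Node}
    (hF : IsEmbedding (Gadget f x) (Gadget f y) F) : ∃ a, ∀ n, Chain f n x y a := by
  choose s hs using fun n : ℕ => hF.exists_seq (List.replicate n 0)
  have hgad : ∀ n, (s n).length = n ∧ Chain f n x y (seqFun (s n)) := by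
    intro n
    -- the gadget given by the trivial chain from `x` to `x`
    have h1 : Gadget f x (List.replicate n 0) (label n x) :=
      ⟨x, by rw [List.length_replicate], .refl fun _ _ => rfl⟩
    obtain ⟨u, hu, hc⟩ := hF.label_eq h1 (hs n)
    obtain ⟨hn, hxu⟩ := eq_of_label_eq hu
    refine ⟨hn.symm, ?_⟩
    rw [← hn] at hc
    exact hc.congr (fun i hi => (hxu i hi).symm) (fun _ _ => rfl) fun _ _ => le_rfl
  have hcons : ∀ n, ∃ j, s (n + 1) = j :: s n := by
    intro n
    have h1 := hs (n + 1)
    rw [List.replicate_succ] at h1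
    rcases hF.cons_or_cons (hs n) h1 with h | ⟨j, h⟩
    · exact h
    · have := congrArg List.length h
      rw [List.length_cons, (hgad n).1, (hgad (n + 1)).1] at this
      omega
  choose a ha using hcons
  have hval : ∀ n, ∀ i < n, seqFun (s n) i = a i := by
    intro n
    induction n with
    | zero => exact fun i hi => absurd hi (Nat.not_lt_zero i)
    | succ n ih =>
      intro i hi
      rw [ha n]
      rcases Nat.lt_succ_iff_lt_or_eq.1 hi with hi | rfl
      · rw [seqFun_cons_of_lt _ (by rwa [(hgad n).1]), ih i hi]
      · have := seqFun_cons_length (a i) (s i)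
        rwa [(hgad i).1] at this
  exact ⟨a, fun n => (hgad n).2.congr (fun _ _ => rfl) (fun _ _ => rfl)
    fun i hi => (hval n i hi).le⟩

instance instCountableNode : Countable Node := by
  let c : Node → List ℕ × ℕ × ℕ × ℕ := fun v => match v with
    | seq s => (s, 0, 0, 0)
    | mid s k => (s, 1, k, 0)
    | path s θ i => (s, 2, θ, i)
    | leaf s θ => (s, 3, θ, 0)
    | leaf' s θ => (s, 4, θ, 0)
  refine Function.Injective.countable (f := c) fun v w h => ?_
  rcases v with s | ⟨s, k⟩ | ⟨s, θ, i⟩ | ⟨s, θ⟩ | ⟨s, θ⟩ <;>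
    rcases w with t | ⟨t, l⟩ | ⟨t, θ', j⟩ | ⟨t, θ'⟩ | ⟨t, θ'⟩ <;> simp_all [c]

/-- A condition on the first `n` terms of a binary sequence is Borel. -/
theorem measurableSet_of_forall_lt {P : (ℕ → Bool) → Prop} (n : ℕ)
    (h : ∀ x y : ℕ → Bool, (∀ i < n, x i = y i) → P x → P y) : MeasurableSet {x | P x} := by
  let r : (ℕ → Bool) → (Fin n → Bool) := fun x i => x i
  have hr : Measurable r := measurable_pi_iff.2 fun i => measurable_pi_apply _
  have : {x | P x} = r ⁻¹' (r '' {x | P x}) := by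
    ext x
    constructor
    · exact fun hx => ⟨x, hx, rfl⟩
    · rintro ⟨y, hy, hyx⟩
      exact h y x (fun i hi => congrFun hyx ⟨i, hi⟩) hy
  rw [this]
  exact hr (Set.toFinite _).measurableSet

theorem measurableSet_gadget (s : List ℕ) (θ : ℕ) : MeasurableSet {x | Gadget f x s θ} :=
  measurableSet_of_forall_lt s.length fun _ _ hxy ⟨u, hu, hc⟩ =>
    ⟨u, hu, hc.congr (fun _ _ => rfl) hxy fun _ _ => le_rfl⟩

theorem measurableSet_valid (v : Node) : MeasurableSet {x | Valid (Gadget f x) v} := by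
  rcases v with s | ⟨s, k⟩ | ⟨s, θ, i⟩ | ⟨s, θ⟩ | ⟨s, θ⟩
  · exact MeasurableSet.const _
  · exact MeasurableSet.const _
  · exact (measurableSet_gadget s θ).inter (MeasurableSet.const _)
  · exact measurableSet_gadget s θ
  · exact measurableSet_gadget s θ

theorem infinite_valid (P : List ℕ → ℕ → Prop) : {v | Valid P v}.Infinite :=
  Set.infinite_of_injective_forall_mem (f := fun s : List ℕ => seq s) (fun s t h => by simpa using h)
    fun _ => trivial

/-- The part of the graph `Node.graph` that is given by `P`, as a tree with vertex set `ℕ` by means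
of a bijection. -/
def combTreeOfValid {P : List ℕ → ℕ → Prop} (b : ℕ ≃ {v | Valid P v}) : CombTree :=
  ⟨graph.comap (b.toEmbedding.trans (Function.Embedding.subtype _)), by
    refine isTree_comap_parentGraph _ (b.symm ⟨seq [], trivial⟩) (fun n hn => ?_) fun n w hw => ?_
    · rw [Equiv.eq_symm_apply]
      refine Subtype.ext ?_
      change parent (b n : Node) = none at hn
      generalize (b n : Node) = v at hn
      rcases v with (_ | ⟨k, s⟩) | ⟨s, k⟩ | ⟨s, θ, _ | i⟩ | ⟨s, θ⟩ | ⟨s, θ⟩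
      · rfl
      all_goals simp [parent] at hn
    · have hv : Valid P w := (b n).2.parent hw
      exact ⟨b.symm ⟨w, hv⟩, congrArg Subtype.val (b.apply_symm_apply ⟨w, hv⟩)⟩⟩

theorem combTreeOfValid_adj {P : List ℕ → ℕ → Prop} (b : ℕ ≃ {v | Valid P v}) {m n : ℕ} :
    (combTreeOfValid b).1.Adj m n ↔ graph.Adj (b m : Node) (b n : Node) := Iff.rfl

/-- As the graphs are trees, injective homomorphisms are the same as embeddings. -/
theorem embeds_combTreeOfValid_iff {P Q : List ℕ → ℕ → Prop} (b : ℕ ≃ {v | Valid P v})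
    (c : ℕ ≃ {v | Valid Q v}) :
    CombTree.Embeds (combTreeOfValid b) (combTreeOfValid c) ↔ ∃ F, IsEmbedding P Q F := by
  classical
  constructor
  · rintro ⟨φ⟩
    have key : ∀ v (hv : Valid P v), (b (b.symm ⟨v, hv⟩) : Node) = v := fun v hv => by simp
    let F : Node → Node := fun v => if hv : Valid P v then c (φ (b.symm ⟨v, hv⟩)) else v
    have hF : ∀ v (hv : Valid P v), F v = c (φ (b.symm ⟨v, hv⟩)) := fun v hv => dif_pos hv
    refine ⟨F, fun v hv => ?_, fun v w hv hw h => ?_, fun v w hv hw h => ?_⟩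
    · rw [hF v hv]
      exact (c _).2
    · rw [hF v hv, hF w hw] at h
      have := b.symm.injective (φ.injective (c.injective (Subtype.ext h)))
      exact congrArg Subtype.val this
    · rw [hF v hv, hF w hw, ← combTreeOfValid_adj, φ.map_adj_iff, combTreeOfValid_adj, key, key]
      exact h
  · rintro ⟨F, hF⟩
    let g : ℕ → ℕ := fun n => c.symm ⟨F (b n), hF.valid _ (b n).2⟩
    have hg : ∀ n, (c (g n) : Node) = F (b n) := fun n => by simp [g]
    have hinj : Function.Injective g := fun m n h => by
      have h1 : F (b m) = F (b n) := by rw [← hg, ← hg, h]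
      exact b.injective (Subtype.ext (hF.inj _ _ (b m).2 (b n).2 h1))
    have hadj : ∀ {m n}, (combTreeOfValid b).1.Adj m n → (combTreeOfValid c).1.Adj (g m) (g n) := by
      intro m n h
      rw [combTreeOfValid_adj, hg, hg]
      exact hF.adj _ _ (b m).2 (b n).2 h
    exact ⟨⟨⟨g, hinj⟩, fun {m n} => ⟨fun h => SimpleGraph.Hom.adj_of_adj (combTreeOfValid b).2.1
      (combTreeOfValid c).2.2 ⟨g, fun h => hadj h⟩ hinj h, fun h => hadj h⟩⟩⟩

theorem measurable_combTree {X : Type*} [MeasurableSpace X] {g : X → CombTree}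
    (h : ∀ m n, MeasurableSet {x | (g x).1.Adj m n}) : Measurable g := by
  refine Measurable.subtype_mk (f := fun x => (g x).1) (measurable_comap_iff.2 ?_)
  exact measurable_pi_iff.2 fun m => measurable_pi_iff.2 fun n => measurableSet_setOfPred.1 (h m n)

/-- An analytic quasi-order is transported to the Cantor space by a Borel injection; there it
becomes, up to equality, the range of a continuous map on the Baire space. -/
theorem exists_forall_iff_eq_or_mem_range {Y : Type*} [MeasurableSpace Y] [StandardBorelSpace Y]
    [Nonempty Y] {R : Y → Y → Prop} (hR : IsAnalyticQuasiOrder R) :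
    ∃ (e : Y → ℕ → Bool) (f : (ℕ → ℕ) → (ℕ → Bool) × (ℕ → Bool)), Measurable e ∧ Continuous f ∧
      (∀ x y z, (x, y) ∈ Set.range f → (y, z) ∈ Set.range f → (x, z) ∈ Set.range f) ∧
      ∀ u w, R u w ↔ e u = e w ∨ (e u, e w) ∈ Set.range f := by
  obtain ⟨e, he, hinj⟩ := MeasurableSpace.measurable_injection_nat_bool_of_countablySeparated Y
  obtain ⟨Z, _, _, _, _, B, hB, hRB⟩ := hR.analytic
  let E : (Y × Y) × Z → (ℕ → Bool) × (ℕ → Bool) := fun z => (e z.1.1, e z.1.2)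
  have hE : Measurable E := (he.comp (measurable_fst.comp measurable_fst)).prodMk
    (he.comp (measurable_snd.comp measurable_fst))
  have hA := hB.analyticSet_image hE
  have hmem : ∀ x y, (x, y) ∈ E '' B ↔ ∃ u w, R u w ∧ e u = x ∧ e w = y := by
    intro x y
    constructor
    · rintro ⟨⟨⟨u, w⟩, z⟩, hz, h⟩
      have : (u, w) ∈ {z : Y × Y | R z.1 z.2} := by
        rw [hRB]
        exact ⟨z, hz⟩
      exact ⟨u, w, this, (Prod.mk.inj h).1, (Prod.mk.inj h).2⟩
    · rintro ⟨u, w, huw, rfl, rfl⟩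
      have : (u, w) ∈ {z : Y × Y | R z.1 z.2} := huw
      rw [hRB] at this
      obtain ⟨z, hz⟩ := this
      exact ⟨((u, w), z), hz, rfl⟩
  rw [MeasureTheory.AnalyticSet] at hA
  rcases hA with hA | ⟨f, hf, hfr⟩
  · obtain ⟨y⟩ := ‹Nonempty Y›
    have := (hmem (e y) (e y)).2 ⟨y, y, hR.refl y, rfl, rfl⟩
    rw [hA] at this
    exact this.elim
  · refine ⟨e, f, he, hf, ?_, fun u w => ?_⟩
    · rw [hfr]
      intro x y z hxy hyz
      obtain ⟨u, w, huw, rfl, rfl⟩ := (hmem x y).1 hxy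
      obtain ⟨u', w', huw', h, rfl⟩ := (hmem _ z).1 hyz
      rw [hinj h] at huw'
      exact (hmem _ _).2 ⟨u, w', hR.trans _ _ _ huw huw', rfl, rfl⟩
    · rw [hfr]
      constructor
      · exact fun h => Or.inr ((hmem _ _).2 ⟨u, w, h, rfl, rfl⟩)
      · rintro (h | h)
        · rw [hinj h]
          exact hR.refl w
        · obtain ⟨u', w', h1, h2, h3⟩ := (hmem _ _).1 h
          rwa [hinj h2, hinj h3] at h1

/-- Every analytic quasi-order is Borel reducible to the embeddability of trees. -/
theorem IsAnalyticQuasiOrder.exists_isBorelReduction_combTree {Y : Type*} [MeasurableSpace Y]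
    [StandardBorelSpace Y] {R : Y → Y → Prop} (hR : IsAnalyticQuasiOrder R) :
    ∃ g : Y → CombTree, IsBorelReduction R CombTree.Embeds g := by
  rcases isEmpty_or_nonempty Y with hY | hY
  · exact ⟨fun y => isEmptyElim y, measurable_of_empty _, fun y => isEmptyElim y⟩
  obtain ⟨e, f, he, hf, htrans, hRf⟩ := exists_forall_iff_eq_or_mem_range hR
  obtain ⟨b, hb⟩ := exists_measurable_enumeration (fun y => {v | Valid (Gadget f (e y)) v})
    (fun v => he (measurableSet_valid v)) fun y => infinite_valid _
  refine ⟨fun y => combTreeOfValid (b y), measurable_combTree fun m n => ?_, fun u w => ?_⟩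
  · have : {y | (combTreeOfValid (b y)).1.Adj m n} = ⋃ (v : Node), ⋃ (w : Node),
        {y | (b y m : Node) = v} ∩ {y | (b y n : Node) = w} ∩ {_y | graph.Adj v w} := by
      ext y
      simp [combTreeOfValid_adj]
    rw [this]
    exact .iUnion fun v => .iUnion fun w => ((hb m v).inter (hb n w)).inter (MeasurableSet.const _)
  · rw [hRf, ← exists_forall_chain_iff hf htrans, embeds_combTreeOfValid_iff]
    exact ⟨fun ⟨a, ha⟩ => ⟨_, isEmbedding_shiftNode_of_chain ha⟩,
      fun ⟨F, hF⟩ => exists_forall_chain_of_isEmbedding hF⟩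

end Reduction

/-! ### Embeddability of fields is a complete analytic quasi-order -/

section Analytic

theorem Fld.embeds_iff {p : ℕ} {K L : Fld p} : Fld.Embeds K L ↔ ∃ φ : ℕ → ℕ,
    (∀ a b, φ (K.1.add a b) = L.1.add (φ a) (φ b)) ∧ (∀ a b, φ (K.1.mul a b) = L.1.mul (φ a) (φ b)) ∧
    φ K.1.zero = L.1.zero ∧ φ K.1.one = L.1.one := by
  constructor
  · rintro ⟨φ⟩
    exact ⟨φ, fun a b => φ.map_add a b, fun a b => φ.map_mul a b, φ.map_zero, φ.map_one⟩
  · rintro ⟨φ, h1, h2, h3, h4⟩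
    exact ⟨{ toFun := φ, map_add' := h1, map_mul' := h2, map_zero' := h3, map_one' := h4 }⟩

/-- Embeddability is the projection of the Borel set of all triples of two fields and a
homomorphism. -/
theorem isAnalyticQuasiOrder_fldEmbeds (p : ℕ) : IsAnalyticQuasiOrder (Fld.Embeds (p := p)) where
  refl K := ⟨RingHom.id _⟩
  trans K L M := fun ⟨φ⟩ ⟨ψ⟩ => ⟨ψ.comp φ⟩
  analytic := by
    let X := (Fld p × Fld p) × (ℕ → ℕ)
    have hK : Measurable fun z : X => z.1.1.1 :=
      measurable_subtype_coe.comp (measurable_fst.comp measurable_fst)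
    have hL : Measurable fun z : X => z.1.2.1 :=
      measurable_subtype_coe.comp (measurable_snd.comp measurable_fst)
    have hφ : ∀ {g : X → ℕ}, Measurable g → Measurable fun z : X => z.2 (g z) := by
      intro g hg
      have h : Measurable fun w : X × ℕ => w.1.2 w.2 :=
        measurable_from_prod_countable_left fun k => (measurable_pi_apply k).comp measurable_snd
      exact h.comp (measurable_id.prodMk hg)
    have ev : ∀ {o : X → ℕ → ℕ → ℕ} {g h : X → ℕ}, (∀ a b, Measurable fun z => o z a b) →
        Measurable g → Measurable h → Measurable fun z => o z (g z) (h z) := by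
      intro o g h ho hg hh
      have hk : Measurable fun w : X × (ℕ × ℕ) => o w.1 w.2.1 w.2.2 :=
        measurable_from_prod_countable_left fun k => ho k.1 k.2
      exact hk.comp (measurable_id.prodMk (hg.prodMk hh))
    have hadd : ∀ {c : X → FieldStr}, Measurable c → ∀ a b, Measurable fun z => (c z).add a b :=
      fun hc a b => (measurable_pi_apply b).comp ((measurable_pi_apply a).comp
        (measurable_fst.comp hc))
    have hmul : ∀ {c : X → FieldStr}, Measurable c → ∀ a b, Measurable fun z => (c z).mul a b :=
      fun hc a b => (measurable_pi_apply b).comp ((measurable_pi_apply a).comp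
        (measurable_fst.comp (measurable_snd.comp hc)))
    have hzero : ∀ {c : X → FieldStr}, Measurable c → Measurable fun z => (c z).zero :=
      fun hc => measurable_fst.comp (measurable_snd.comp (measurable_snd.comp hc))
    have hone : ∀ {c : X → FieldStr}, Measurable c → Measurable fun z => (c z).one :=
      fun hc => measurable_snd.comp (measurable_snd.comp (measurable_snd.comp hc))
    have hall : ∀ {P : ℕ → ℕ → X → Prop}, (∀ a b, MeasurableSet {z | P a b z}) →
        MeasurableSet {z | ∀ a b, P a b z} := by
      intro P hP
      simp only [Set.ofPred_forall]
      exact .iInter fun a => .iInter fun b => hP a b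
    refine ⟨ℕ → ℕ, inferInstance, inferInstance, inferInstance, inferInstance,
      {z : X | (∀ a b, z.2 (z.1.1.1.add a b) = z.1.2.1.add (z.2 a) (z.2 b)) ∧
        (∀ a b, z.2 (z.1.1.1.mul a b) = z.1.2.1.mul (z.2 a) (z.2 b)) ∧
        z.2 z.1.1.1.zero = z.1.2.1.zero ∧ z.2 z.1.1.1.one = z.1.2.1.one}, ?_, ?_⟩
    · refine .inter ?_ (.inter ?_ (.inter ?_ ?_))
      · exact hall fun a b => measurableSet_eq_fun (hφ (hadd hK a b))
          (ev (hadd hL) (hφ measurable_const) (hφ measurable_const))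
      · exact hall fun a b => measurableSet_eq_fun (hφ (hmul hK a b))
          (ev (hmul hL) (hφ measurable_const) (hφ measurable_const))
      · exact measurableSet_eq_fun (hφ (hzero hK)) (hzero hL)
      · exact measurableSet_eq_fun (hφ (hone hK)) (hone hL)
    · ext ⟨K, L⟩
      exact Fld.embeds_iff

end Analytic

section Complete

theorem IsBorelReduction.comp {X Y Z : Type*} [MeasurableSpace X] [StandardBorelSpace X]
    [MeasurableSpace Y] [StandardBorelSpace Y] [MeasurableSpace Z] [StandardBorelSpace Z]
    {P : X → X → Prop} {Q : Y → Y → Prop} {R : Z → Z → Prop} {g : Y → Z} {f : X → Y}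
    (hg : IsBorelReduction Q R g) (hf : IsBorelReduction P Q f) : IsBorelReduction P R (g ∘ f) :=
  ⟨hg.measurable.comp hf.measurable, fun x y => (hf.iff x y).trans (hg.iff _ _)⟩

theorem exists_strictMono_primes (p : ℕ) : ∃ q : ℕ → ℕ, StrictMono q ∧ (∀ n, (q n).Prime) ∧
    (∀ n, Odd (q n)) ∧ ∀ n, q n ≠ p := by
  let P : ℕ → Prop := fun n => n.Prime ∧ n ≠ 2 ∧ n ≠ p
  have hinf : {n | P n}.Infinite := by
    have : {n | P n} = {n | n.Prime} \ {2, p} := by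
      ext n
      simp [P]
    rw [this]
    exact Nat.infinite_setOfPred_prime.sdiff (Set.toFinite _)
  have h := fun n => Nat.nth_mem_of_infinite hinf n
  exact ⟨Nat.nth P, Nat.nth_strictMono hinf, fun n => (h n).1,
    fun n => (h n).1.odd_of_ne_two (h n).2.1, fun n => (h n).2.2⟩

/-- A field of characteristic `p` that is equal to its prime field satisfies the assumptions of the
construction of the fields `K_T`. -/
theorem exists_isBorelReduction_fld_of_forall_mem_bot {p : ℕ} (hp : p = 0 ∨ (p.Prime ∧ Odd p))
    (F : Type*) [Field F] [Countable F] [CharP F p] (hF : ∀ x : F, x ∈ (⊥ : Subfield F)) :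
    ∃ f : CombTree → Fld p, IsBorelReduction CombTree.Embeds Fld.Embeds f := by
  obtain ⟨q, hmono, hprime, hodd, hne⟩ := exists_strictMono_primes p
  obtain ⟨f, -, hf⟩ := FriedKollar.exists_isBorelReduction (F := F) (p := p)
    (FriedKollar.admissible_of hp hmono.injective hprime hodd hne)
    fun k _ => isAlgebraic_algebraMap (⟨k, hF k⟩ : (⊥ : Subfield F))
  exact ⟨f, hf⟩

theorem exists_isBorelReduction_fld {p : ℕ} (hp : p = 0 ∨ (p.Prime ∧ Odd p)) :
    ∃ f : CombTree → Fld p, IsBorelReduction CombTree.Embeds Fld.Embeds f := by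
  rcases hp with rfl | hp
  · exact exists_isBorelReduction_fld_of_forall_mem_bot (Or.inl rfl) ℚ fun x => by
      simpa using SubfieldClass.ratCast_mem (⊥ : Subfield ℚ) x
  · have : Fact p.Prime := ⟨hp.1⟩
    exact exists_isBorelReduction_fld_of_forall_mem_bot (Or.inr hp) (ZMod p) fun x => by
      simpa using natCast_mem (⊥ : Subfield (ZMod p)) x.val

end Complete

theorem mainTheorem4 (p : ℕ) (hp : p = 0 ∨ (p.Prime ∧ Odd p)) :
    (∀ (F : Type u) [Field F] [Countable F] [CharP F p] (q : ℕ → ℕ),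
      StrictMono q → (∀ n, (q n).Prime) → (∀ n, Odd (q n)) → (∀ n, q n ≠ p) →
      (∀ n (k : F), IsHigh (q n) k → IsAlgebraic (⊥ : Subfield F) k) →
      ∃ f : CombTree → Fld p,
        (∀ T, Nonempty ((f T).Carrier ≃+* FriedKollar.KTree F q T)) ∧
        IsBorelReduction CombTree.Embeds Fld.Embeds f) ∧
    IsCompleteAnalyticQuasiOrder.{0, w} (Fld.Embeds (p := p)) := by
  refine ⟨fun F _ _ _ q hmono hprime hodd hne hhigh => ?_, isAnalyticQuasiOrder_fldEmbeds p,
    fun Y _ _ R hR => ?_⟩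
  · exact FriedKollar.exists_isBorelReduction
      (FriedKollar.admissible_of hp hmono.injective hprime hodd hne) (hhigh 1)
  · obtain ⟨f, hf⟩ := exists_isBorelReduction_fld hp
    obtain ⟨g, hg⟩ := hR.exists_isBorelReduction_combTree
    exact ⟨f ∘ g, hf.comp hg⟩
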